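/- A rooted planar map is a connected planar multigraph embedded in the sphere with one oriented edge (the root edge) distinguished, up to orientation-preserving homeomorphism; its root vertex is the origin of the root edge and its outer face is the face to the right of the root edge. The map consisting of a single vertex is also regarded as rooted. A rooted map is outerplanar if it is simple (no loops, no multiple edges) and every vertex lies on the boundary of the outer face. A map is non-separable if it has at least one edge and removing any vertex does not disconnect it. Every maximal non-separable submap (block) of a rooted outerplanar map inherits a root: its root vertex is its vertex nearest to the root vertex of the map, and its root edge is its edge leaving that vertex with the outer face of the map on the right. Let $\mathcal{C}^s$ be a non-empty class of non-separable rooted outerplanar maps, and let $\mathcal{M}^s$ be the class of all rooted outerplanar maps all of whose blocks belong to $\mathcal{C}^s$. Let $|\mathcal{M}^s_n|$ be the number of maps in $\mathcal{M}^s$ with $n$ vertices. Let $\varphi(z)$ be the power series whose coefficient $[z^k]\varphi(z)$ is the number of maps in $\mathcal{C}^s$ with $k$ vertices, let $\phi(z)=1/(1-\varphi(z)/z)$, let $\rho_\phi$ be the radius of convergence of $\phi$ (it is positive), let $\psi(t)=t\phi'(t)/\phi(t)$, and let $\nu=\lim_{t\nearrow\rho_\phi}\psi(t)\in[0,\infty]$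 (the limit exists). Let $\mathbf{s}$ be the greatest common divisor of all integers $i$ with $[z^i]\phi(z)\neq 0$. If $\nu\ge 1$, then there is a unique $\tau\in\,]0,\rho_\phi]$ with $\psi(\tau)=1$, and if $\phi''(\tau)<\infty$ (which is automatic when $\nu>1$), then $$|\mathcal{M}^s_n|\sim \mathbf{s}\left(\frac{\phi(\tau)}{2\pi\phi''(\tau)}\right)^{1/2}\left(\frac{\tau}{\phi(\tau)}\right)^{-n}n^{-3/2}$$ as $n\to\infty$ with $n\equiv 1 \bmod \mathbf{s}$. If $\phi''(\tau)=\infty$ (which is possible only for $\nu=1$, $\tau=\rho_\phi$), so that the constant on the right-hand side is $0$, the formula is understood as $|\mathcal{M}^s_n|=o\big((\tau/\phi(\tau))^{-n}n^{-3/2}\big)$ as $n\to\infty$ with $n\equiv 1\bmod\mathbf{s}$. -/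

import Mathlib

open Filter Topology Asymptotics
open scoped PowerSeries

noncomputable section

/-- A finite combinatorial map: a system of darts (oriented edges) with the permutation `rot`
(the next dart in counterclockwise order around the origin of a dart) and the fixed-point-free
involution `rev` (orientation reversal). Connectedness and planarity are separate predicates. -/
structure CombMap : Type 1 where
  Dart : Type
  finite : Finite Dart
  rot : Equiv.Perm Dart
  rev : Equiv.Perm Dart
  rev_rev : ∀ x, rev (rev x) = x
  rev_ne : ∀ x, rev x ≠ x

namespace CombMap

attribute [instance] CombMap.finite

variable (M : CombMap)

/-- The permutation whose cycles are the boundary walks of the faces: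
the cycle of a dart `x` is the face to the right of `x`. -/
def facePerm : Equiv.Perm M.Dart := M.rot * M.rev

def Vertex : Type := Quotient (Equiv.Perm.SameCycle.setoid M.rot)

def Edge : Type := Quotient (Equiv.Perm.SameCycle.setoid M.rev)

def Face : Type := Quotient (Equiv.Perm.SameCycle.setoid M.facePerm)

/-- The origin of a dart. -/
def src (x : M.Dart) : M.Vertex := Quotient.mk _ x

/-- The right face of a dart. -/
def rightFace (x : M.Dart) : M.Face := Quotient.mk _ x

/-- The underlying graph (loops and multiplicities of edges are forgotten). -/
def graph : SimpleGraph M.Vertex where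
  Adj u v := u ≠ v ∧ ∃ x, M.src x = u ∧ M.src (M.rev x) = v
  symm := by
    constructor
    rintro u v ⟨h, x, hu, hv⟩
    exact ⟨h.symm, M.rev x, hv, by rw [M.rev_rev]; exact hu⟩
  loopless := ⟨fun _ h => h.1 rfl⟩

def numVertices : ℕ := Nat.card M.Vertex

/-- A planar map (with at least one edge): connected and of genus zero, by Euler's formula. -/
def IsPlanar : Prop :=
  M.graph.Connected ∧ Nat.card M.Vertex + Nat.card M.Face = Nat.card M.Edge + 2

/-- No loops and no multiple edges. -/
def IsSimple : Prop :=
  (∀ x, M.src x ≠ M.src (M.rev x)) ∧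
    ∀ x y, M.src x = M.src y → M.src (M.rev x) = M.src (M.rev y) → x = y

/-- At least one edge, connected, and removing any vertex does not disconnect the map. -/
def IsNonseparable : Prop :=
  Nonempty M.Dart ∧ M.graph.Connected ∧
    ∀ v : M.Vertex, (M.graph.induce ({v}ᶜ : Set M.Vertex)).Preconnected

variable {M}

theorem exists_return {S : Set M.Dart} (x : S) : ∃ k : ℕ, 0 < k ∧ (M.rot ^ k) x.1 ∈ S :=
  ⟨orderOf M.rot, orderOf_pos _, by rw [pow_orderOf_eq_one]; exact x.2⟩

open Classical in
/-- The first dart of `S` met after `x` when turning counterclockwise around the origin of `x`. -/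
def firstReturn (S : Set M.Dart) (x : S) : S :=
  ⟨(M.rot ^ Nat.find (exists_return x)) x.1, (Nat.find_spec (exists_return x)).2⟩

theorem firstReturn_injective (S : Set M.Dart) : Function.Injective (firstReturn S) := by
  classical
  have key : ∀ x y : S, Nat.find (exists_return x) ≤ Nat.find (exists_return y) →
      firstReturn S x = firstReturn S y → x = y := by
    intro x y hle h
    have h1 : (M.rot ^ Nat.find (exists_return x)) x.1 =
        (M.rot ^ Nat.find (exists_return y)) y.1 := congrArg Subtype.val h
    obtain ⟨d, hd⟩ := Nat.exists_eq_add_of_le hle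
    rw [hd, pow_add, Equiv.Perm.mul_apply] at h1
    have h2 := (M.rot ^ Nat.find (exists_return x)).injective h1
    rcases Nat.eq_zero_or_pos d with h0 | hpos
    · subst h0
      exact Subtype.ext (by simpa using h2)
    · have hx := (Nat.find_spec (exists_return x)).1
      exact absurd ⟨hpos, h2 ▸ x.2⟩ (Nat.find_min (exists_return y) (m := d) (by omega))
  intro x y h
  rcases le_total (Nat.find (exists_return x)) (Nat.find (exists_return y)) with hle | hle
  · exact key x y hle h
  · exact (key y x hle h.symm).symm

variable (M)

/-- The submap formed by the edges whose darts lie in `S` (a set closed under reversal) and their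
end vertices, with the embedding inherited from `M`: the darts outside `S` are skipped
in the rotation. -/
def submap (S : Set M.Dart) (hS : ∀ x ∈ S, M.rev x ∈ S) : CombMap where
  Dart := S
  finite := inferInstance
  rot := Equiv.ofBijective (firstReturn S)
    (Finite.injective_iff_bijective.1 (firstReturn_injective S))
  rev :=
    { toFun := fun x => ⟨M.rev x.1, hS x.1 x.2⟩
      invFun := fun x => ⟨M.rev x.1, hS x.1 x.2⟩
      left_inv := fun x => Subtype.ext (M.rev_rev x.1)
      right_inv := fun x => Subtype.ext (M.rev_rev x.1) }
  rev_rev := fun x => Subtype.ext (M.rev_rev x.1)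
  rev_ne := fun x h => M.rev_ne x.1 (congrArg Subtype.val h)

/-- `S` is the dart set of a maximal non-separable submap (a block). -/
def IsBlock (S : Set M.Dart) : Prop :=
  Maximal (fun T => ∃ hT : ∀ x ∈ T, M.rev x ∈ T, (M.submap T hT).IsNonseparable) S

end CombMap

/-- A map with at least one edge, rooted at a dart. The outer face is the face to the right of
the root dart. -/
structure RootedMap : Type 1 extends CombMap where
  root : Dart

namespace RootedMap

/-- Isomorphism of rooted maps, i.e. equivalence under an orientation-preserving homeomorphism
that respects the root. -/
def Iso (M N : RootedMap) : Prop :=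
  ∃ e : M.Dart ≃ N.Dart, (∀ x, e (M.rot x) = N.rot (e x)) ∧
    (∀ x, e (M.rev x) = N.rev (e x)) ∧ e M.root = N.root

instance isoSetoid : Setoid RootedMap where
  r := Iso
  iseqv :=
    { refl := fun M => ⟨Equiv.refl _, fun _ => rfl, fun _ => rfl, rfl⟩
      symm := by
        rintro M N ⟨e, h1, h2, h3⟩
        refine ⟨e.symm, fun x => ?_, fun x => ?_, ?_⟩
        · rw [Equiv.symm_apply_eq, h1, Equiv.apply_symm_apply]
        · rw [Equiv.symm_apply_eq, h2, Equiv.apply_symm_apply]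
        · rw [Equiv.symm_apply_eq, h3]
      trans := by
        rintro M N P ⟨e, h1, h2, h3⟩ ⟨f, k1, k2, k3⟩
        exact ⟨e.trans f, fun x => by simp [h1, k1], fun x => by simp [h2, k2],
          by simp [h3, k3]⟩ }

/-- A rooted map is outerplanar if it is planar, simple, and every vertex lies on the boundary
of the outer face. -/
def IsOuterplanar (M : RootedMap) : Prop :=
  M.IsPlanar ∧ M.IsSimple ∧
    ∀ v : M.Vertex, ∃ x, M.src x = v ∧ M.rightFace x = M.rightFace M.root

/-- The dart `x` is the root that the block with dart set `S` inherits from the outerplanar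
map `M`: its origin is the vertex of the block nearest to the root vertex of `M`, and the outer
face lies to its right. -/
def IsBlockRoot (M : RootedMap) (S : Set M.Dart) (x : M.Dart) : Prop :=
  x ∈ S ∧ M.rightFace x = M.rightFace M.root ∧
    ∀ y ∈ S, M.graph.dist (M.src M.root) (M.src x) ≤ M.graph.dist (M.src M.root) (M.src y)

end RootedMap

/-- Rooted maps with at least one edge, up to isomorphism. -/
abbrev RootedMapClass : Type 1 := Quotient RootedMap.isoSetoid

namespace OuterplanarClass

variable (C : Set RootedMapClass)

/-- Membership in the class of all outerplanar maps whose blocks, with their inherited roots,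
belong to `C` (for maps with at least one edge). -/
def Mem (M : RootedMap) : Prop :=
  M.IsOuterplanar ∧ ∀ (S : Set M.Dart) (hS : ∀ x ∈ S, M.rev x ∈ S), M.IsBlock S →
    ∃ (x : M.Dart) (hx : M.IsBlockRoot S x),
      (Quotient.mk _ { M.submap S hS with root := ⟨x, hx.1⟩ } : RootedMapClass) ∈ C

/-- The number of maps with `n` vertices, up to isomorphism, in the class of all rooted outerplanar
maps with blocks in `C`. The map consisting of a single vertex belongs to the class. -/
def count (n : ℕ) : ℕ :=
  ((Quotient.mk _ : RootedMap → RootedMapClass) ''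
    {M | Mem C M ∧ M.numVertices = n}).ncard + if n = 1 then 1 else 0

/-- The power series `φ_C(z)` whose `k`-th coefficient is the number of maps in `C`
with `k` vertices. -/
def blockSeries : ℝ⟦X⟧ := PowerSeries.mk fun k =>
  (((Quotient.mk _ : RootedMap → RootedMapClass) ''
    {M | (Quotient.mk _ M : RootedMapClass) ∈ C ∧ M.numVertices = k}).ncard : ℝ)

/-- The power series `φ(z) = 1 / (1 - φ_C(z) / z)`. -/
def phiSeries : ℝ⟦X⟧ :=
  (1 - PowerSeries.mk fun k => PowerSeries.coeff (k + 1) (blockSeries C))⁻¹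

/-- The radius of convergence of `φ` (finite as soon as `C` is non-empty). -/
def rho : ℝ :=
  (FormalMultilinearSeries.ofScalars ℝ fun k => PowerSeries.coeff k (phiSeries C)).radius.toReal

/-- The sum at `t` of the `j`-th derivative of `φ`. -/
def phiDeriv (j : ℕ) (t : ℝ) : ℝ :=
  ∑' k, PowerSeries.coeff k ((PowerSeries.derivative ℝ)^[j] (phiSeries C)) * t ^ k

/-- The `j`-th derivative of `φ` converges at `t`. -/
def PhiDerivSummable (j : ℕ) (t : ℝ) : Prop :=
  Summable fun k => PowerSeries.coeff k ((PowerSeries.derivative ℝ)^[j] (phiSeries C)) * t ^ k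

/-- `ψ(t) = t φ'(t) / φ(t)`. -/
def psi (t : ℝ) : ℝ := t * phiDeriv C 1 t / phiDeriv C 0 t

/-- `ν`, the limit of `ψ(t)` as `t` increases to the radius of convergence, in `[0, ∞]`. -/
def nu : EReal := limUnder (𝓝[<] rho C) fun t => (psi C t : EReal)

/-- The greatest common divisor of all `i` with `[z ^ i] φ(z) ≠ 0`. -/
def span : ℕ := Nat.setGcd {i | PowerSeries.coeff i (phiSeries C) ≠ 0}

end OuterplanarClass

end

/-!
An outerplanar map is either a single vertex or arises in a unique way from the block containing its
root edge by attaching a smaller rooted outerplanar map at each corner of the outer boundary of the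
block: the outer face visits each vertex of a block exactly once, so a block with `k` vertices has
`k` such corners. Hence the generating function `M` of the class satisfies `M = z + ∑ c_k M ^ k`
(`OuterplanarClass.count_eq`), that is `M = z φ(M)`, and Lagrange inversion gives
`n |M_n| = [t ^ (n - 1)] φ(t) ^ n` (`OuterplanarClass.natCast_mul_count`).

Planarity enters in the form `CombMap.isPlanar_iff`: Euler's formula says exactly that every
circulation on the darts is a combination of face boundaries. This yields discrete Jordan curves
(`CombMap.CyclesBound.exists_level`): a closed walk that follows the outer face and perhaps one
further edge has a level function which changes only across the walk. With it one cuts a map at a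
vertex which the outer face visits twice (`RootedMap.exists_decomposition`), and one sees that the
chords of a block do not cross and determine it. As non-crossing sets of arcs are determined by
their degrees, there are only exponentially many blocks (`OuterplanarClass.finite_blocks_and_le`),
so that `φ` has a positive radius of convergence.

As `ψ(t)` is the mean of the weights `[z ^ k] φ(z) * t ^ k`, it is strictly increasing, which gives
the limit `ν` and the uniqueness of `τ`; continuity gives existence. Tilting by `τ` turns `φ` into an
offspring distribution of mean `1`, and `[t ^ (n - 1)] φ(t) ^ n` into the probability that `n`
independent copies sum to `n - 1`. The local limit theorem for these lattice variables
(`tendsto_sqrt_mul_coeff_pow_of_variance`, `tendsto_sqrt_mul_coeff_pow_of_not_summable`) is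
proved by Fourier inversion and dominated convergence; since the distribution has an atom at `0`,
its characteristic function has a Gaussian bound on a full period without any moment
assumption, and without a second moment the rescaled integral tends to `0`.
-/

noncomputable section


/-! ### Vertices and connectivity in terms of darts -/

theorem sameCycle_induction {D : Type*} [Finite D] {σ : Equiv.Perm D} {P : D → Prop}
    (hP : ∀ d, P d → P (σ d)) {x y : D} (h : σ.SameCycle x y) (hx : P x) : P y := by
  obtain ⟨n, -, rfl⟩ := h.exists_pow_eq'
  have : ∀ n : ℕ, P ((σ ^ n) x) := by
    intro n
    induction n with
    | zero => simpa using hx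
    | succ n ih => rw [pow_succ', Equiv.Perm.mul_apply]; exact hP _ ih
  exact this n

theorem eq_of_sameCycle {D α : Type*} [Finite D] {σ : Equiv.Perm D} {f : D → α}
    (hf : ∀ d, f (σ d) = f d) {x y : D} (h : σ.SameCycle x y) : f y = f x :=
  sameCycle_induction (P := fun d => f d = f x) (fun d hd => (hf d).trans hd) h rfl

theorem exists_minimal_pow {D : Type*} [Finite D] {σ : Equiv.Perm D} {x y : D}
    (h : σ.SameCycle x y) : ∃ n : ℕ, (σ ^ n) x = y ∧ (∀ q < n, (σ ^ q) x ≠ y) ∧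
      ∀ q, 0 < q → q ≤ n → (σ ^ q) x ≠ x := by
  classical
  have hex : ∃ n : ℕ, (σ ^ n) x = y := by
    obtain ⟨n, -, hn⟩ := h.exists_pow_eq'
    exact ⟨n, hn⟩
  obtain ⟨hn, hmin⟩ := (Nat.find_eq_iff hex).1 rfl
  set n := Nat.find hex
  refine ⟨n, hn, fun q hq => hmin q hq, fun q h0 hq hx => hmin (n - q) (by omega) ?_⟩
  rw [← hn]
  conv_rhs => rw [← Nat.sub_add_cancel hq, pow_add, Equiv.Perm.mul_apply, hx]

namespace CombMap
variable {M : CombMap}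

instance : Fintype M.Dart := Fintype.ofFinite _

instance : Finite M.Vertex := inferInstanceAs (Finite (Quotient _))

theorem src_eq_src_iff {x y : M.Dart} : M.src x = M.src y ↔ M.rot.SameCycle x y :=
  Quotient.eq (r := Equiv.Perm.SameCycle.setoid M.rot)

theorem rightFace_eq_iff {x y : M.Dart} :
    M.rightFace x = M.rightFace y ↔ M.facePerm.SameCycle x y :=
  Quotient.eq (r := Equiv.Perm.SameCycle.setoid M.facePerm)

@[simp] theorem src_rot (x : M.Dart) : M.src (M.rot x) = M.src x :=
  src_eq_src_iff.2 (Equiv.Perm.sameCycle_apply_left.2 (.refl _ _))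

@[simp] theorem rightFace_facePerm (x : M.Dart) :
    M.rightFace (M.facePerm x) = M.rightFace x :=
  rightFace_eq_iff.2 (Equiv.Perm.sameCycle_apply_left.2 (.refl _ _))

theorem facePerm_apply (x : M.Dart) : M.facePerm x = M.rot (M.rev x) := rfl

theorem exists_src (v : M.Vertex) : ∃ x, M.src x = v := Quotient.exists_rep v

theorem src_facePerm (x : M.Dart) : M.src (M.facePerm x) = M.src (M.rev x) := src_rot _

theorem eq_of_src_eq {α : Type*} {f : M.Dart → α} (hf : ∀ d, f (M.rot d) = f d) {x y : M.Dart}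
    (h : M.src x = M.src y) : f x = f y :=
  (eq_of_sameCycle hf (src_eq_src_iff.1 h)).symm

/-- The group generated by the two permutations of a map acts transitively on the darts. -/
def DartConnected (M : CombMap) : Prop :=
  ∀ A : Set M.Dart, A.Nonempty → (∀ d ∈ A, M.rot d ∈ A) → (∀ d ∈ A, M.rev d ∈ A) → ∀ d, d ∈ A

theorem reachable_induction {V : Type*} {G : SimpleGraph V} {P : V → Prop}
    (hP : ∀ u v, G.Adj u v → P u → P v) {u v : V} (h : G.Reachable u v) (hu : P u) : P v := by
  obtain ⟨p⟩ := h
  induction p with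
  | nil => exact hu
  | cons h p ih => exact ih (hP _ _ h hu)

theorem adj_or_eq (x : M.Dart) :
    M.graph.Adj (M.src x) (M.src (M.rev x)) ∨ M.src x = M.src (M.rev x) := by
  by_cases h : M.src x = M.src (M.rev x)
  · exact .inr h
  · exact .inl ⟨h, x, rfl, rfl⟩

theorem connected_iff : M.graph.Connected ↔ Nonempty M.Dart ∧ M.DartConnected := by
  constructor
  · intro h
    obtain ⟨v⟩ := h.nonempty
    obtain ⟨x, -⟩ := exists_src v
    refine ⟨⟨x⟩, fun A hA h1 h2 d => ?_⟩
    obtain ⟨a, ha⟩ := hA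
    have key : ∀ e f, M.src e = M.src f → e ∈ A → f ∈ A := fun e f hef he =>
      sameCycle_induction (P := (· ∈ A)) h1 (src_eq_src_iff.1 hef) he
    refine reachable_induction (P := fun v => ∀ d, M.src d = v → d ∈ A) ?_
      (h.preconnected (M.src a) (M.src d)) (fun e he => key a e he.symm ha) d rfl
    rintro u v ⟨-, y, hu, hv⟩ H e he
    exact key (M.rev y) e (hv.trans he.symm) (h2 _ (H y hu))
  · rintro ⟨⟨r⟩, h⟩
    have hr : ∀ d, d ∈ {d | M.graph.Reachable (M.src r) (M.src d)} := by
      refine h _ ⟨r, SimpleGraph.Reachable.refl _⟩ (fun d hd => ?_) (fun d hd => ?_)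
      · simpa using hd
      · rcases adj_or_eq d with h' | h'
        · exact SimpleGraph.Reachable.trans hd h'.reachable
        · simpa [← h'] using hd
    have : Nonempty M.Vertex := ⟨M.src r⟩
    refine ⟨fun u v => ?_⟩
    obtain ⟨x, rfl⟩ := exists_src u
    obtain ⟨y, rfl⟩ := exists_src v
    exact SimpleGraph.Reachable.trans (SimpleGraph.Reachable.symm (hr x)) (hr y)

theorem DartConnected.eq_of_invariant (h : M.DartConnected) {α : Type*} {f : M.Dart → α}
    (h1 : ∀ d, f (M.rot d) = f d) (h2 : ∀ d, f (M.rev d) = f d) (x y : M.Dart) : f x = f y :=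
  h {d | f d = f y} ⟨y, rfl⟩ (fun d hd => (h1 d).trans hd) (fun d hd => (h2 d).trans hd) x

/-- A function on vertices that changes by at most one along each edge bounds the distance. -/
theorem le_add_dist (hc : M.graph.Connected) {p : M.Dart → ℕ} (h1 : ∀ d, p (M.rot d) = p d)
    (h2 : ∀ d, p (M.rev d) ≤ p d + 1) (r d : M.Dart) :
    p d ≤ p r + M.graph.dist (M.src r) (M.src d) := by
  obtain ⟨w, hw⟩ := (hc.preconnected (M.src r) (M.src d)).exists_walk_length_eq_dist
  rw [← hw]
  have : ∀ {u v : M.Vertex} (w : M.graph.Walk u v) (r d : M.Dart), M.src r = u → M.src d = v →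
      p d ≤ p r + w.length := by
    intro u v w
    induction w with
    | nil => intro r d hr hd; simp [eq_of_src_eq h1 (hd.trans hr.symm)]
    | cons hadj w ih =>
      intro r d hr hd
      obtain ⟨y, hu, hv⟩ := hadj.2
      have := ih (M.rev y) d hv hd
      have h3 := h2 y
      rw [eq_of_src_eq h1 (hu.trans hr.symm)] at h3
      rw [SimpleGraph.Walk.length_cons]; omega
  exact this w r d rfl rfl

/-! ### Planarity as exactness: every cycle is a boundary -/

/-- Every flow `z` on the darts that is conserved at each vertex (orthogonality to the functions
of the vertex) is the boundary of a function `g` on the faces. For connected maps this is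
equivalent to Euler's formula, see `isPlanar_iff`, but it passes to submaps and to gluings
without any counting. -/
def CyclesBound (M : CombMap) : Prop :=
  ∀ z : M.Dart → ℝ, (∀ d, z (M.rev d) = - z d) →
    (∀ f : M.Dart → ℝ, (∀ d, f (M.rot d) = f d) → ∑ d, f d * z d = 0) →
    ∃ g : M.Dart → ℝ, (∀ d, g (M.facePerm d) = g d) ∧ ∀ d, z d = g d - g (M.rev d)

/-- The functions invariant under a permutation. -/
def invariants {D : Type*} (σ : Equiv.Perm D) : Submodule ℝ (EuclideanSpace ℝ D) where
  carrier := {f | ∀ d, f (σ d) = f d}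
  add_mem' := fun {f g} hf hg d => by simp [hf d, hg d]
  zero_mem' := fun d => rfl
  smul_mem' := fun c f hf d => by simp [hf d]

theorem finrank_invariants {D : Type*} [Fintype D] (σ : Equiv.Perm D) :
    Module.finrank ℝ (invariants σ) = Nat.card (Quotient (Equiv.Perm.SameCycle.setoid σ)) := by
  classical
  have : Fintype (Quotient (Equiv.Perm.SameCycle.setoid σ)) := Fintype.ofFinite _
  let e : (Quotient (Equiv.Perm.SameCycle.setoid σ) → ℝ) ≃ₗ[ℝ] invariants σ :=
    { toFun := fun f => ⟨WithLp.toLp 2 fun d => f (Quotient.mk _ d), fun d => by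
        have : (Quotient.mk (Equiv.Perm.SameCycle.setoid σ) (σ d)) = Quotient.mk _ d :=
          Quotient.sound (Equiv.Perm.sameCycle_apply_left.2 (.refl _ _))
        simp [this]⟩
      map_add' := fun f g => rfl
      map_smul' := fun c f => rfl
      invFun := fun f => Quotient.lift (fun d => f.1 d)
        (fun a b h => (eq_of_sameCycle f.2 h).symm)
      left_inv := fun f => by
        ext q; induction q using Quotient.inductionOn; rfl
      right_inv := fun f => rfl }
  rw [← e.finrank_eq, Module.finrank_fintype_fun_eq_card, Nat.card_eq_fintype_card]

variable (M)

/-- The antisymmetric functions on darts. -/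
def flows : Submodule ℝ (EuclideanSpace ℝ M.Dart) where
  carrier := {f | ∀ d, f (M.rev d) = - f d}
  add_mem' := fun {f g} hf hg d => by simp [hf d, hg d]; ring
  zero_mem' := fun d => by simp
  smul_mem' := fun c f hf d => by simp [hf d]

theorem finrank_flows : Module.finrank ℝ M.flows = Nat.card M.Edge := by
  classical
  have hrev : ∀ x y : M.Dart, M.rev.SameCycle x y → x = y ∨ x = M.rev y := by
    intro x y h
    exact (sameCycle_induction (σ := M.rev) (P := fun d => d = y ∨ d = M.rev y)
      (by rintro d (rfl | rfl)
          · exact .inr rfl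
          · exact .inl (M.rev_rev _)) h.symm (.inl rfl))
  -- a choice of one dart for each edge gives a nowhere vanishing antisymmetric sign
  let o : M.Dart → M.Dart := fun d => (Quotient.mk (Equiv.Perm.SameCycle.setoid M.rev) d).out
  have ho : ∀ d, o d = d ∨ o d = M.rev d := fun d =>
    hrev _ _ (Quotient.exact (s := Equiv.Perm.SameCycle.setoid M.rev) (Quotient.out_eq _))
  have ho2 : ∀ d, o (M.rev d) = o d := fun d => by
    have : (Quotient.mk (Equiv.Perm.SameCycle.setoid M.rev) (M.rev d)) = Quotient.mk _ d :=
      Quotient.sound (Equiv.Perm.sameCycle_apply_left.2 (.refl _ _))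
    simp only [o, this]
  let s : M.Dart → ℝ := fun d => if o d = d then 1 else -1
  have hs : ∀ d, s (M.rev d) = - s d := by
    intro d
    have h1 := M.rev_ne d
    rcases ho d with h | h
    · simp [s, ho2, h, h1.symm]
    · simp [s, ho2, h, h1]
  have hss : ∀ d, s d * s d = 1 := by
    intro d; simp only [s]; split_ifs <;> norm_num
  let e : invariants M.rev ≃ₗ[ℝ] M.flows :=
    { toFun := fun f => ⟨WithLp.toLp 2 fun d => s d * f.1 d, fun d => by
        have := f.2 d
        simp [hs, this]⟩
      map_add' := fun f g => by ext d; simp [mul_add]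
      map_smul' := fun c f => by ext d; simp; ring
      invFun := fun f => ⟨WithLp.toLp 2 fun d => s d * f.1 d, fun d => by
        have := f.2 d
        simp [hs, this]⟩
      left_inv := fun f => by ext d; simp [← mul_assoc, hss]
      right_inv := fun f => by ext d; simp [← mul_assoc, hss] }
  rw [← e.finrank_eq, finrank_invariants]
  rfl

/-- The map sending a function on darts to its difference along the edges. -/
def diff : EuclideanSpace ℝ M.Dart →ₗ[ℝ] EuclideanSpace ℝ M.Dart where
  toFun f := WithLp.toLp 2 fun d => f d - f (M.rev d)
  map_add' f g := by ext d; simp; ring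
  map_smul' c f := by ext d; simp; ring

theorem finrank_map_diff {σ : Equiv.Perm M.Dart} (hne : Nonempty M.Dart)
    (h : ∀ f : M.Dart → ℝ, (∀ d, f (σ d) = f d) → (∀ d, f (M.rev d) = f d) →
      ∀ x y, f x = f y) :
    Module.finrank ℝ ((invariants σ).map M.diff) + 1 =
      Nat.card (Quotient (Equiv.Perm.SameCycle.setoid σ)) := by
  classical
  obtain ⟨r⟩ := hne
  rw [← finrank_invariants, ← LinearMap.finrank_range_add_finrank_ker
    (M.diff.domRestrict (invariants σ)), LinearMap.range_domRestrict]
  congr 1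
  symm
  rw [finrank_eq_one_iff']
  have hmem : ∀ f : invariants σ, f ∈ LinearMap.ker (M.diff.domRestrict (invariants σ)) ↔
      ∀ d, f.1 d - f.1 (M.rev d) = 0 := by
    intro f
    rw [LinearMap.mem_ker, LinearMap.domRestrict_apply]
    constructor
    · intro h d
      exact congrFun (congrArg WithLp.ofLp h) d
    · intro h; ext d; exact h d
  refine ⟨⟨⟨WithLp.toLp 2 fun _ => (1 : ℝ), fun _ => rfl⟩, (hmem _).2 (by simp)⟩, ?_, ?_⟩
  · intro h0
    have : (1 : ℝ) = 0 := congrFun (congrArg (fun f => WithLp.ofLp f.1.1) h0) r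
    norm_num at this
  · intro w
    refine ⟨w.1.1 r, ?_⟩
    have hw := (hmem _).1 w.2
    ext d
    have := h (fun d => w.1.1 d) w.1.2 (fun d => by have := hw d; linarith) d r
    simp [this]

variable {M}

/-- The boundary of a function on faces is orthogonal to the coboundary of a function on
vertices. -/
theorem sum_mul_diff_eq_zero {f g : M.Dart → ℝ} (hf : ∀ d, f (M.rot d) = f d)
    (hg : ∀ d, g (M.facePerm d) = g d) : ∑ d, f d * (g d - g (M.rev d)) = 0 := by
  have h1 : ∑ d, f d * g (M.rev d) = ∑ d, f (M.rev d) * g d := by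
    rw [← Equiv.sum_comp M.rev]
    exact Finset.sum_congr rfl fun d _ => by rw [M.rev_rev]
  have h2 : ∑ d, f (M.rev d) * g d = ∑ d, f d * g d := by
    rw [← Equiv.sum_comp M.facePerm (fun d => f d * g d)]
    exact Finset.sum_congr rfl fun d _ => by rw [hg, facePerm_apply, hf]
  simp only [mul_sub, Finset.sum_sub_distrib, h1, h2, sub_self]

theorem isPlanar_iff_of_connected (hc : M.graph.Connected) : M.IsPlanar ↔ M.CyclesBound := by
  classical
  obtain ⟨hne, hdc⟩ := connected_iff.1 hc
  have hX := finrank_map_diff M (σ := M.rot) hne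
    (fun f h1 h2 => hdc.eq_of_invariant h1 h2)
  have hY := finrank_map_diff M (σ := M.facePerm) hne
    (fun f h1 h2 => hdc.eq_of_invariant (fun d => by
      have := h1 (M.rev d)
      rw [facePerm_apply, M.rev_rev] at this
      rw [this, h2]) h2)
  set W := (invariants M.rot).map M.diff with hW
  set U := (invariants M.facePerm).map M.diff with hU
  have hflow : ∀ f, M.diff f ∈ M.flows := fun f d => by simp [diff, M.rev_rev]
  have hWA : W ≤ M.flows := by rintro _ ⟨f, -, rfl⟩; exact hflow f
  have hinner : ∀ f z : EuclideanSpace ℝ M.Dart, z ∈ M.flows →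
      inner ℝ (M.diff f) z = 2 * ∑ d, f d * z d := by
    intro f z hz
    have h1 : ∑ d, f (M.rev d) * z d = - ∑ d, f d * z d := by
      rw [← Equiv.sum_comp M.rev, ← Finset.sum_neg_distrib]
      exact Finset.sum_congr rfl fun d _ => by rw [M.rev_rev, hz d]; ring
    simp only [PiLp.inner_apply, diff, LinearMap.coe_mk, AddHom.coe_mk]
    have : ∀ d, inner ℝ (f d - f (M.rev d)) (z d) = f d * z d - f (M.rev d) * z d := by
      intro d; simp; ring
    simp only [this, Finset.sum_sub_distrib, h1]; ring
  have hZ : ∀ z : EuclideanSpace ℝ M.Dart, z ∈ Wᗮ ⊓ M.flows ↔ z ∈ M.flows ∧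
      ∀ f : M.Dart → ℝ, (∀ d, f (M.rot d) = f d) → ∑ d, f d * z d = 0 := by
    intro z
    rw [Submodule.mem_inf, and_comm]
    refine and_congr_right fun hz => ?_
    rw [Submodule.mem_orthogonal]
    constructor
    · intro h f hf
      have := h (M.diff (WithLp.toLp 2 f)) ⟨_, hf, rfl⟩
      rw [hinner _ _ hz] at this
      simpa using this
    · rintro h _ ⟨f, hf, rfl⟩
      rw [hinner _ _ hz, h _ hf, mul_zero]
  have hUZ : U ≤ Wᗮ ⊓ M.flows := by
    rintro _ ⟨g, hg, rfl⟩
    exact (hZ _).2 ⟨hflow g, fun f hf => sum_mul_diff_eq_zero hf hg⟩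
  have hdim := Submodule.finrank_add_inf_finrank_orthogonal hWA
  rw [finrank_flows] at hdim
  have hiff : M.CyclesBound ↔ Wᗮ ⊓ M.flows ≤ U := by
    constructor
    · intro h z hz
      obtain ⟨h1, h2⟩ := (hZ z).1 hz
      obtain ⟨g, hg, hgz⟩ := h z h1 h2
      exact ⟨WithLp.toLp 2 g, hg, by ext d; exact (hgz d).symm⟩
    · intro h z h1 h2
      obtain ⟨g, hg, hgz⟩ := h ((hZ (WithLp.toLp 2 z)).2 ⟨h1, h2⟩)
      exact ⟨g, hg, fun d => (congrFun (congrArg WithLp.ofLp hgz) d).symm⟩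
  rw [hiff]
  change _ ∧ Nat.card (Quotient _) + Nat.card (Quotient _) = _ ↔ _
  rw [and_iff_right hc, ← hX, ← hY]
  constructor
  · intro h
    exact (Submodule.eq_of_le_of_finrank_eq hUZ (by omega)).ge
  · intro h
    rw [le_antisymm h hUZ] at hdim
    omega

theorem isPlanar_iff : M.IsPlanar ↔ M.graph.Connected ∧ M.CyclesBound :=
  ⟨fun h => ⟨h.1, (isPlanar_iff_of_connected h.1).1 h⟩,
    fun h => (isPlanar_iff_of_connected h.1).2 h.2⟩

end CombMap

namespace CombMap
variable {M : CombMap}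

/-! ### Submaps -/

/-- The point `b` is reached from `a` by iterating `σ`, with no intermediate point in `S`. -/
def ReachAvoiding {D : Type*} (σ : Equiv.Perm D) (S : Set D) (a b : D) : Prop :=
  ∃ k : ℕ, 0 < k ∧ (σ ^ k) a = b ∧ ∀ j, 0 < j → j < k → (σ ^ j) a ∉ S

theorem ReachAvoiding.single {D : Type*} {σ : Equiv.Perm D} {S : Set D} {a b : D}
    (h : σ a = b) : ReachAvoiding σ S a b :=
  ⟨1, one_pos, by simpa using h, fun j h1 h2 => by omega⟩

theorem ReachAvoiding.trans {D : Type*} {σ : Equiv.Perm D} {S : Set D} {a b c : D}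
    (h1 : ReachAvoiding σ S a b) (hb : b ∉ S) (h2 : ReachAvoiding σ S b c) :
    ReachAvoiding σ S a c := by
  obtain ⟨k, hk, rfl, hk2⟩ := h1
  obtain ⟨l, hl, rfl, hl2⟩ := h2
  refine ⟨l + k, by omega, by rw [pow_add, Equiv.Perm.mul_apply], fun j hj hjl => ?_⟩
  rcases lt_trichotomy j k with h | rfl | h
  · exact hk2 j hj h
  · exact hb
  · obtain ⟨i, rfl⟩ := Nat.exists_eq_add_of_lt h
    have := hl2 (i + 1) (by omega) (by omega)
    rwa [← Equiv.Perm.mul_apply, ← pow_add, show i + 1 + k = k + i + 1 by ring] at this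

theorem ReachAvoiding.mono {D : Type*} {σ : Equiv.Perm D} {S T : Set D} {a b : D}
    (h : ReachAvoiding σ S a b) (hT : T ⊆ S) : ReachAvoiding σ T a b := by
  obtain ⟨k, hk, hb, hk2⟩ := h
  exact ⟨k, hk, hb, fun j h1 h2 h3 => hk2 j h1 h2 (hT h3)⟩

theorem firstReturn_eq {S : Set M.Dart} {a : S} {b : M.Dart} (hb : b ∈ S)
    (h : ReachAvoiding M.rot S a b) : firstReturn S a = ⟨b, hb⟩ := by
  classical
  obtain ⟨k, hk, rfl, hk2⟩ := h
  have : Nat.find (exists_return a) = k :=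
    (Nat.find_eq_iff _).2 ⟨⟨hk, hb⟩, fun n hn h => hk2 n h.1 hn h.2⟩
  exact Subtype.ext (by simp [firstReturn, this])

theorem reachAvoiding_firstReturn {S : Set M.Dart} (a : S) :
    ReachAvoiding M.rot S a (firstReturn S a).1 := by
  classical
  refine ⟨Nat.find (exists_return a), (Nat.find_spec (exists_return a)).1, rfl,
    fun j h1 h2 h3 => Nat.find_min (exists_return a) h2 ⟨h1, h3⟩⟩

theorem src_firstReturn {S : Set M.Dart} (a : S) : M.src (firstReturn S a).1 = M.src a.1 := by
  obtain ⟨k, -, h, -⟩ := reachAvoiding_firstReturn a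
  rw [← h]
  exact (src_eq_src_iff.2 ⟨k, by simp⟩).symm

theorem submap_src_eq_iff {S : Set M.Dart} {hS : ∀ x ∈ S, M.rev x ∈ S}
    {x y : (M.submap S hS).Dart} :
    (M.submap S hS).src x = (M.submap S hS).src y ↔ M.src x.1 = M.src y.1 := by
  constructor
  · exact fun h => eq_of_src_eq (M := M.submap S hS) (f := fun x => M.src x.1)
      (fun d => src_firstReturn (M := M) d) h
  · intro h
    obtain ⟨n, -, hn⟩ := (src_eq_src_iff.1 h).exists_pow_eq'
    induction n using Nat.strong_induction_on generalizing x with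
    | _ n ih =>
      rcases Nat.eq_zero_or_pos n with rfl | hpos
      · rw [Subtype.ext (a1 := x) (a2 := y) hn]
      · obtain ⟨k, hk, hk1, hk2⟩ := reachAvoiding_firstReturn (M := M) x
        have hkn : k ≤ n := by
          by_contra hlt
          exact hk2 n hpos (by omega) (hn ▸ y.2)
        have h1 : (M.submap S hS).src ((M.submap S hS).rot x) = (M.submap S hS).src y := by
          refine ih (n - k) (by omega) (x := (M.submap S hS).rot x) ?_ ?_
          · exact (src_firstReturn (M := M) x).trans h
          · change (M.rot ^ (n - k)) (firstReturn S x).1 = _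
            rw [← hk1, ← Equiv.Perm.mul_apply, ← pow_add, Nat.sub_add_cancel hkn, hn]
        rwa [src_rot] at h1

/-- Isomorphism of unrooted maps. -/
def Iso (M N : CombMap) : Prop :=
  ∃ e : M.Dart ≃ N.Dart, (∀ x, e (M.rot x) = N.rot (e x)) ∧ ∀ x, e (M.rev x) = N.rev (e x)

theorem Iso.symm {M N : CombMap} (h : Iso M N) : Iso N M := by
  obtain ⟨e, h1, h2⟩ := h
  refine ⟨e.symm, fun x => ?_, fun x => ?_⟩
  · rw [Equiv.symm_apply_eq, h1, Equiv.apply_symm_apply]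
  · rw [Equiv.symm_apply_eq, h2, Equiv.apply_symm_apply]

theorem Iso.exists_graphIso {M N : CombMap} (h : Iso M N) : Nonempty (M.graph ≃g N.graph) := by
  obtain ⟨e, h1, h2⟩ := h
  have hsrc : ∀ x y, M.src x = M.src y ↔ N.src (e x) = N.src (e y) := by
    intro x y
    constructor
    · exact fun h => eq_of_src_eq (f := fun x => N.src (e x))
        (fun d => by rw [h1, src_rot]) h
    · intro h
      have := eq_of_src_eq (M := N) (f := fun x => M.src (e.symm x))
        (fun d => by
          obtain ⟨d, rfl⟩ := e.surjective d
          rw [← h1, e.symm_apply_apply, e.symm_apply_apply, src_rot]) h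
      simpa using this
  let f : M.Vertex → N.Vertex := Quotient.lift (fun x => N.src (e x))
    (fun a b h => (hsrc a b).1 (src_eq_src_iff.2 h))
  have hf : ∀ x, f (M.src x) = N.src (e x) := fun x => rfl
  have hbij : Function.Bijective f := by
    constructor
    · intro u v huv
      obtain ⟨x, rfl⟩ := exists_src u
      obtain ⟨y, rfl⟩ := exists_src v
      exact (hsrc x y).2 huv
    · intro v
      obtain ⟨y, rfl⟩ := exists_src v
      exact ⟨M.src (e.symm y), by rw [hf, e.apply_symm_apply]⟩
  refine ⟨⟨Equiv.ofBijective f hbij, ?_⟩⟩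
  intro u v
  change (f u ≠ f v ∧ ∃ x, N.src x = f u ∧ N.src (N.rev x) = f v) ↔
    (u ≠ v ∧ ∃ x, M.src x = u ∧ M.src (M.rev x) = v)
  rw [hbij.1.ne_iff]
  refine and_congr_right fun _ => ⟨?_, ?_⟩
  · rintro ⟨x, hu, hv⟩
    obtain ⟨x, rfl⟩ := e.surjective x
    rw [← h2] at hv
    exact ⟨x, hbij.1 hu, hbij.1 hv⟩
  · rintro ⟨x, rfl, rfl⟩
    exact ⟨e x, rfl, by rw [← h2]; rfl⟩

theorem Iso.isNonseparable {M N : CombMap} (h : Iso M N) (hM : M.IsNonseparable) :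
    N.IsNonseparable := by
  obtain ⟨g⟩ := h.exists_graphIso
  obtain ⟨e, -, -⟩ := h
  obtain ⟨⟨x⟩, hc, hp⟩ := hM
  refine ⟨⟨e x⟩, g.connected_iff.1 hc, fun v => ?_⟩
  have h1 := hp (g.symm v)
  let k : M.graph.induce ({g.symm v}ᶜ : Set M.Vertex) →g N.graph.induce ({v}ᶜ : Set N.Vertex) :=
    { toFun := fun u => ⟨g u.1, fun h => u.2 (by
        have h' : g u.1 = v := h
        exact (g.symm_apply_apply u.1).symm.trans (congrArg g.symm h'))⟩
      map_rel' := fun {a b} hab => g.map_adj_iff.2 hab }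
  intro a b
  have ha : (g.symm a.1) ∈ ({g.symm v}ᶜ : Set M.Vertex) := fun h => a.2 (g.symm.injective h)
  have hb : (g.symm b.1) ∈ ({g.symm v}ᶜ : Set M.Vertex) := fun h => b.2 (g.symm.injective h)
  have := (h1 ⟨_, ha⟩ ⟨_, hb⟩).map k
  have ea : k ⟨_, ha⟩ = a := Subtype.ext (g.apply_symm_apply a.1)
  have eb : k ⟨_, hb⟩ = b := Subtype.ext (g.apply_symm_apply b.1)
  rwa [ea, eb] at this

/-- An embedding of a map as a submap of another one. -/
structure IsEmbedding {P N : CombMap} (f : P.Dart → N.Dart) : Prop where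
  injective : Function.Injective f
  rev : ∀ d, N.rev (f d) = f (P.rev d)
  rot : ∀ d, ReachAvoiding N.rot (Set.range f) (f d) (f (P.rot d))

theorem IsEmbedding.image_closed {P N : CombMap} {f : P.Dart → N.Dart} (hf : IsEmbedding f)
    {T : Set P.Dart} (hT : ∀ x ∈ T, P.rev x ∈ T) : ∀ x ∈ f '' T, N.rev x ∈ f '' T := by
  rintro _ ⟨x, hx, rfl⟩
  exact ⟨_, hT x hx, (hf.rev x).symm⟩

theorem IsEmbedding.firstReturn_image {P N : CombMap} {f : P.Dart → N.Dart} (hf : IsEmbedding f)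
    {T : Set P.Dart} (x : T) :
    firstReturn (f '' T) ⟨f x.1, x.1, x.2, rfl⟩ =
      ⟨f (firstReturn T x).1, _, (firstReturn T x).2, rfl⟩ := by
  apply firstReturn_eq
  obtain ⟨k, hk, hk1, hk2⟩ := reachAvoiding_firstReturn x
  rw [← hk1]
  clear hk1
  have hsub : f '' T ⊆ Set.range f := Set.image_subset_range f T
  induction k with
  | zero => omega
  | succ k ih =>
    have hstep := (hf.rot ((P.rot ^ k) x.1)).mono hsub
    rw [pow_succ', Equiv.Perm.mul_apply]
    rcases Nat.eq_zero_or_pos k with rfl | hpos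
    · exact hstep
    · refine (ih hpos fun j h1 h2 => hk2 j h1 (by omega)).trans ?_ hstep
      rintro ⟨y, hy, hyx⟩
      rw [hf.injective hyx] at hy
      exact hk2 k hpos (by omega) hy

/-- The identification of a submap with its image under an embedding. -/
def imageEquiv {P N : CombMap} {f : P.Dart → N.Dart} (hf : IsEmbedding f) (T : Set P.Dart) :
    T ≃ f '' T := Equiv.Set.image f T hf.injective

theorem IsEmbedding.imageEquiv_rot {P N : CombMap} {f : P.Dart → N.Dart} (hf : IsEmbedding f)
    {T : Set P.Dart} {hT : ∀ x ∈ T, P.rev x ∈ T} {hT' : ∀ x ∈ f '' T, N.rev x ∈ f '' T}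
    (x : T) : imageEquiv hf T ((P.submap T hT).rot x) =
      (N.submap (f '' T) hT').rot (imageEquiv hf T x) :=
  (hf.firstReturn_image x).symm

theorem IsEmbedding.imageEquiv_rev {P N : CombMap} {f : P.Dart → N.Dart} (hf : IsEmbedding f)
    {T : Set P.Dart} {hT : ∀ x ∈ T, P.rev x ∈ T} {hT' : ∀ x ∈ f '' T, N.rev x ∈ f '' T}
    (x : T) : imageEquiv hf T ((P.submap T hT).rev x) =
      (N.submap (f '' T) hT').rev (imageEquiv hf T x) :=
  Subtype.ext (hf.rev x.1).symm

theorem IsEmbedding.iso_submap_image {P N : CombMap} {f : P.Dart → N.Dart} (hf : IsEmbedding f)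
    {T : Set P.Dart} (hT : ∀ x ∈ T, P.rev x ∈ T) (hT' : ∀ x ∈ f '' T, N.rev x ∈ f '' T) :
    Iso (P.submap T hT) (N.submap (f '' T) hT') :=
  ⟨imageEquiv hf T, fun x => hf.imageEquiv_rot x, fun x => hf.imageEquiv_rev x⟩

/-- The identification of a map with its image under an embedding. -/
def rangeEquiv {P N : CombMap} {f : P.Dart → N.Dart} (hf : IsEmbedding f) :
    P.Dart ≃ Set.range f := Equiv.ofInjective f hf.injective

theorem IsEmbedding.rangeEquiv_rot {P N : CombMap} {f : P.Dart → N.Dart} (hf : IsEmbedding f)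
    {hT' : ∀ x ∈ Set.range f, N.rev x ∈ Set.range f}
    (x : P.Dart) : rangeEquiv hf (P.rot x) = (N.submap (Set.range f) hT').rot (rangeEquiv hf x) :=
  (firstReturn_eq (M := N) (S := Set.range f) (a := ⟨f x, x, rfl⟩) ⟨_, rfl⟩ (hf.rot x)).symm

theorem IsEmbedding.rangeEquiv_rev {P N : CombMap} {f : P.Dart → N.Dart} (hf : IsEmbedding f)
    {hT' : ∀ x ∈ Set.range f, N.rev x ∈ Set.range f}
    (x : P.Dart) : rangeEquiv hf (P.rev x) = (N.submap (Set.range f) hT').rev (rangeEquiv hf x) :=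
  Subtype.ext (hf.rev x).symm

theorem IsEmbedding.range_closed {P N : CombMap} {f : P.Dart → N.Dart} (hf : IsEmbedding f) :
    ∀ x ∈ Set.range f, N.rev x ∈ Set.range f := by
  rintro _ ⟨x, rfl⟩
  exact ⟨_, (hf.rev x).symm⟩

theorem IsEmbedding.iso_submap_range {P N : CombMap} {f : P.Dart → N.Dart} (hf : IsEmbedding f)
    (hT' : ∀ x ∈ Set.range f, N.rev x ∈ Set.range f) :
    Iso P (N.submap (Set.range f) hT') :=
  ⟨rangeEquiv hf, fun x => hf.rangeEquiv_rot x, fun x => hf.rangeEquiv_rev x⟩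

/-! ### Separation of non-separable maps -/

/-- In a non-separable map, a set of edges that is a union of connected components after cutting
a single vertex (whose darts contain `E`) is empty or contains everything. -/
theorem IsNonseparable.separation (hM : M.IsNonseparable) {A E : Set M.Dart}
    (hrev : ∀ d ∈ A, M.rev d ∈ A) (hE : ∀ x ∈ E, ∀ y ∈ E, M.src x = M.src y)
    (hloop : ∀ x ∈ E, ∀ d, M.src d = M.src x → M.src (M.rev d) ≠ M.src x)
    (hA : ∀ d, d ∉ E → (M.rot d ∈ A ↔ d ∈ A)) :
    (∀ d, d ∈ A) ∨ ∀ d, d ∉ A := by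
  by_contra! hcon
  obtain ⟨⟨b, hb⟩, a, ha⟩ := hcon
  obtain ⟨-, hc, hp⟩ := hM
  have hdc := (connected_iff.1 hc).2
  rcases E.eq_empty_or_nonempty with rfl | ⟨x, hx⟩
  · exact hb (hdc A ⟨a, ha⟩ (fun d hd => (hA d (by simp)).2 hd) hrev b)
  · have hE' : ∀ d, M.src d ≠ M.src x → (M.rot d ∈ A ↔ d ∈ A) := fun d hd =>
      hA d fun h => hd (hE d h x hx)
    have hcyc : ∀ d e, M.src d ≠ M.src x → M.src d = M.src e → d ∈ A → e ∈ A := by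
      intro d e hd hde hdA
      exact (sameCycle_induction (P := fun e => M.src e = M.src d ∧ e ∈ A)
        (fun e he => ⟨by rw [src_rot, he.1], (hE' e (by rw [he.1]; exact hd)).2 he.2⟩)
        (src_eq_src_iff.1 hde) ⟨rfl, hdA⟩).2
    have hrev' : ∀ d, M.rev d ∈ A → d ∈ A := fun d h => by
      have := hrev _ h; rwa [M.rev_rev] at this
    obtain ⟨a', ha', ha's⟩ : ∃ a' ∈ A, M.src a' ≠ M.src x := by
      by_cases h : M.src a = M.src x
      · exact ⟨_, hrev _ ha, hloop x hx a h⟩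
      · exact ⟨a, ha, h⟩
    obtain ⟨b', hb', hb's⟩ : ∃ b', b' ∉ A ∧ M.src b' ≠ M.src x := by
      by_cases h : M.src b = M.src x
      · exact ⟨_, fun h' => hb (hrev' _ h'), hloop x hx b h⟩
      · exact ⟨b, hb, h⟩
    refine hb' (reachable_induction
      (P := fun v : ({M.src x}ᶜ : Set M.Vertex) => ∀ d, M.src d = v → d ∈ A) ?_
      (hp (M.src x) ⟨M.src a', ha's⟩ ⟨M.src b', hb's⟩) (fun d hd => hcyc a' d ha's hd.symm ha')
      b' rfl)
    rintro u v huv h d hd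
    obtain ⟨y, hu, hv⟩ := (huv : M.graph.Adj u.1 v.1).2
    exact hcyc (M.rev y) d (by rw [hv]; exact v.2) (hv.trans hd.symm) (hrev _ (h y hu))

end CombMap

/-! ### Discrete Jordan curves -/

namespace CombMap
variable {M : CombMap}

open Classical in
/-- Winding numbers. The walk along the face of `x` up to `y`, completed to a closed walk by the
flow of a weight `w`, has a level function `h`: it is the same on both darts of an edge, and
turning around a vertex it changes only where the walk is crossed. -/
theorem CyclesBound.exists_level (hM : M.CyclesBound) {x y : M.Dart} {k : ℕ}
    (hk : (M.facePerm ^ k) x = y) (w : M.Dart → ℝ)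
    (hw : ∀ f : M.Dart → ℝ, (∀ d, f (M.rot d) = f d) →
      f x - f y + ∑ d, f d * (w d - w (M.rev d)) = 0) :
    ∃ h : M.Dart → ℝ, (∀ d, h (M.rev d) = h d) ∧ ∀ d, h (M.rot d) =
      h d + (if M.rot d = x then 1 else 0) - (if M.rot d = y then 1 else 0)
        + w (M.rot d) - w (M.rev d) := by
  let c : M.Dart → ℝ := fun d => ∑ i ∈ Finset.range k, if (M.facePerm ^ i) x = d then 1 else 0
  have hc : ∀ d, c (M.facePerm d) = c d + (if M.facePerm d = x then 1 else 0)
      - (if M.facePerm d = y then 1 else 0) := by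
    intro d
    have h1 : c d = ∑ i ∈ Finset.range k,
        if (M.facePerm ^ (i + 1)) x = M.facePerm d then (1 : ℝ) else 0 := by
      refine Finset.sum_congr rfl fun i _ => ?_
      simp only [pow_succ', Equiv.Perm.mul_apply, EmbeddingLike.apply_eq_iff_eq]
    have h2 := Finset.sum_range_succ
      (fun i => if (M.facePerm ^ i) x = M.facePerm d then (1 : ℝ) else 0) k
    rw [Finset.sum_range_succ', hk] at h2
    simp only [pow_zero, Equiv.Perm.one_apply] at h2
    rw [h1]
    change ∑ i ∈ Finset.range k, (if (M.facePerm ^ i) x = M.facePerm d then (1 : ℝ) else 0) = _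
    simp only [eq_comm (a := M.facePerm d)] at *
    linarith
  have hdelta : ∀ (f : M.Dart → ℝ), ∑ d, f d * c d =
      ∑ i ∈ Finset.range k, f ((M.facePerm ^ i) x) := by
    intro f
    simp only [c, Finset.mul_sum]
    rw [Finset.sum_comm]
    refine Finset.sum_congr rfl fun i _ => ?_
    simp
  let u : M.Dart → ℝ := fun d => c d + w d
  obtain ⟨g, hg, hz⟩ := hM (fun d => u d - u (M.rev d)) (fun d => by rw [M.rev_rev]; ring) (by
    intro f hf
    have h1 : ∑ d, f d * c (M.rev d) = ∑ i ∈ Finset.range k, f ((M.facePerm ^ (i + 1)) x) := by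
      rw [← Equiv.sum_comp M.rev]
      simp only [M.rev_rev]
      rw [hdelta (fun d => f (M.rev d))]
      refine Finset.sum_congr rfl fun i _ => ?_
      rw [pow_succ', Equiv.Perm.mul_apply, facePerm_apply, hf]
    have h2 : ∑ i ∈ Finset.range k, f ((M.facePerm ^ i) x)
        - ∑ i ∈ Finset.range k, f ((M.facePerm ^ (i + 1)) x) = f x - f y := by
      rw [← Finset.sum_sub_distrib, Finset.sum_range_sub' (fun i => f ((M.facePerm ^ i) x)), hk]
      simp
    have h3 : ∑ d, f d * (u d - u (M.rev d)) = (∑ d, f d * c d - ∑ d, f d * c (M.rev d))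
        + ∑ d, f d * (w d - w (M.rev d)) := by
      rw [← Finset.sum_sub_distrib, ← Finset.sum_add_distrib]
      exact Finset.sum_congr rfl fun d _ => by simp only [u]; ring
    rw [h3, hdelta, h1, h2]
    exact hw f hf)
  refine ⟨fun d => u d - g d, fun d => ?_, fun d => ?_⟩
  · have := hz d
    linarith
  · have h1 : M.rot d = M.facePerm (M.rev d) := by rw [facePerm_apply, M.rev_rev]
    have h2 := hc (M.rev d)
    have h3 := hz d
    have h4 := hg (M.rev d)
    rw [← h1] at h2 h4
    simp only [u] at h3 ⊢
    linarith

open Classical in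
/-- Two visits of a face to the same vertex cut the map: there is a function that changes only at
the two corners. -/
theorem CyclesBound.exists_cut (hM : M.CyclesBound) {x y : M.Dart}
    (hf : M.rightFace x = M.rightFace y) (hv : M.src x = M.src y) :
    ∃ h : M.Dart → ℝ, (∀ d, h (M.rev d) = h d) ∧ ∀ d, h (M.rot d) =
      h d + (if M.rot d = x then 1 else 0) - (if M.rot d = y then 1 else 0) := by
  obtain ⟨k, -, hk⟩ := (rightFace_eq_iff.1 hf).exists_pow_eq'
  obtain ⟨h, h1, h2⟩ := hM.exists_level hk (fun _ => 0)
    (fun f hf => by simp [eq_of_src_eq hf hv])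
  exact ⟨h, h1, fun d => by simpa using h2 d⟩

open Classical in
theorem value_after_cut {D : Type*} [Finite D] {σ : Equiv.Perm D} {h : D → ℝ} {x y : D}
    (hxy : x ≠ y) (hs : σ.SameCycle x y) (hh : ∀ d, h (σ d) =
      h d + (if σ d = x then 1 else 0) - (if σ d = y then 1 else 0)) : h y = h x - 1 := by
  obtain ⟨n, hn, hmin, hret⟩ := exists_minimal_pow hs
  have hpos : 0 < n := by
    rcases Nat.eq_zero_or_pos n with h0 | h0
    · rw [h0] at hn; exact absurd hn hxy
    · exact h0
  have key : ∀ j, j < n → h ((σ ^ j) x) = h x := by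
    intro j
    induction j with
    | zero => intro _; simp
    | succ j ih =>
      intro hj
      have h1 := hh ((σ ^ j) x)
      rw [← Equiv.Perm.mul_apply, ← pow_succ', if_neg (hret _ (by omega) hj.le),
        if_neg (hmin _ hj), ih (by omega)] at h1
      linarith
  have h1 := hh ((σ ^ (n - 1)) x)
  rw [← Equiv.Perm.mul_apply, ← pow_succ', Nat.sub_add_cancel hpos, hn, if_neg hxy.symm,
    if_pos rfl, key _ (by omega)] at h1
  linarith

end CombMap

namespace RootedMap
variable {N : RootedMap}

/-- The darts on the boundary of the outer face. -/
def outer (N : RootedMap) : Set N.Dart := {x | N.rightFace x = N.rightFace N.root}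

theorem root_mem_outer : N.root ∈ N.outer := rfl

theorem facePerm_mem_outer {x : N.Dart} : N.facePerm x ∈ N.outer ↔ x ∈ N.outer := by
  simp [outer]

/-- The outer face visits each vertex at most once. -/
def OuterSimple (N : RootedMap) : Prop :=
  ∀ x ∈ N.outer, ∀ y ∈ N.outer, N.src x = N.src y → x = y

theorem IsOuterplanar.connected (h : N.IsOuterplanar) : N.graph.Connected := h.1.1

theorem IsOuterplanar.dartConnected (h : N.IsOuterplanar) : N.DartConnected :=
  (CombMap.connected_iff.1 h.connected).2

theorem IsOuterplanar.cyclesBound (h : N.IsOuterplanar) : N.CyclesBound :=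
  (CombMap.isPlanar_iff.1 h.1).2

theorem IsOuterplanar.loopless (h : N.IsOuterplanar) (x d : N.Dart) (hd : N.src d = N.src x) :
    N.src (N.rev d) ≠ N.src x := fun h' => h.2.1.1 d (hd.trans h'.symm)

theorem OuterSimple.of_isNonseparable (h : N.IsOuterplanar) (hn : N.IsNonseparable) :
    N.OuterSimple := by
  classical
  intro x hx y hy hxy
  by_contra hne
  obtain ⟨f, h1, h2⟩ := h.cyclesBound.exists_cut (hx.trans hy.symm) hxy
  have hval := CombMap.value_after_cut hne (CombMap.src_eq_src_iff.1 hxy) h2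
  rcases hn.separation (A := {d | f d = f x}) (E := {d | N.src d = N.src x})
    (fun d hd => (h1 d).trans hd) (fun a ha b hb => ha.trans hb.symm)
    (fun a _ d hd => h.loopless a d hd) (fun d hd => by
      have e1 : N.rot d ≠ x := by rintro rfl; exact hd (CombMap.src_rot _).symm
      have e2 : N.rot d ≠ y := by rintro rfl; exact hd (by rw [Set.mem_ofPred_eq, hxy]; simp)
      have := h2 d
      rw [if_neg e1, if_neg e2] at this
      simp [this]) with h' | h'
  · have := h' y
    simp only [Set.mem_ofPred_eq] at this
    linarith
  · exact h' x rfl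

/-- A connected map whose outer face visits each vertex exactly once is non-separable: after
removing a vertex the rest of the boundary walk still connects the other vertices. -/
theorem OuterSimple.isNonseparable (h : N.OuterSimple) (hc : N.graph.Connected)
    (hv : ∀ v : N.Vertex, ∃ x, N.src x = v ∧ N.rightFace x = N.rightFace N.root) :
    N.IsNonseparable := by
  refine ⟨⟨N.root⟩, hc, fun v => ?_⟩
  obtain ⟨x, rfl, hx⟩ := hv v
  have key : ∀ k : ℕ, ∀ u : ({N.src x}ᶜ : Set N.Vertex), ∀ w : ({N.src x}ᶜ : Set N.Vertex),
      N.src (N.facePerm x) = w.1 →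
      N.src ((N.facePerm ^ (k + 1)) x) = u.1 → (∀ j, 0 < j → j ≤ k → (N.facePerm ^ j) x ≠ x) →
      (N.graph.induce ({N.src x}ᶜ : Set N.Vertex)).Reachable w u := by
    intro k
    induction k with
    | zero =>
      intro u w hw hu _
      have : w = u := Subtype.ext (by rw [← hw, ← hu]; simp)
      rw [this]
    | succ k ih =>
      intro u w hw hu hk
      have hout : (N.facePerm ^ (k + 1)) x ∈ N.outer := by
        have : N.facePerm.SameCycle x ((N.facePerm ^ (k + 1)) x) := 
          ⟨((k + 1 : ℕ) : ℤ), by rw [zpow_natCast]⟩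
        exact (CombMap.rightFace_eq_iff.2 this).symm.trans hx
      have hne : N.src ((N.facePerm ^ (k + 1)) x) ≠ N.src x := fun h' =>
        hk (k + 1) (by omega) le_rfl (h _ hout _ hx h')
      refine (ih ⟨_, hne⟩ w hw rfl fun j h1 h2 => hk j h1 (by omega)).trans ?_
      rw [pow_succ', Equiv.Perm.mul_apply, CombMap.src_facePerm] at hu
      rcases CombMap.adj_or_eq ((N.facePerm ^ (k + 1)) x) with h' | h'
      · apply SimpleGraph.Adj.reachable
        change N.graph.Adj _ u.1
        rwa [← hu]
      · have : (⟨_, hne⟩ : ({N.src x}ᶜ : Set N.Vertex)) = u := Subtype.ext (h'.trans hu)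
        rw [this]
  have key2 : ∀ u : ({N.src x}ᶜ : Set N.Vertex), ∃ w : ({N.src x}ᶜ : Set N.Vertex),
      N.src (N.facePerm x) = w.1 ∧
      (N.graph.induce ({N.src x}ᶜ : Set N.Vertex)).Reachable w u := by
    intro u
    obtain ⟨y, hyu, hy⟩ := hv u.1
    have hxy : N.facePerm.SameCycle x y := CombMap.rightFace_eq_iff.1 (hx.trans hy.symm)
    obtain ⟨n, hn, -, hne⟩ := exists_minimal_pow hxy
    have hyx : y ≠ x := by rintro rfl; exact u.2 hyu.symm
    have hpos : 0 < n := by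
      rcases Nat.eq_zero_or_pos n with h0 | h0
      · rw [h0] at hn; exact absurd hn.symm hyx
      · exact h0
    have hw : N.src (N.facePerm x) ≠ N.src x := fun h' =>
      hne 1 one_pos hpos (by simpa using h _ (facePerm_mem_outer.2 hx) _ hx h')
    refine ⟨⟨_, hw⟩, rfl, key (n - 1) u ⟨_, hw⟩ rfl ?_ fun j h1 h2 => hne j h1 (by omega)⟩
    rw [Nat.sub_add_cancel hpos, hn, hyu]
  intro u u'
  obtain ⟨w, hw, h1⟩ := key2 u
  obtain ⟨w', hw', h2⟩ := key2 u'
  have : w = w' := Subtype.ext (hw.symm.trans hw')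
  subst this
  exact h1.symm.trans h2

end RootedMap

/-! ### Splicing permutations and gluing maps -/

theorem sameCycle_of_apply_eq {D : Type*} {σ : Equiv.Perm D} {d d' : D} (hd : σ d = d') :
    σ.SameCycle d d' := ⟨1, by simpa using hd⟩

/-- `σN` acts on the disjoint union of `B` and the `D w` as `σB` and the `σD w`, except that the
cycle of `r w` is inserted just before the point `ι w`. -/
structure IsSpliced {B N W : Type} {D : W → Type} (e : B ⊕ (Σ w, D w) ≃ N) (ι : W → B)
    (r : ∀ w, D w) (σN : Equiv.Perm N) (σB : Equiv.Perm B) (σD : ∀ w, Equiv.Perm (D w)) :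
    Prop where
  inl : ∀ b, (∀ w, ι w ≠ σB b) → σN (e (.inl b)) = e (.inl (σB b))
  inl_attach : ∀ b w, ι w = σB b → σN (e (.inl b)) = e (.inr ⟨w, r w⟩)
  inr : ∀ w c, σD w c ≠ r w → σN (e (.inr ⟨w, c⟩)) = e (.inr ⟨w, σD w c⟩)
  inr_root : ∀ w c, σD w c = r w → σN (e (.inr ⟨w, c⟩)) = e (.inl (ι w))

section Retractions
variable {B N W : Type} {D : W → Type} (e : B ⊕ (Σ w, D w) ≃ N) (ι : W → B) (r : ∀ w, D w)

/-- The retraction of a gluing onto its core. -/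
def retractCore (d : N) : B := Sum.elim id (fun c => ι c.1) (e.symm d)

open Classical in
/-- The retraction of a gluing onto one of the attached pieces. -/
def retractPiece (w : W) (d : N) : D w :=
  Sum.elim (fun _ => r w) (fun c => if h : c.1 = w then h ▸ c.2 else r w) (e.symm d)

@[simp] theorem retractCore_inl (b : B) : retractCore e ι (e (.inl b)) = b := by
  simp [retractCore]

@[simp] theorem retractCore_inr (c : Σ w, D w) : retractCore e ι (e (.inr c)) = ι c.1 := by
  simp [retractCore]

@[simp] theorem retractPiece_inl (w : W) (b : B) : retractPiece e r w (e (.inl b)) = r w := by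
  simp [retractPiece]

@[simp] theorem retractPiece_inr (w : W) (c : D w) :
    retractPiece e r w (e (.inr ⟨w, c⟩)) = c := by
  simp [retractPiece]

theorem retractPiece_inr_of_ne {w w' : W} (h : w' ≠ w) (c : D w') :
    retractPiece e r w (e (.inr ⟨w', c⟩)) = r w := by
  simp [retractPiece, h]

/-- Case analysis on the darts of a gluing. -/
theorem gluing_cases {P : N → Prop} (h1 : ∀ b, P (e (.inl b)))
    (h2 : ∀ w c, P (e (.inr ⟨w, c⟩))) (d : N) : P d := by
  obtain ⟨b | ⟨w, c⟩, rfl⟩ := e.surjective d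
  · exact h1 b
  · exact h2 w c

end Retractions

namespace IsSpliced
variable {B N W : Type} {D : W → Type} {e : B ⊕ (Σ w, D w) ≃ N} {ι : W → B}
  {r : ∀ w, D w} {σN : Equiv.Perm N} {σB : Equiv.Perm B} {σD : ∀ w, Equiv.Perm (D w)}

section
variable (h : IsSpliced e ι r σN σB σD)
include h

theorem retractCore_step (d : N) :
    retractCore e ι (σN d) = σB (retractCore e ι d) ∨ retractCore e ι (σN d) = retractCore e ι d := by
  induction d using gluing_cases (e := e) with
  | h1 b =>
    left
    by_cases hb : ∃ w, ι w = σB b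
    · obtain ⟨w, hw⟩ := hb
      simp [h.inl_attach b w hw, hw]
    · push Not at hb
      simp [h.inl b hb]
  | h2 w c =>
    right
    by_cases hc : σD w c = r w
    · simp [h.inr_root w c hc]
    · simp [h.inr w c hc]

theorem retractPiece_step (w : W) (d : N) :
    retractPiece e r w (σN d) = σD w (retractPiece e r w d) ∨
      retractPiece e r w (σN d) = retractPiece e r w d := by
  induction d using gluing_cases (e := e) with
  | h1 b =>
    right
    by_cases hb : ∃ w, ι w = σB b
    · obtain ⟨w', hw⟩ := hb
      rw [h.inl_attach b w' hw]
      by_cases hww : w' = w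
      · subst hww; simp
      · rw [retractPiece_inr_of_ne e r hww]; simp
    · push Not at hb
      simp [h.inl b hb]
  | h2 w' c =>
    by_cases hww : w' = w
    · subst hww
      left
      by_cases hc : σD w' c = r w'
      · simp [h.inr_root w' c hc, hc]
      · simp [h.inr w' c hc]
    · right
      rw [retractPiece_inr_of_ne e r hww]
      by_cases hc : σD w' c = r w'
      · simp [h.inr_root w' c hc]
      · rw [h.inr w' c hc, retractPiece_inr_of_ne e r hww]

variable [Finite N]

theorem sameCycle_retractCore {d d' : N} (hd : σN.SameCycle d d') :
    σB.SameCycle (retractCore e ι d) (retractCore e ι d') := by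
  refine sameCycle_induction (P := fun d' => σB.SameCycle (retractCore e ι d)
    (retractCore e ι d')) (fun x hx => ?_) hd (.refl _ _)
  rcases h.retractCore_step x with h' | h'
  · rw [h']; exact Equiv.Perm.sameCycle_apply_right.2 hx
  · rw [h']; exact hx

theorem sameCycle_retractPiece (w : W) {d d' : N} (hd : σN.SameCycle d d') :
    (σD w).SameCycle (retractPiece e r w d) (retractPiece e r w d') := by
  refine sameCycle_induction (P := fun d' => (σD w).SameCycle (retractPiece e r w d)
    (retractPiece e r w d')) (fun x hx => ?_) hd (.refl _ _)
  rcases h.retractPiece_step w x with h' | h'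
  · rw [h']; exact Equiv.Perm.sameCycle_apply_right.2 hx
  · rw [h']; exact hx

theorem sameCycle_root (w : W) : σN.SameCycle (e (.inr ⟨w, r w⟩)) (e (.inl (ι w))) := by
  have : Finite (D w) := Finite.of_injective (fun c => e (.inr ⟨w, c⟩)) fun c c' hc => by
    simpa using hc
  have key : ∀ c, (σD w).SameCycle (r w) c →
      σN.SameCycle (e (.inr ⟨w, r w⟩)) (e (.inr ⟨w, c⟩)) := by
    intro c hc
    refine sameCycle_induction (P := fun c => σN.SameCycle (e (.inr ⟨w, r w⟩))
      (e (.inr ⟨w, c⟩))) (fun x hx => ?_) hc (.refl _ _)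
    by_cases hr : σD w x = r w
    · rw [hr]
    · exact hx.trans (sameCycle_of_apply_eq (h.inr w x hr))
  have h0 : σD w ((σD w).symm (r w)) = r w := by simp
  refine (key ((σD w).symm (r w)) ?_).trans (sameCycle_of_apply_eq (h.inr_root w _ h0))
  exact ⟨-1, by simp⟩

theorem sameCycle_inr (w : W) {c c' : D w} (hc : (σD w).SameCycle c c') :
    σN.SameCycle (e (.inr ⟨w, c⟩)) (e (.inr ⟨w, c'⟩)) := by
  have : Finite (D w) := Finite.of_injective (fun c => e (.inr ⟨w, c⟩)) fun c c' hc => by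
    simpa using hc
  refine sameCycle_induction (P := fun c' => σN.SameCycle (e (.inr ⟨w, c⟩))
    (e (.inr ⟨w, c'⟩))) (fun x hx => ?_) hc (.refl _ _)
  refine hx.trans ?_
  by_cases hr : σD w x = r w
  · rw [hr]
    exact (sameCycle_of_apply_eq (h.inr_root w x hr)).trans (h.sameCycle_root w).symm
  · exact sameCycle_of_apply_eq (h.inr w x hr)

theorem sameCycle_inl {b b' : B} (hb : σB.SameCycle b b') :
    σN.SameCycle (e (.inl b)) (e (.inl b')) := by
  have : Finite B := Finite.of_injective (fun b => e (.inl b)) fun c c' hc => by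
    simpa using hc
  refine sameCycle_induction (P := fun b' => σN.SameCycle (e (.inl b))
    (e (.inl b'))) (fun x hx => hx.trans ?_) hb (.refl _ _)
  by_cases hb : ∃ w, ι w = σB x
  · obtain ⟨w, hw⟩ := hb
    rw [← hw]
    exact (sameCycle_of_apply_eq (h.inl_attach x w hw)).trans (h.sameCycle_root w)
  · push Not at hb
    exact sameCycle_of_apply_eq (h.inl x hb)

theorem sameCycle_inl_iff {b b' : B} :
    σN.SameCycle (e (.inl b)) (e (.inl b')) ↔ σB.SameCycle b b' :=
  ⟨fun hb => by simpa using h.sameCycle_retractCore hb, h.sameCycle_inl⟩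

theorem sameCycle_inr_iff {w : W} {c c' : D w} :
    σN.SameCycle (e (.inr ⟨w, c⟩)) (e (.inr ⟨w, c'⟩)) ↔ (σD w).SameCycle c c' :=
  ⟨fun hb => by simpa using h.sameCycle_retractPiece w hb, h.sameCycle_inr w⟩

end
end IsSpliced

namespace CombMap

/-- Exactness passes to a map embedded in such a way that vertices lie in vertices and faces lie
in faces. -/
theorem CyclesBound.of_injective {P N : CombMap} (hN : N.CyclesBound) {f : P.Dart → N.Dart}
    (hf : Function.Injective f) (hrev : ∀ d, N.rev (f d) = f (P.rev d))
    (hsrc : ∀ d, N.src (f (P.rot d)) = N.src (f d))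
    (hface : ∀ d, N.rightFace (f (P.facePerm d)) = N.rightFace (f d)) : P.CyclesBound := by
  intro z hz hdiv
  have hrange : ∀ d, N.rev d ∈ Set.range f ↔ d ∈ Set.range f := by
    intro d
    constructor
    · rintro ⟨x, hx⟩
      exact ⟨P.rev x, by rw [← hrev, hx, N.rev_rev]⟩
    · rintro ⟨x, rfl⟩
      exact ⟨P.rev x, (hrev x).symm⟩
  obtain ⟨g, hg, hzg⟩ := hN (Function.extend f z 0) (fun d => by
    by_cases hd : d ∈ Set.range f
    · obtain ⟨x, rfl⟩ := hd
      rw [hrev, hf.extend_apply, hf.extend_apply, hz]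
    · rw [Function.extend_apply' _ _ _ hd, Function.extend_apply' _ _ _
        (fun h => hd ((hrange d).1 h))]
      simp) (by
    intro F hF
    rw [← Fintype.sum_of_injective f hf (fun c => F (f c) * z c) _ (fun d hd => by
      rw [Function.extend_apply' _ _ _ hd]; simp) (fun c => by rw [hf.extend_apply])]
    exact hdiv _ fun d => eq_of_src_eq hF (hsrc d))
  refine ⟨fun d => g (f d), fun d => ?_, fun d => ?_⟩
  · exact eq_of_sameCycle hg (rightFace_eq_iff.1 (hface d).symm)
  · have := hzg (f d)
    rwa [hf.extend_apply, hrev] at this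

theorem sum_eq_zero_of_antisymm {M : CombMap} {z : M.Dart → ℝ} (hz : ∀ d, z (M.rev d) = - z d) :
    ∑ d, z d = 0 := by
  have h : ∑ d, z d = - ∑ d, z d := by
    conv_lhs => rw [← Equiv.sum_comp M.rev]
    rw [← Finset.sum_neg_distrib]
    exact Finset.sum_congr rfl fun d _ => hz d
  linarith

end CombMap

/-- `N` is obtained from the rooted map `B` by attaching, for each `w`, the rooted map `M w` with
its root vertex in the corner of `B` just before the dart `ι w`. -/
structure Gluing (N B : RootedMap) {W : Type} (ι : W → B.Dart) (M : W → RootedMap) where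
  e : B.Dart ⊕ (Σ w, (M w).Dart) ≃ N.Dart
  rev_inl : ∀ b, N.rev (e (.inl b)) = e (.inl (B.rev b))
  rev_inr : ∀ w c, N.rev (e (.inr ⟨w, c⟩)) = e (.inr ⟨w, (M w).rev c⟩)
  rot : IsSpliced e ι (fun w => (M w).root) N.rot B.rot (fun w => (M w).rot)
  root : N.root = e (.inl B.root)

namespace Gluing
variable {N B : RootedMap} {W : Type} {ι : W → B.Dart} {M : W → RootedMap}

section
variable (G : Gluing N B ι M)
include G

/-- The inclusion of the core. -/
def core (b : B.Dart) : N.Dart := G.e (.inl b)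

/-- The inclusion of an attached piece. -/
def piece (w : W) (c : (M w).Dart) : N.Dart := G.e (.inr ⟨w, c⟩)

theorem core_injective : Function.Injective G.core := fun b b' h => by
  simpa [core] using h

theorem piece_injective (w : W) : Function.Injective (G.piece w) := fun c c' h => by
  simpa [piece] using h

theorem core_ne_piece (b : B.Dart) (w : W) (c : (M w).Dart) : G.core b ≠ G.piece w c := by
  simp [core, piece]

theorem piece_ne_piece {w w' : W} (h : w ≠ w') (c : (M w).Dart) (c' : (M w').Dart) :
    G.piece w c ≠ G.piece w' c' := by
  simp only [piece, ne_eq, EmbeddingLike.apply_eq_iff_eq, Sum.inr.injEq, Sigma.mk.injEq]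
  exact fun h' => h h'.1

theorem cases {P : N.Dart → Prop} (h1 : ∀ b, P (G.core b)) (h2 : ∀ w c, P (G.piece w c))
    (d : N.Dart) : P d := gluing_cases G.e h1 h2 d

theorem rev_core (b : B.Dart) : N.rev (G.core b) = G.core (B.rev b) := G.rev_inl b

theorem rev_piece (w : W) (c : (M w).Dart) : N.rev (G.piece w c) = G.piece w ((M w).rev c) :=
  G.rev_inr w c

theorem face : IsSpliced G.e ι (fun w => (M w).root) N.facePerm B.facePerm
    (fun w => (M w).facePerm) where
  inl b hb := by rw [CombMap.facePerm_apply, G.rev_inl]; exact G.rot.inl _ hb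
  inl_attach b w hb := by rw [CombMap.facePerm_apply, G.rev_inl]; exact G.rot.inl_attach _ w hb
  inr w c hc := by rw [CombMap.facePerm_apply, G.rev_inr]; exact G.rot.inr w _ hc
  inr_root w c hc := by rw [CombMap.facePerm_apply, G.rev_inr]; exact G.rot.inr_root w _ hc

/-- The retraction onto the core. -/
def toCore : N.Dart → B.Dart := retractCore G.e ι

/-- The retraction onto a piece. -/
def toPiece (w : W) : N.Dart → (M w).Dart := retractPiece G.e (fun w => (M w).root) w

@[simp] theorem toCore_core (b : B.Dart) : G.toCore (G.core b) = b := retractCore_inl _ _ _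
@[simp] theorem toCore_piece (w : W) (c : (M w).Dart) : G.toCore (G.piece w c) = ι w :=
  retractCore_inr _ _ _
@[simp] theorem toPiece_core (w : W) (b : B.Dart) : G.toPiece w (G.core b) = (M w).root :=
  retractPiece_inl _ _ _ _
@[simp] theorem toPiece_piece (w : W) (c : (M w).Dart) : G.toPiece w (G.piece w c) = c :=
  retractPiece_inr _ _ _ _
theorem toPiece_piece_of_ne {w w' : W} (h : w' ≠ w) (c : (M w').Dart) :
    G.toPiece w (G.piece w' c) = (M w).root :=
  retractPiece_inr_of_ne _ _ h _

theorem src_toCore {d d' : N.Dart} (h : N.src d = N.src d') :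
    B.src (G.toCore d) = B.src (G.toCore d') :=
  CombMap.src_eq_src_iff.2 (G.rot.sameCycle_retractCore (CombMap.src_eq_src_iff.1 h))

theorem src_toPiece (w : W) {d d' : N.Dart} (h : N.src d = N.src d') :
    (M w).src (G.toPiece w d) = (M w).src (G.toPiece w d') :=
  CombMap.src_eq_src_iff.2 (G.rot.sameCycle_retractPiece w (CombMap.src_eq_src_iff.1 h))

theorem src_core_iff {b b' : B.Dart} :
    N.src (G.core b) = N.src (G.core b') ↔ B.src b = B.src b' := by
  rw [CombMap.src_eq_src_iff, CombMap.src_eq_src_iff]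
  exact G.rot.sameCycle_inl_iff

theorem src_piece_iff {w : W} {c c' : (M w).Dart} :
    N.src (G.piece w c) = N.src (G.piece w c') ↔ (M w).src c = (M w).src c' := by
  rw [CombMap.src_eq_src_iff, CombMap.src_eq_src_iff]
  exact G.rot.sameCycle_inr_iff

theorem src_root (w : W) : N.src (G.piece w (M w).root) = N.src (G.core (ι w)) :=
  CombMap.src_eq_src_iff.2 (G.rot.sameCycle_root w)

theorem rightFace_core_iff {b b' : B.Dart} :
    N.rightFace (G.core b) = N.rightFace (G.core b') ↔ B.rightFace b = B.rightFace b' := by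
  rw [CombMap.rightFace_eq_iff, CombMap.rightFace_eq_iff]
  exact G.face.sameCycle_inl_iff

theorem rightFace_piece_iff {w : W} {c c' : (M w).Dart} :
    N.rightFace (G.piece w c) = N.rightFace (G.piece w c') ↔
      (M w).rightFace c = (M w).rightFace c' := by
  rw [CombMap.rightFace_eq_iff, CombMap.rightFace_eq_iff]
  exact G.face.sameCycle_inr_iff

theorem rightFace_root (w : W) :
    N.rightFace (G.piece w (M w).root) = N.rightFace (G.core (ι w)) :=
  CombMap.rightFace_eq_iff.2 (G.face.sameCycle_root w)

theorem core_mem_outer {b : B.Dart} : G.core b ∈ N.outer ↔ b ∈ B.outer := by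
  change N.rightFace _ = N.rightFace _ ↔ _
  rw [G.root]
  exact G.rightFace_core_iff

theorem piece_mem_outer (hι : ∀ w, ι w ∈ B.outer) {w : W} {c : (M w).Dart} :
    G.piece w c ∈ N.outer ↔ c ∈ (M w).outer := by
  have h1 := G.core_mem_outer.2 (hι w)
  change N.rightFace _ = N.rightFace _ at h1
  change N.rightFace _ = N.rightFace _ ↔ _
  rw [← h1, ← G.rightFace_root]
  exact G.rightFace_piece_iff

/-! #### Connectedness -/

theorem dartConnected_iff : N.DartConnected ↔
    B.DartConnected ∧ ∀ w, (M w).DartConnected := by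
  have hcyc : ∀ (P : CombMap) (A : Set P.Dart), (∀ d ∈ A, P.rot d ∈ A) →
      ∀ x y, P.rot.SameCycle x y → x ∈ A → y ∈ A := fun P A hA x y h hx =>
    sameCycle_induction (P := (· ∈ A)) hA h hx
  constructor
  · intro h
    constructor
    · rintro A ⟨a, ha⟩ h1 h2 b
      have := h (G.toCore ⁻¹' A) ⟨G.core a, by simpa using ha⟩
        (fun d hd => hcyc B.toCombMap A h1 _ _ (CombMap.src_eq_src_iff.1
          (G.src_toCore (CombMap.src_rot d).symm)) hd)
        (fun d hd => by
          induction d using G.cases with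
          | h1 b => simpa [G.rev_core] using h2 _ (by simpa using hd)
          | h2 w c => simpa [G.rev_piece] using hd) (G.core b)
      simpa using this
    · rintro w A ⟨a, ha⟩ h1 h2 b
      have := h (G.toPiece w ⁻¹' A) ⟨G.piece w a, by simpa using ha⟩
        (fun d hd => hcyc (M w).toCombMap A h1 _ _ (CombMap.src_eq_src_iff.1
          (G.src_toPiece w (CombMap.src_rot d).symm)) hd)
        (fun d hd => by
          induction d using G.cases with
          | h1 b => simpa [G.rev_core] using hd
          | h2 w' c =>
            by_cases hw : w' = w
            · subst hw
              simpa [G.rev_piece] using h2 _ (by simpa using hd)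
            · rw [Set.mem_preimage, G.rev_piece]
              rw [Set.mem_preimage] at hd
              rw [G.toPiece_piece_of_ne hw] at hd ⊢
              exact hd) (G.piece w b)
      simpa using this
  · rintro ⟨hB, hM⟩ A ⟨a, ha⟩ h1 h2
    have hN : ∀ x y, N.src x = N.src y → x ∈ A → y ∈ A := fun x y h =>
      hcyc N.toCombMap A h1 x y (CombMap.src_eq_src_iff.1 h)
    have hcore : ∀ b, G.core b ∈ A → ∀ b', G.core b' ∈ A := fun b hb =>
      hB (G.core ⁻¹' A) ⟨b, hb⟩
        (fun d hd => hN _ _ (G.src_core_iff.2 (CombMap.src_rot d).symm) hd)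
        (fun d hd => by
          rw [Set.mem_preimage, ← G.rev_core]
          exact h2 _ hd)
    have hpiece : ∀ w b, G.piece w b ∈ A → ∀ b', G.piece w b' ∈ A := fun w b hb =>
      hM w (G.piece w ⁻¹' A) ⟨b, hb⟩
        (fun d hd => hN _ _ (G.src_piece_iff.2 (CombMap.src_rot d).symm) hd)
        (fun d hd => by
          rw [Set.mem_preimage, ← G.rev_piece]
          exact h2 _ hd)
    have hroot : G.core B.root ∈ A := by
      induction a using G.cases with
      | h1 b => exact hcore b ha _
      | h2 w c => exact hcore _ (hN _ _ (G.src_root w) (hpiece w c ha _)) _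
    intro d
    induction d using G.cases with
    | h1 b => exact hcore _ hroot b
    | h2 w c => exact hpiece w _ (hN _ _ (G.src_root w).symm (hcore _ hroot _)) c

theorem connected_iff : N.graph.Connected ↔
    B.graph.Connected ∧ ∀ w, (M w).graph.Connected := by
  simp only [CombMap.connected_iff, G.dartConnected_iff]
  constructor
  · rintro ⟨-, h1, h2⟩
    exact ⟨⟨⟨B.root⟩, h1⟩, fun w => ⟨⟨(M w).root⟩, h2 w⟩⟩
  · rintro ⟨⟨-, h1⟩, h2⟩
    exact ⟨⟨N.root⟩, h1, fun w => (h2 w).2⟩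

/-! #### Planarity -/

theorem cyclesBound_iff [Finite W] (hι : ∀ w, ι w ∈ B.outer) : N.CyclesBound ↔
    B.CyclesBound ∧ ∀ w, (M w).CyclesBound := by
  classical
  constructor
  · intro h
    exact ⟨h.of_injective G.core_injective G.rev_core
        (fun d => G.src_core_iff.2 (CombMap.src_rot d))
        (fun d => G.rightFace_core_iff.2 (CombMap.rightFace_facePerm d)),
      fun w => h.of_injective (G.piece_injective w) (G.rev_piece w)
        (fun d => G.src_piece_iff.2 (CombMap.src_rot d))
        (fun d => G.rightFace_piece_iff.2 (CombMap.rightFace_facePerm d))⟩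
  · rintro ⟨hB, hM⟩ z hz hdiv
    have := Fintype.ofFinite W
    have hzp : ∀ w c, z (G.piece w ((M w).rev c)) = - z (G.piece w c) := fun w c => by
      rw [← G.rev_piece, hz]
    obtain ⟨g, hg, hzg⟩ := hB (fun b => z (G.core b)) (fun b => by rw [← G.rev_core, hz]) (by
      intro f hf
      have h1 := hdiv (fun d => f (G.toCore d)) (fun d =>
        CombMap.eq_of_src_eq hf (G.src_toCore (CombMap.src_rot d)))
      rw [← Equiv.sum_comp G.e, Fintype.sum_sum_type, Fintype.sum_sigma] at h1
      have h2 : ∀ w, ∑ c, f (G.toCore (G.piece w c)) * z (G.piece w c) = 0 := by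
        intro w
        simp only [toCore_piece, ← Finset.mul_sum]
        rw [CombMap.sum_eq_zero_of_antisymm (hzp w), mul_zero]
      change ∑ b, f (G.toCore (G.core b)) * z (G.core b)
        + ∑ w, ∑ c, f (G.toCore (G.piece w c)) * z (G.piece w c) = 0 at h1
      simp only [h2, Finset.sum_const_zero, add_zero] at h1
      simpa using h1)
    have hP : ∀ w, ∃ g : (M w).Dart → ℝ, (∀ d, g ((M w).facePerm d) = g d) ∧
        ∀ d, z (G.piece w d) = g d - g ((M w).rev d) := by
      intro w
      refine hM w (fun c => z (G.piece w c)) (hzp w) fun f hf => ?_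
      have h1 := hdiv (fun d => f (G.toPiece w d)) (fun d =>
        CombMap.eq_of_src_eq hf (G.src_toPiece w (CombMap.src_rot d)))
      have h2 : ∑ d, (f (G.toPiece w d) - f (M w).root) * z d = 0 := by
        simp only [sub_mul, Finset.sum_sub_distrib, ← Finset.mul_sum]
        rw [h1, CombMap.sum_eq_zero_of_antisymm hz]; simp
      rw [← Fintype.sum_of_injective (G.piece w) (G.piece_injective w)
        (fun c => (f c - f (M w).root) * z (G.piece w c)) _ (fun d hd => ?_)
        (fun c => by simp)] at h2
      · simp only [sub_mul, Finset.sum_sub_distrib, ← Finset.mul_sum] at h2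
        have h3 : ∑ c, z (G.piece w c) = 0 := CombMap.sum_eq_zero_of_antisymm (hzp w)
        simpa [h3] using h2
      · induction d using G.cases with
        | h1 b => simp
        | h2 w' c =>
          by_cases hw : w' = w
          · subst hw
            exact absurd ⟨c, rfl⟩ hd
          · rw [G.toPiece_piece_of_ne hw]; simp
    choose k hk hzk using hP
    let F : N.Dart → ℝ := fun d => Sum.elim (fun b => g b - g B.root)
      (fun c => k c.1 c.2 - k c.1 (M c.1).root) (G.e.symm d)
    have hFc : ∀ b, F (G.core b) = g b - g B.root := fun b => by simp [F, core]
    have hFp : ∀ w c, F (G.piece w c) = k w c - k w (M w).root := fun w c => by simp [F, piece]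
    have hgout : ∀ w, g (ι w) = g B.root := fun w =>
      (eq_of_sameCycle hg (CombMap.rightFace_eq_iff.1 (hι w))).symm
    refine ⟨F, fun d => ?_, fun d => ?_⟩
    · induction d using G.cases with
      | h1 b =>
        by_cases hb : ∃ w, ι w = B.facePerm b
        · obtain ⟨w, hw⟩ := hb
          have h1 : N.facePerm (G.core b) = G.piece w (M w).root := G.face.inl_attach b w hw
          rw [h1, hFp, hFc, ← hg b, ← hw, hgout]; simp
        · push Not at hb
          have h1 : N.facePerm (G.core b) = G.core (B.facePerm b) := G.face.inl b hb
          rw [h1, hFc, hFc, hg]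
      | h2 w c =>
        by_cases hc : (M w).facePerm c = (M w).root
        · have h1 : N.facePerm (G.piece w c) = G.core (ι w) := G.face.inr_root w c hc
          rw [h1, hFc, hFp, hgout, ← hk w c, hc]; simp
        · have h1 : N.facePerm (G.piece w c) = G.piece w ((M w).facePerm c) := G.face.inr w c hc
          rw [h1, hFp, hFp, hk]
    · induction d using G.cases with
      | h1 b => rw [G.rev_core, hFc, hFc, hzg b]; ring
      | h2 w c => rw [G.rev_piece, hFp, hFp, hzk w c]; ring

/-! #### Simplicity and outerplanarity -/

theorem isSimple_iff : N.IsSimple ↔ B.IsSimple ∧ ∀ w, (M w).IsSimple := by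
  constructor
  · rintro ⟨h1, h2⟩
    refine ⟨⟨fun b hb => h1 (G.core b) ?_, fun b b' h h' => G.core_injective (h2 _ _ ?_ ?_)⟩,
      fun w => ⟨fun c hc => h1 (G.piece w c) ?_,
        fun c c' h h' => G.piece_injective w (h2 _ _ ?_ ?_)⟩⟩
    · rw [G.rev_core]; exact G.src_core_iff.2 hb
    · exact G.src_core_iff.2 h
    · rw [G.rev_core, G.rev_core]; exact G.src_core_iff.2 h'
    · rw [G.rev_piece]; exact G.src_piece_iff.2 hc
    · exact G.src_piece_iff.2 h
    · rw [G.rev_piece, G.rev_piece]; exact G.src_piece_iff.2 h'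
  · rintro ⟨hB, hM⟩
    have hmix : ∀ b w c, N.src (G.core b) = N.src (G.piece w c) →
        N.src (N.rev (G.core b)) = N.src (N.rev (G.piece w c)) → False := by
      intro b w c h h'
      rw [G.rev_core, G.rev_piece] at h'
      have h1 := G.src_toCore h
      have h2 := G.src_toCore h'
      simp only [toCore_core, toCore_piece] at h1 h2
      exact hB.1 b (h1.trans h2.symm)
    constructor
    · intro d
      induction d using G.cases with
      | h1 b => rw [G.rev_core, ne_eq, G.src_core_iff]; exact hB.1 b
      | h2 w c => rw [G.rev_piece, ne_eq, G.src_piece_iff]; exact (hM w).1 c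
    · intro x y h h'
      induction x using G.cases with
      | h1 b =>
        induction y using G.cases with
        | h1 b' =>
          rw [G.rev_core, G.rev_core] at h'
          rw [hB.2 b b' (G.src_core_iff.1 h) (G.src_core_iff.1 h')]
        | h2 w c => exact (hmix b w c h h').elim
      | h2 w c =>
        induction y using G.cases with
        | h1 b => exact (hmix b w c h.symm h'.symm).elim
        | h2 w' c' =>
          rw [G.rev_piece, G.rev_piece] at h'
          by_cases hw : w' = w
          · subst hw
            rw [(hM w').2 c c' (G.src_piece_iff.1 h) (G.src_piece_iff.1 h')]
          · have h1 := G.src_toPiece w h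
            have h2 := G.src_toPiece w h'
            rw [toPiece_piece, G.toPiece_piece_of_ne hw] at h1 h2
            exact ((hM w).1 c (h1.trans h2.symm)).elim

theorem isOuterplanar_iff [Finite W] (hι : ∀ w, ι w ∈ B.outer) : N.IsOuterplanar ↔
    B.IsOuterplanar ∧ ∀ w, (M w).IsOuterplanar := by
  have hv : (∀ v : N.Vertex, ∃ x, N.src x = v ∧ N.rightFace x = N.rightFace N.root) ↔
      (∀ v : B.Vertex, ∃ x, B.src x = v ∧ B.rightFace x = B.rightFace B.root) ∧
      ∀ w, ∀ v : (M w).Vertex, ∃ x, (M w).src x = v ∧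
        (M w).rightFace x = (M w).rightFace (M w).root := by
    constructor
    · intro h
      constructor
      · intro v
        obtain ⟨b, rfl⟩ := CombMap.exists_src v
        obtain ⟨x, hx, hx'⟩ := h (N.src (G.core b))
        have := G.src_toCore hx
        rw [toCore_core] at this
        refine ⟨_, this, ?_⟩
        induction x using G.cases with
        | h1 b' => rw [toCore_core]; exact G.core_mem_outer.1 hx'
        | h2 w c => rw [toCore_piece]; exact hι w
      · intro w v
        obtain ⟨c, rfl⟩ := CombMap.exists_src v
        obtain ⟨x, hx, hx'⟩ := h (N.src (G.piece w c))
        have := G.src_toPiece w hx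
        rw [toPiece_piece] at this
        refine ⟨_, this, ?_⟩
        induction x using G.cases with
        | h1 b' => rw [toPiece_core]
        | h2 w' c' =>
          by_cases hw : w' = w
          · subst hw; rw [toPiece_piece]; exact (G.piece_mem_outer hι).1 hx'
          · rw [G.toPiece_piece_of_ne hw]
    · rintro ⟨hB, hM⟩ v
      obtain ⟨d, rfl⟩ := CombMap.exists_src v
      induction d using G.cases with
      | h1 b =>
        obtain ⟨x, hx, hx'⟩ := hB (B.src b)
        exact ⟨G.core x, G.src_core_iff.2 hx, G.core_mem_outer.2 hx'⟩
      | h2 w c =>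
        obtain ⟨x, hx, hx'⟩ := hM w ((M w).src c)
        exact ⟨G.piece w x, G.src_piece_iff.2 hx, (G.piece_mem_outer hι).2 hx'⟩
  simp only [RootedMap.IsOuterplanar, CombMap.isPlanar_iff, G.connected_iff,
    G.cyclesBound_iff hι, G.isSimple_iff, hv]
  constructor
  · rintro ⟨⟨⟨a1, a2⟩, b1, b2⟩, ⟨c1, c2⟩, d1, d2⟩
    exact ⟨⟨⟨a1, b1⟩, c1, d1⟩, fun w => ⟨⟨a2 w, b2 w⟩, c2 w, d2 w⟩⟩
  · rintro ⟨⟨⟨a1, b1⟩, c1, d1⟩, h⟩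
    exact ⟨⟨⟨a1, fun w => (h w).1.1⟩, b1, fun w => (h w).1.2⟩, ⟨c1, fun w => (h w).2.1⟩, d1,
      fun w => (h w).2.2⟩

end
end Gluing

namespace Gluing
variable {N B : RootedMap} {W : Type} {ι : W → B.Dart} {M : W → RootedMap}

section
variable (G : Gluing N B ι M)
include G

/-! #### Counting vertices -/

theorem numVertices_add [Finite W] : N.numVertices + Nat.card W =
    B.numVertices + ∑ᶠ w, (M w).numVertices := by
  classical
  have := Fintype.ofFinite W
  let fB : B.Vertex → N.Vertex := Quotient.lift (fun b => N.src (G.core b))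
    fun b b' h => G.src_core_iff.2 (CombMap.src_eq_src_iff.2 h)
  let fM : ∀ w, (M w).Vertex → N.Vertex := fun w => Quotient.lift (fun b => N.src (G.piece w b))
    fun b b' h => G.src_piece_iff.2 (CombMap.src_eq_src_iff.2 h)
  have hfB : ∀ b, fB (B.src b) = N.src (G.core b) := fun _ => rfl
  have hfM : ∀ w c, fM w ((M w).src c) = N.src (G.piece w c) := fun _ _ => rfl
  let Ψ : B.Vertex ⊕ (Σ w, (M w).Vertex) → N.Vertex ⊕ W := Sum.elim (fun u => .inl (fB u))
    fun v => if v.2 = (M v.1).src (M v.1).root then .inr v.1 else .inl (fM v.1 v.2)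
  have hΨ : Function.Bijective Ψ := by
    constructor
    · have hmix : ∀ u w v, v ≠ (M w).src (M w).root → fB u ≠ fM w v := by
        intro u w v hv h
        obtain ⟨b, rfl⟩ := CombMap.exists_src u
        obtain ⟨c, rfl⟩ := CombMap.exists_src v
        have := G.src_toPiece w (hfM w c ▸ hfB b ▸ h)
        rw [toPiece_core, toPiece_piece] at this
        exact hv this.symm
      rintro (u | ⟨w, v⟩) (u' | ⟨w', v'⟩) h
      · obtain ⟨b, rfl⟩ := CombMap.exists_src u
        obtain ⟨c, rfl⟩ := CombMap.exists_src u'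
        rw [G.src_core_iff.1 (Sum.inl.inj h)]
      · simp only [Ψ, Sum.elim_inl, Sum.elim_inr] at h
        split_ifs at h with hv
        exact (hmix _ _ _ hv (Sum.inl.inj h)).elim
      · simp only [Ψ, Sum.elim_inl, Sum.elim_inr] at h
        split_ifs at h with hv
        exact (hmix _ _ _ hv (Sum.inl.inj h).symm).elim
      · simp only [Ψ, Sum.elim_inr] at h
        split_ifs at h with hv hv' hv'
        · obtain rfl := Sum.inr.inj h
          rw [hv, hv']
        · have h := Sum.inl.inj h
          obtain ⟨b, rfl⟩ := CombMap.exists_src v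
          obtain ⟨c, rfl⟩ := CombMap.exists_src v'
          rw [hfM, hfM] at h
          by_cases hw : w = w'
          · subst hw
            rw [G.src_piece_iff.1 h]
          · have := G.src_toPiece w' h
            rw [G.toPiece_piece_of_ne hw, toPiece_piece] at this
            exact (hv' this.symm).elim
    · rintro (v | w)
      · obtain ⟨d, rfl⟩ := CombMap.exists_src v
        induction d using G.cases with
        | h1 b => exact ⟨.inl (B.src b), rfl⟩
        | h2 w c =>
          by_cases hc : (M w).src c = (M w).src (M w).root
          · refine ⟨.inl (B.src (ι w)), ?_⟩
            rw [G.src_piece_iff.2 hc, G.src_root]; rfl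
          · exact ⟨.inr ⟨w, (M w).src c⟩, by simp [Ψ, hc, hfM]⟩
      · exact ⟨.inr ⟨w, (M w).src (M w).root⟩, by simp [Ψ]⟩
  have := Nat.card_congr (Equiv.ofBijective Ψ hΨ)
  rw [Nat.card_sum, Nat.card_sum, Nat.card_sigma] at this
  rw [finsum_eq_sum_of_fintype]
  exact this.symm

/-! #### The core and the pieces as submaps -/

theorem isEmbedding_core : CombMap.IsEmbedding (P := B.toCombMap) (N := N.toCombMap) G.core where
  injective := G.core_injective
  rev := G.rev_core
  rot b := by
    by_cases hb : ∃ w, ι w = B.rot b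
    · obtain ⟨w, hw⟩ := hb
      have hnot : ∀ c, G.piece w c ∉ Set.range G.core := fun c ⟨b, hb⟩ => G.core_ne_piece b w c hb
      have h0 : CombMap.ReachAvoiding N.rot (Set.range G.core) (G.core b)
          (G.piece w (M w).root) := .single (G.rot.inl_attach b w hw)
      have key : ∀ c, (M w).rot.SameCycle (M w).root c →
          CombMap.ReachAvoiding N.rot (Set.range G.core) (G.core b) (G.piece w c) := by
        intro c hc
        refine sameCycle_induction (P := fun c => CombMap.ReachAvoiding N.rot (Set.range G.core)
          (G.core b) (G.piece w c)) (fun x hx => ?_) hc h0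
        by_cases hr : (M w).rot x = (M w).root
        · rw [hr]; exact h0
        · exact hx.trans (hnot x) (.single (G.rot.inr w x hr))
      have h1 : (M w).rot ((M w).rot.symm (M w).root) = (M w).root := by simp
      refine (key _ ⟨-1, by simp⟩).trans (hnot ((M w).rot.symm (M w).root)) (.single ?_)
      rw [← hw]
      exact G.rot.inr_root w _ h1
    · push Not at hb
      exact .single (G.rot.inl b hb)

theorem isEmbedding_piece (w : W) :
    CombMap.IsEmbedding (P := (M w).toCombMap) (N := N.toCombMap) (G.piece w) where
  injective := G.piece_injective w
  rev := G.rev_piece w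
  rot c := by
    by_cases hc : (M w).rot c = (M w).root
    · let S := Set.range (G.piece w)
      let a : S := ⟨G.piece w c, c, rfl⟩
      obtain ⟨c', hc'⟩ := (CombMap.firstReturn (M := N.toCombMap) S a).2
      have h1 := CombMap.reachAvoiding_firstReturn (M := N.toCombMap) a
      rw [← hc'] at h1
      -- the first return is injective, and it is known on all darts but `c`
      have h2 : (M w).rot.symm c' = c := by
        by_contra hne
        have h3 : (M w).rot ((M w).rot.symm c') ≠ (M w).root := fun h => hne
          ((M w).rot.injective (h.trans hc.symm))
        have h4 := CombMap.firstReturn_eq (M := N.toCombMap) (S := S)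
          (a := ⟨G.piece w ((M w).rot.symm c'), _, rfl⟩) (b := G.piece w c') ⟨c', rfl⟩
          (.single (by
            have := G.rot.inr w _ h3
            rwa [Equiv.apply_symm_apply] at this))
        have h5 : CombMap.firstReturn (M := N.toCombMap) S a = ⟨G.piece w c', c', rfl⟩ :=
          Subtype.ext hc'.symm
        have h6 := CombMap.firstReturn_injective (M := N.toCombMap) S (h4.trans h5.symm)
        exact hne (G.piece_injective w (congrArg Subtype.val h6))
      rw [← h2, Equiv.apply_symm_apply, h2]
      exact h1
    · exact .single (G.rot.inr w c hc)

/-! #### Distances from the root -/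

theorem dist_piece (hc : N.graph.Connected) (w : W) (c : (M w).Dart) :
    N.graph.dist (N.src N.root) (N.src (G.piece w c)) =
      N.graph.dist (N.src N.root) (N.src (G.core (ι w))) +
        (M w).graph.dist ((M w).src (M w).root) ((M w).src c) := by
  classical
  have hadj : ∀ (P : CombMap), P.graph.Connected → ∀ r d : P.Dart,
      P.graph.dist (P.src r) (P.src (P.rev d)) ≤ P.graph.dist (P.src r) (P.src d) + 1 := by
    intro P hP r d
    refine (hP.dist_triangle (v := P.src d)).trans ?_
    rcases CombMap.adj_or_eq d with h | h
    · rw [SimpleGraph.dist_eq_one_iff_adj.2 h]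
    · simp [← h]
  have hcM := (G.connected_iff.1 hc).2 w
  apply le_antisymm
  · refine (hc.dist_triangle (v := N.src (G.core (ι w)))).trans (Nat.add_le_add_left ?_ _)
    have := CombMap.le_add_dist hcM
      (p := fun c => N.graph.dist (N.src (G.piece w (M w).root)) (N.src (G.piece w c)))
      (fun d => by rw [G.src_piece_iff.2 (CombMap.src_rot d)])
      (fun d => by rw [← G.rev_piece]; exact hadj N.toCombMap hc _ _) (M w).root c
    simpa [G.src_root] using this
  · let back : N.Dart → N.Dart := fun d =>
      if d ∈ Set.range (G.piece w) then G.core (ι w) else d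
    have hpp : ∀ c, back (G.piece w c) = G.core (ι w) := fun c => if_pos ⟨c, rfl⟩
    have hpc : ∀ b, back (G.core b) = G.core b := fun b => if_neg fun ⟨c, hc⟩ =>
      G.core_ne_piece b w c hc.symm
    have hpn : ∀ w' c, w' ≠ w → back (G.piece w' c) = G.piece w' c := fun w' c h => if_neg
      fun ⟨c', hc'⟩ => G.piece_ne_piece h c c' hc'.symm
    have h := CombMap.le_add_dist hc (p := fun d => N.graph.dist (N.src N.root) (N.src (back d))
      + (M w).graph.dist ((M w).src (M w).root) ((M w).src (G.toPiece w d)))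
      (fun d => by
        rw [G.src_toPiece w (CombMap.src_rot d)]
        congr 2
        induction d using G.cases with
        | h1 b =>
          by_cases hb : ∃ w, ι w = B.rot b
          · obtain ⟨w', hw⟩ := hb
            have h1 : N.rot (G.core b) = G.piece w' (M w').root := G.rot.inl_attach b w' hw
            have h2 : N.src (G.core b) = N.src (G.core (ι w')) := by
              rw [hw, G.src_core_iff, CombMap.src_rot]
            by_cases hww : w' = w
            · subst hww; rw [h1, hpp, hpc, h2]
            · rw [h1, hpn _ _ hww, hpc, h2, G.src_root]
          · push Not at hb
            have h1 : N.rot (G.core b) = G.core (B.rot b) := G.rot.inl b hb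
            rw [h1, hpc, hpc, ← h1, CombMap.src_rot]
        | h2 w' c =>
          by_cases hr : (M w').rot c = (M w').root
          · have h1 : N.rot (G.piece w' c) = G.core (ι w') := G.rot.inr_root w' c hr
            by_cases hww : w' = w
            · subst hww; rw [h1, hpp, hpc]
            · rw [h1, hpn _ _ hww, hpc, ← h1, CombMap.src_rot]
          · have h1 : N.rot (G.piece w' c) = G.piece w' ((M w').rot c) := G.rot.inr w' c hr
            by_cases hww : w' = w
            · subst hww; rw [h1, hpp, hpp]
            · rw [h1, hpn _ _ hww, hpn _ _ hww, ← h1, CombMap.src_rot])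
      (fun d => by
        have hout : ∀ d, back d = d → back (N.rev d) = N.rev d →
            G.toPiece w d = (M w).root → G.toPiece w (N.rev d) = (M w).root →
            N.graph.dist (N.src N.root) (N.src (back (N.rev d))) + (M w).graph.dist
              ((M w).src (M w).root) ((M w).src (G.toPiece w (N.rev d))) ≤
            N.graph.dist (N.src N.root) (N.src (back d)) + (M w).graph.dist
              ((M w).src (M w).root) ((M w).src (G.toPiece w d)) + 1 := by
          intro d h1 h2 h3 h4
          rw [h1, h2, h3, h4]
          have := hadj N.toCombMap hc N.root d
          omega
        induction d using G.cases with
        | h1 b =>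
          refine hout _ (hpc b) ?_ (G.toPiece_core w b) ?_
          · rw [G.rev_core, hpc]
          · rw [G.rev_core, toPiece_core]
        | h2 w' c' =>
          by_cases hww : w' = w
          · subst hww
            rw [G.rev_piece, hpp, hpp, toPiece_piece, toPiece_piece]
            have := hadj (M w').toCombMap hcM (M w').root c'
            omega
          · refine hout _ (hpn _ _ hww) ?_ (G.toPiece_piece_of_ne hww c') ?_
            · rw [G.rev_piece, hpn _ _ hww]
            · rw [G.rev_piece, G.toPiece_piece_of_ne hww])
      N.root (G.piece w c)
    rw [hpp, toPiece_piece] at h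
    have hr : back N.root = N.root := by
      have := hpc B.root
      rw [core, ← G.root] at this
      exact this
    have hr2 : G.toPiece w N.root = (M w).root := by
      have := G.toPiece_core w B.root
      rw [core, ← G.root] at this
      exact this
    rw [hr, hr2] at h
    simpa using h

/-! #### Blocks -/

theorem mem_range_piece_iff {w : W} {d : N.Dart} (hd : N.src d ≠ N.src (G.core (ι w))) :
    N.rot d ∈ Set.range (G.piece w) ↔ d ∈ Set.range (G.piece w) := by
  have hnc : ∀ b, G.core b ∉ Set.range (G.piece w) := fun b ⟨c, hc⟩ => G.core_ne_piece b w c hc.symm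
  have hnp : ∀ w' c, w' ≠ w → G.piece w' c ∉ Set.range (G.piece w) := fun w' c h ⟨c', hc'⟩ =>
    G.piece_ne_piece h c c' hc'.symm
  induction d using G.cases with
  | h1 b =>
    refine iff_of_false (fun h => ?_) (hnc b)
    by_cases hb : ∃ w, ι w = B.rot b
    · obtain ⟨w', hw⟩ := hb
      have h1 : N.rot (G.core b) = G.piece w' (M w').root := G.rot.inl_attach b w' hw
      by_cases hww : w' = w
      · subst hww
        exact hd (by rw [hw, G.src_core_iff, CombMap.src_rot])
      · rw [h1] at h
        exact hnp _ _ hww h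
    · push Not at hb
      have h1 : N.rot (G.core b) = G.core (B.rot b) := G.rot.inl b hb
      rw [h1] at h
      exact hnc _ h
  | h2 w' c =>
    by_cases hr : (M w').rot c = (M w').root
    · have h1 : N.rot (G.piece w' c) = G.core (ι w') := G.rot.inr_root w' c hr
      rw [h1]
      refine iff_of_false (hnc _) (hnp _ _ ?_)
      rintro rfl
      exact hd (by rw [← h1, CombMap.src_rot])
    · have h1 : N.rot (G.piece w' c) = G.piece w' ((M w').rot c) := G.rot.inr w' c hr
      rw [h1]
      by_cases hww : w' = w
      · subst hww
        exact iff_of_true ⟨_, rfl⟩ ⟨_, rfl⟩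
      · exact iff_of_false (hnp _ _ hww) (hnp _ _ hww)

/-- A non-separable submap of a gluing lies in the core or in one of the pieces. -/
theorem nonseparable_subset (hN : N.IsSimple) {T : Set N.Dart} (hT : ∀ x ∈ T, N.rev x ∈ T)
    (hns : (N.submap T hT).IsNonseparable) :
    T ⊆ Set.range G.core ∨ ∃ w, T ⊆ Set.range (G.piece w) := by
  have hsep : ∀ w, T ⊆ Set.range (G.piece w) ∨ ∀ d ∈ T, d ∉ Set.range (G.piece w) := by
    intro w
    rcases hns.separation (A := {x : T | x.1 ∈ Set.range (G.piece w)})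
      (E := {x : T | N.src x.1 = N.src (G.core (ι w))})
      (fun d hd => (G.isEmbedding_piece w).range_closed _ hd)
      (fun x hx y hy => CombMap.submap_src_eq_iff.2 (hx.trans hy.symm))
      (fun x hx d hd h => hN.1 d.1 ((CombMap.submap_src_eq_iff.1 hd).trans
        (CombMap.submap_src_eq_iff.1 h).symm))
      (fun d hd => by
        obtain ⟨k, -, hk, -⟩ := CombMap.reachAvoiding_firstReturn (M := N.toCombMap) (S := T) d
        change (CombMap.firstReturn (M := N.toCombMap) T d).1 ∈ Set.range (G.piece w) ↔
          d.1 ∈ Set.range (G.piece w)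
        rw [← hk]
        clear hk
        have hsrc : ∀ k : ℕ, N.src ((N.rot ^ k) d.1) = N.src d.1 := fun k =>
          (CombMap.src_eq_src_iff.2 ⟨k, by simp⟩).symm
        induction k with
        | zero => simp
        | succ k ih =>
          rw [pow_succ', Equiv.Perm.mul_apply]
          exact (G.mem_range_piece_iff (by rw [hsrc]; exact hd)).trans ih) with h | h
    · exact .inl fun x hx => h ⟨x, hx⟩
    · exact .inr fun x hx => h ⟨x, hx⟩
  by_cases h : ∃ w, T ⊆ Set.range (G.piece w)
  · exact .inr h
  · push Not at h
    refine .inl fun d hd => ?_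
    induction d using G.cases with
    | h1 b => exact ⟨b, rfl⟩
    | h2 w c => exact ((hsep w).resolve_left (h w) _ hd ⟨c, rfl⟩).elim

/-- The blocks of a gluing along a non-separable core are the core and the blocks of the
pieces. -/
theorem isBlock_iff (hN : N.IsSimple) (hB : B.IsNonseparable) {S : Set N.Dart} :
    N.IsBlock S ↔ S = Set.range G.core ∨
      ∃ w T, (M w).IsBlock T ∧ S = G.piece w '' T := by
  have hcore : ∃ hT : ∀ x ∈ Set.range G.core, N.rev x ∈ Set.range G.core,
      (N.submap _ hT).IsNonseparable :=
    ⟨G.isEmbedding_core.range_closed, (G.isEmbedding_core.iso_submap_range _).isNonseparable hB⟩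
  have hpiece : ∀ w T, (∃ hT : ∀ x ∈ T, (M w).rev x ∈ T, ((M w).submap T hT).IsNonseparable) →
      ∃ hT : ∀ x ∈ G.piece w '' T, N.rev x ∈ G.piece w '' T,
        (N.submap _ hT).IsNonseparable := by
    rintro w T ⟨hT, h⟩
    exact ⟨(G.isEmbedding_piece w).image_closed hT,
      ((G.isEmbedding_piece w).iso_submap_image hT _).isNonseparable h⟩
  have hpiece' : ∀ w T, (∃ hT : ∀ x ∈ G.piece w '' T, N.rev x ∈ G.piece w '' T,
        (N.submap _ hT).IsNonseparable) →
      (∃ hT : ∀ x ∈ T, (M w).rev x ∈ T, ((M w).submap T hT).IsNonseparable) := by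
    rintro w T ⟨hT, h⟩
    have hT' : ∀ x ∈ T, (M w).rev x ∈ T := fun x hx => by
      obtain ⟨y, hy, hyx⟩ := hT _ ⟨x, hx, rfl⟩
      rw [G.rev_piece] at hyx
      rwa [← G.piece_injective w hyx]
    exact ⟨hT', ((G.isEmbedding_piece w).iso_submap_image hT' hT).symm.isNonseparable h⟩
  constructor
  · rintro ⟨⟨hS, hns⟩, hmax⟩
    rcases G.nonseparable_subset hN hS hns with h | ⟨w, h⟩
    · exact .inl (h.antisymm (hmax hcore h))
    · refine .inr ⟨w, G.piece w ⁻¹' S, ⟨?_, fun T' hT' hle => ?_⟩,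
        (Set.image_preimage_eq_of_subset h).symm⟩
      · apply hpiece'
        rw [Set.image_preimage_eq_of_subset h]
        exact ⟨hS, hns⟩
      · exact fun c hc => hmax (hpiece w T' hT') (fun d hd => by
          obtain ⟨c', rfl⟩ := h hd
          exact ⟨c', hle hd, rfl⟩) ⟨c, hc, rfl⟩
  · rintro (rfl | ⟨w, T, ⟨hT, hmax⟩, rfl⟩)
    · refine ⟨hcore, fun T' hT' hle => ?_⟩
      obtain ⟨hT1, hT2⟩ := hT'
      rcases G.nonseparable_subset hN hT1 hT2 with h | ⟨w, h⟩
      · exact h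
      · obtain ⟨c, hc⟩ := h (hle ⟨B.root, rfl⟩)
        exact (G.core_ne_piece _ _ _ hc.symm).elim
    · refine ⟨hpiece w T hT, fun T' hT' hle => ?_⟩
      obtain ⟨hT1, hT2⟩ := hT'
      obtain ⟨_, ⟨x⟩, _⟩ := hT
      have hx : G.piece w x.1 ∈ T' := hle ⟨x.1, x.2, rfl⟩
      rcases G.nonseparable_subset hN hT1 hT2 with h | ⟨w', h⟩
      · obtain ⟨b, hb⟩ := h hx
        exact (G.core_ne_piece _ _ _ hb).elim
      · have hw : w' = w := by
          by_contra hne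
          obtain ⟨b, hb⟩ := h hx
          exact G.piece_ne_piece hne _ _ hb
        subst hw
        have h1 := hmax (y := G.piece w' ⁻¹' T') (hpiece' _ _ (by
          rw [Set.image_preimage_eq_of_subset h]; exact ⟨hT1, hT2⟩))
          (fun c hc => hle ⟨c, hc, rfl⟩)
        intro d hd
        obtain ⟨c, rfl⟩ := h hd
        exact ⟨c, h1 hd, rfl⟩

theorem isBlockRoot_core (hs : B.OuterSimple) (hc : N.graph.Connected) (x : N.Dart) :
    N.IsBlockRoot (Set.range G.core) x ↔ x = N.root := by
  constructor
  · rintro ⟨⟨b, rfl⟩, hb, hd⟩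
    have h1 := hd (G.core B.root) ⟨_, rfl⟩
    rw [show G.core B.root = N.root from G.root.symm, SimpleGraph.dist_self,
      Nat.le_zero] at h1
    have h2 := hc.dist_eq_zero_iff.1 h1
    rw [G.root] at h2
    rw [hs b (G.core_mem_outer.1 hb) B.root rfl (G.src_core_iff.1 h2).symm]
    exact G.root.symm
  · rintro rfl
    exact ⟨⟨B.root, G.root.symm⟩, rfl, fun y _ => by simp⟩

theorem isBlockRoot_piece (hι : ∀ w, ι w ∈ B.outer) (hc : N.graph.Connected) {w : W}
    {T : Set (M w).Dart} {c : (M w).Dart} :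
    N.IsBlockRoot (G.piece w '' T) (G.piece w c) ↔ (M w).IsBlockRoot T c := by
  have h1 : G.piece w c ∈ G.piece w '' T ↔ c ∈ T := (G.piece_injective w).mem_set_image
  refine and_congr h1 (and_congr (G.piece_mem_outer hι) ?_)
  simp only [Set.forall_mem_image, G.dist_piece hc, Nat.add_le_add_iff_left]

/-- The class with prescribed blocks is described by the gluing. -/
theorem mem_iff [Finite W] (C : Set RootedMapClass) (hι : ∀ w, ι w ∈ B.outer)
    (hs : B.OuterSimple) (hB : B.IsNonseparable) : OuterplanarClass.Mem C N ↔
      B.IsOuterplanar ∧ (Quotient.mk _ B : RootedMapClass) ∈ C ∧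
        ∀ w, OuterplanarClass.Mem C (M w) := by
  have hclassB : ∀ (hT : ∀ x ∈ Set.range G.core, N.rev x ∈ Set.range G.core)
      (h : N.root ∈ Set.range G.core),
      (Quotient.mk _ { N.submap _ hT with root := ⟨N.root, h⟩ } : RootedMapClass) =
        Quotient.mk _ B := by
    intro hT h
    refine (Quotient.sound (s := RootedMap.isoSetoid) <| show RootedMap.Iso _ _ from
      ⟨CombMap.rangeEquiv G.isEmbedding_core,
      fun x => G.isEmbedding_core.rangeEquiv_rot (hT' := hT) x, fun x => G.isEmbedding_core.rangeEquiv_rev (hT' := hT) x,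
      Subtype.ext G.root.symm⟩).symm
  have hclassM : ∀ w T (hT : ∀ x ∈ T, (M w).rev x ∈ T)
      (hT' : ∀ x ∈ G.piece w '' T, N.rev x ∈ G.piece w '' T) c (hc : c ∈ T)
      (h : G.piece w c ∈ G.piece w '' T),
      (Quotient.mk _ { N.submap _ hT' with root := ⟨G.piece w c, h⟩ } : RootedMapClass) =
        Quotient.mk _ { (M w).submap T hT with root := ⟨c, hc⟩ } := by
    intro w T hT hT' c hc h
    refine (Quotient.sound (s := RootedMap.isoSetoid) <| show RootedMap.Iso _ _ from
      ⟨CombMap.imageEquiv (G.isEmbedding_piece w) T,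
      fun x => (G.isEmbedding_piece w).imageEquiv_rot (hT := hT) (hT' := hT') x,
      fun x => (G.isEmbedding_piece w).imageEquiv_rev (hT := hT) (hT' := hT') x, rfl⟩).symm
  constructor
  · rintro ⟨hout, hbl⟩
    obtain ⟨h1, h2⟩ := (G.isOuterplanar_iff hι).1 hout
    refine ⟨h1, ?_, fun w => ⟨h2 w, fun T hT hTb => ?_⟩⟩
    · obtain ⟨x, hx, hxC⟩ := hbl _ G.isEmbedding_core.range_closed
        ((G.isBlock_iff hout.2.1 hB).2 (.inl rfl))
      obtain rfl := (G.isBlockRoot_core hs hout.connected x).1 hx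
      rwa [hclassB] at hxC
    · have hT' := (G.isEmbedding_piece w).image_closed hT
      obtain ⟨x, hx, hxC⟩ := hbl _ hT'
        ((G.isBlock_iff hout.2.1 hB).2 (.inr ⟨w, T, hTb, rfl⟩))
      obtain ⟨c, hc, rfl⟩ := hx.1
      refine ⟨c, (G.isBlockRoot_piece hι hout.connected).1 hx, ?_⟩
      rwa [hclassM w T hT hT' c hc] at hxC
  · rintro ⟨h1, h2, h3⟩
    have hout := (G.isOuterplanar_iff hι).2 ⟨h1, fun w => (h3 w).1⟩
    refine ⟨hout, fun S hS hSb => ?_⟩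
    rcases (G.isBlock_iff hout.2.1 hB).1 hSb with rfl | ⟨w, T, hT, rfl⟩
    · refine ⟨N.root, (G.isBlockRoot_core hs hout.connected _).2 rfl, ?_⟩
      rwa [hclassB]
    · obtain ⟨hTr, -⟩ := hT.1
      obtain ⟨c, hc, hcC⟩ := (h3 w).2 T hTr hT
      refine ⟨G.piece w c, (G.isBlockRoot_piece hι hout.connected).2 hc, ?_⟩
      rwa [hclassM w T hTr hS c hc.1]

end
end Gluing

namespace Gluing

/-! ### Existence and uniqueness of gluings -/

theorem exists_gluing (B : RootedMap) {W : Type} [Finite W] {ι : W → B.Dart}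
    (hι : Function.Injective ι) (M : W → RootedMap) :
    ∃ N : RootedMap, Nonempty (Gluing N B ι M) := by
  classical
  let D := B.Dart ⊕ (Σ w, (M w).Dart)
  let θ : D → D := Sum.elim
    (fun b => if h : ∃ w, ι w = b then .inr ⟨h.choose, (M h.choose).root⟩ else .inl b)
    (fun c => if c.2 = (M c.1).root then .inl (ι c.1) else .inr c)
  have h1 : ∀ w, θ (.inl (ι w)) = .inr ⟨w, (M w).root⟩ := by
    intro w
    have hex : ∃ w', ι w' = ι w := ⟨w, rfl⟩
    have hw : hex.choose = w := hι hex.choose_spec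
    simp only [θ, Sum.elim_inl, dif_pos hex]
    rw [hw]
  have h2 : ∀ b, (∀ w, ι w ≠ b) → θ (.inl b) = .inl b := by
    intro b hb
    have : ¬ ∃ w, ι w = b := by push Not; exact hb
    simp only [θ, Sum.elim_inl, dif_neg this]
  have h3 : ∀ w, θ (.inr ⟨w, (M w).root⟩) = .inl (ι w) := by
    intro w; simp [θ]
  have h4 : ∀ w c, c ≠ (M w).root → θ (.inr ⟨w, c⟩) = .inr ⟨w, c⟩ := by
    intro w c hc; simp [θ, hc]
  have hθ : Function.Involutive θ := by
    rintro (b | ⟨w, c⟩)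
    · by_cases hb : ∃ w, ι w = b
      · obtain ⟨w, rfl⟩ := hb
        rw [h1, h3]
      · push Not at hb
        rw [h2 b hb, h2 b hb]
    · by_cases hc : c = (M w).root
      · rw [hc, h3, h1]
      · rw [h4 w c hc, h4 w c hc]
  let N : RootedMap :=
    { Dart := D
      finite := inferInstance
      rot := (Equiv.sumCongr B.rot (Equiv.sigmaCongrRight fun w => (M w).rot)).trans
        hθ.toPerm
      rev := Equiv.sumCongr B.rev (Equiv.sigmaCongrRight fun w => (M w).rev)
      rev_rev := by
        rintro (b | ⟨w, c⟩)
        · exact congrArg Sum.inl (B.rev_rev b)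
        · exact congrArg (fun c => Sum.inr (⟨w, c⟩ : Σ w, (M w).Dart)) ((M w).rev_rev c)
      rev_ne := by
        rintro (b | ⟨w, c⟩) h
        · exact B.rev_ne b (Sum.inl.inj h)
        · have := Sum.inr.inj h
          exact (M w).rev_ne c (by simpa using this)
      root := .inl B.root }
  refine ⟨N, ⟨⟨Equiv.refl _, fun _ => rfl, fun _ _ => rfl, ⟨?_, ?_, ?_, ?_⟩, rfl⟩⟩⟩
  · intro b hb
    exact h2 _ hb
  · intro b w hb
    change θ (.inl (B.rot b)) = _
    rw [← hb, h1]; rfl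
  · intro w c hc
    exact h4 w _ hc
  · intro w c hc
    change θ (.inr ⟨w, (M w).rot c⟩) = _
    rw [hc, h3]; rfl

/-- Gluings of isomorphic data are isomorphic. -/
theorem iso_of_iso {N B N' B' : RootedMap} {W W' : Type} {ι : W → B.Dart} {M : W → RootedMap}
    {ι' : W' → B'.Dart} {M' : W' → RootedMap} (G : Gluing N B ι M) (G' : Gluing N' B' ι' M')
    (β : B.Dart ≃ B'.Dart) (hβ : ∀ b, β (B.rot b) = B'.rot (β b))
    (hβ2 : ∀ b, β (B.rev b) = B'.rev (β b)) (hβ3 : β B.root = B'.root) (ω : W ≃ W')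
    (hω : ∀ w, ι' (ω w) = β (ι w)) (hM : ∀ w, RootedMap.Iso (M w) (M' (ω w))) :
    RootedMap.Iso N N' := by
  choose γ hγ1 hγ2 hγ3 using hM
  let E : N.Dart ≃ N'.Dart := (G.e.symm.trans
    (Equiv.sumCongr β (Equiv.sigmaCongr ω γ))).trans G'.e
  have hEc : ∀ b, E (G.core b) = G'.core (β b) := fun b => by simp [E, core]
  have hEp : ∀ w c, E (G.piece w c) = G'.piece (ω w) (γ w c) := fun w c => by
    simp [E, piece, Equiv.sigmaCongr]
  refine ⟨E, fun d => ?_, fun d => ?_, ?_⟩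
  · induction d using G.cases with
    | h1 b =>
      by_cases hb : ∃ w, ι w = B.rot b
      · obtain ⟨w, hw⟩ := hb
        have e1 : N.rot (G.core b) = G.piece w (M w).root := G.rot.inl_attach b w hw
        have e2 : N'.rot (G'.core (β b)) = G'.piece (ω w) (M' (ω w)).root :=
          G'.rot.inl_attach (β b) (ω w) (by rw [hω, hw, hβ])
        rw [e1, hEc, e2, hEp, hγ3]
      · push Not at hb
        have e1 : N.rot (G.core b) = G.core (B.rot b) := G.rot.inl b hb
        have e2 : N'.rot (G'.core (β b)) = G'.core (B'.rot (β b)) :=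
          G'.rot.inl (β b) (fun w' => by
            obtain ⟨w, rfl⟩ := ω.surjective w'
            rw [hω, ← hβ]
            exact fun h => hb w (β.injective h))
        rw [e1, hEc, hEc, e2, hβ]
    | h2 w c =>
      by_cases hc : (M w).rot c = (M w).root
      · have e1 : N.rot (G.piece w c) = G.core (ι w) := G.rot.inr_root w c hc
        have e2 : N'.rot (G'.piece (ω w) (γ w c)) = G'.core (ι' (ω w)) :=
          G'.rot.inr_root _ _ (by rw [← hγ1, hc, hγ3])
        rw [e1, hEp, e2, hEc, hω]
      · have e1 : N.rot (G.piece w c) = G.piece w ((M w).rot c) := G.rot.inr w c hc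
        have e2 : N'.rot (G'.piece (ω w) (γ w c)) =
            G'.piece (ω w) ((M' (ω w)).rot (γ w c)) :=
          G'.rot.inr _ _ (by rw [← hγ1, ← hγ3]; exact fun h => hc ((γ w).injective h))
        rw [e1, hEp, hEp, e2, hγ1]
  · induction d using G.cases with
    | h1 b => rw [G.rev_core, hEc, hEc, G'.rev_core, hβ2]
    | h2 w c => rw [G.rev_piece, hEp, hEp, G'.rev_piece, hγ2]
  · have e1 : N.root = G.core B.root := G.root
    have e2 : N'.root = G'.core B'.root := G'.root
    rw [e1, e2, hEc, hβ3]

end Gluing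

namespace RootedMap

/-- The darts of the block of the root: those reached from the root without crossing a corner of
the outer face. -/
inductive InCore (N : RootedMap) : N.Dart → Prop
  | root : InCore N N.root
  | rev {d : N.Dart} : InCore N d → InCore N (N.rev d)
  | rot {d : N.Dart} : InCore N d → N.rot d ∉ N.outer → InCore N (N.rot d)
  | rot_symm {d : N.Dart} : InCore N (N.rot d) → N.rot d ∉ N.outer → InCore N d

theorem Iso.mem_outer_iff {N N' : RootedMap} {ε : N.Dart ≃ N'.Dart}
    (h1 : ∀ x, ε (N.rot x) = N'.rot (ε x)) (h2 : ∀ x, ε (N.rev x) = N'.rev (ε x))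
    (h3 : ε N.root = N'.root) {d : N.Dart} : ε d ∈ N'.outer ↔ d ∈ N.outer := by
  have hf : ∀ x, ε (N.facePerm x) = N'.facePerm (ε x) := fun x => by
    rw [CombMap.facePerm_apply, CombMap.facePerm_apply, h1, h2]
  constructor
  · intro h
    have := eq_of_sameCycle (f := fun x => N.rightFace (ε.symm x)) (σ := N'.facePerm)
      (fun x => by
        obtain ⟨x, rfl⟩ := ε.surjective x
        rw [← hf, ε.symm_apply_apply, ε.symm_apply_apply, CombMap.rightFace_facePerm])
      (CombMap.rightFace_eq_iff.1 h)
    simp only [Equiv.symm_apply_apply, ← h3] at this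
    exact this.symm
  · intro h
    have := eq_of_sameCycle (f := fun x => N'.rightFace (ε x)) (σ := N.facePerm)
      (fun x => by rw [hf, CombMap.rightFace_facePerm]) (CombMap.rightFace_eq_iff.1 h)
    rw [h3] at this
    exact this.symm

theorem InCore.map {N N' : RootedMap} {ε : N.Dart ≃ N'.Dart}
    (h1 : ∀ x, ε (N.rot x) = N'.rot (ε x)) (h2 : ∀ x, ε (N.rev x) = N'.rev (ε x))
    (h3 : ε N.root = N'.root) {d : N.Dart} (h : N.InCore d) : N'.InCore (ε d) := by
  induction h with
  | root => rw [h3]; exact .root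
  | rev _ ih => rw [h2]; exact .rev ih
  | rot _ ho ih =>
    rw [h1]
    exact .rot ih (by rw [← h1, Iso.mem_outer_iff h1 h2 h3]; exact ho)
  | rot_symm _ ho ih =>
    rw [h1] at ih
    exact .rot_symm ih (by rw [← h1, Iso.mem_outer_iff h1 h2 h3]; exact ho)

end RootedMap

namespace Gluing
variable {N B : RootedMap} {W : Type} {ι : W → B.Dart} {M : W → RootedMap}

theorem inCore_iff (G : Gluing N B ι M) (hι : ∀ w, ι w ∈ B.outer) (hs : B.OuterSimple)
    (hc : B.DartConnected) {d : N.Dart} : N.InCore d ↔ d ∈ Set.range G.core := by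
  constructor
  · intro h
    induction h with
    | root => exact ⟨_, G.root.symm⟩
    | rev _ ih => exact G.isEmbedding_core.range_closed _ ih
    | rot _ ho ih =>
      obtain ⟨b, rfl⟩ := ih
      by_cases hb : ∃ w, ι w = B.rot b
      · obtain ⟨w, hw⟩ := hb
        have e1 : N.rot (G.core b) = G.piece w (M w).root := G.rot.inl_attach b w hw
        rw [e1] at ho
        exact (ho ((G.piece_mem_outer hι).2 rfl)).elim
      · push Not at hb
        exact ⟨_, (G.rot.inl b hb).symm⟩
    | @rot_symm d _ ho ih =>
      induction d using G.cases with
      | h1 b => exact ⟨b, rfl⟩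
      | h2 w c =>
        obtain ⟨b, hb⟩ := ih
        by_cases hr : (M w).rot c = (M w).root
        · have e1 : N.rot (G.piece w c) = G.core (ι w) := G.rot.inr_root w c hr
          rw [e1] at ho
          exact (ho (G.core_mem_outer.2 (hι w))).elim
        · have e1 : N.rot (G.piece w c) = G.piece w ((M w).rot c) := G.rot.inr w c hr
          rw [e1] at hb
          exact (G.core_ne_piece _ _ _ hb).elim
  · have hstep : ∀ b, B.rot b ∉ B.outer → N.rot (G.core b) = G.core (B.rot b) := fun b hb =>
      G.rot.inl b fun w hw => hb (hw ▸ hι w)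
    have hiff : ∀ b, B.rot b ∉ B.outer → (N.InCore (G.core (B.rot b)) ↔ N.InCore (G.core b)) := by
      intro b hb
      have h1 : N.rot (G.core b) ∉ N.outer := by rwa [hstep b hb, G.core_mem_outer]
      rw [← hstep b hb]
      exact ⟨fun h => .rot_symm h h1, fun h => .rot h h1⟩
    rintro ⟨b, rfl⟩
    refine hc {b | N.InCore (G.core b)} ⟨B.root, ?_⟩ (fun b hb => ?_) (fun b hb => ?_) b
    · change N.InCore (G.e (.inl B.root))
      rw [← G.root]; exact .root
    · by_cases ho : B.rot b ∈ B.outer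
      · -- the other darts at this vertex are not outer
        refine (sameCycle_induction (σ := B.rot) (P := fun d => B.src d = B.src (B.rot b) ∧
          (N.InCore (G.core d) ↔ N.InCore (G.core (B.rot b)))) (fun d hd => ?_)
          (x := B.rot b) (y := b) (Equiv.Perm.sameCycle_apply_left.2 (.refl _ _))
          ⟨rfl, Iff.rfl⟩).2.1 hb
        refine ⟨by rw [CombMap.src_rot, hd.1], ?_⟩
        by_cases hd' : B.rot d ∈ B.outer
        · rw [hs _ hd' _ ho (by rw [CombMap.src_rot, hd.1])]
        · rw [hiff d hd', hd.2]
      · exact (hiff b ho).2 hb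
    · change N.InCore (G.core (B.rev b))
      rw [← G.rev_core]
      exact .rev hb

theorem reachAvoiding_unique {D : CombMap} {S : Set D.Dart} {a b c : D.Dart} (ha : a ∈ S)
    (hb : b ∈ S) (hc : c ∈ S) (h1 : CombMap.ReachAvoiding D.rot S a b)
    (h2 : CombMap.ReachAvoiding D.rot S a c) : b = c :=
  congrArg Subtype.val ((CombMap.firstReturn_eq (a := ⟨a, ha⟩) hb h1).symm.trans
    (CombMap.firstReturn_eq (a := ⟨a, ha⟩) hc h2))

/-- An isomorphism between gluings maps the core isomorphically onto the core. -/
theorem exists_core_iso {N' B' : RootedMap} {W' : Type} {ι' : W' → B'.Dart}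
    {M' : W' → RootedMap} (G : Gluing N B ι M) (G' : Gluing N' B' ι' M')
    (hι : ∀ w, ι w ∈ B.outer) (hs : B.OuterSimple) (hc : B.DartConnected)
    (hι' : ∀ w, ι' w ∈ B'.outer) (hs' : B'.OuterSimple) (hc' : B'.DartConnected)
    {ε : N.Dart ≃ N'.Dart} (h1 : ∀ x, ε (N.rot x) = N'.rot (ε x))
    (h2 : ∀ x, ε (N.rev x) = N'.rev (ε x)) (h3 : ε N.root = N'.root) :
    ∃ β : B.Dart ≃ B'.Dart, (∀ x, β (B.rot x) = B'.rot (β x)) ∧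
      (∀ x, β (B.rev x) = B'.rev (β x)) ∧ β B.root = B'.root ∧
      ∀ b, ε (G.core b) = G'.core (β b) := by
  have hmem : ∀ d, ε d ∈ Set.range G'.core ↔ d ∈ Set.range G.core := by
    intro d
    rw [← G.inCore_iff hι hs hc, ← G'.inCore_iff hι' hs' hc']
    refine ⟨fun h => ?_, fun h => h.map h1 h2 h3⟩
    have := h.map (ε := ε.symm) (fun x => by rw [Equiv.symm_apply_eq, h1, Equiv.apply_symm_apply])
      (fun x => by rw [Equiv.symm_apply_eq, h2, Equiv.apply_symm_apply])
      (by rw [Equiv.symm_apply_eq, h3])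
    rwa [ε.symm_apply_apply] at this
  have hex : ∀ b, ∃ b', G'.core b' = ε (G.core b) := fun b => (hmem _).2 ⟨b, rfl⟩
  choose f hf using hex
  have hbij : Function.Bijective f := by
    constructor
    · intro b b' h
      apply G.core_injective
      apply ε.injective
      rw [← hf, ← hf, h]
    · intro b'
      obtain ⟨b, hb⟩ := (hmem (ε.symm (G'.core b'))).1 (by rw [ε.apply_symm_apply]; exact ⟨_, rfl⟩)
      refine ⟨b, G'.core_injective ?_⟩
      rw [hf, hb, ε.apply_symm_apply]
  refine ⟨Equiv.ofBijective f hbij, fun b => ?_, fun b => ?_, ?_, fun b => (hf b).symm⟩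
  · apply G'.core_injective
    change G'.core (f (B.rot b)) = G'.core (B'.rot (f b))
    refine reachAvoiding_unique (D := N'.toCombMap) (S := Set.range G'.core)
      (a := G'.core (f b)) ⟨_, rfl⟩ ⟨_, rfl⟩ ⟨_, rfl⟩ ?_ (G'.isEmbedding_core.rot (f b))
    obtain ⟨k, hk, hk1, hk2⟩ := G.isEmbedding_core.rot b
    have hpow : ∀ (k : ℕ) d, (N'.rot ^ k) (ε d) = ε ((N.rot ^ k) d) := by
      intro k d
      induction k with
      | zero => rfl
      | succ k ih => rw [pow_succ', pow_succ', Equiv.Perm.mul_apply, Equiv.Perm.mul_apply, ih, h1]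
    refine ⟨k, hk, ?_, fun j hj hjk hjm => hk2 j hj hjk ?_⟩
    · rw [hf, hf, hpow, hk1]
    · rw [hf, hpow] at hjm
      exact (hmem _).1 hjm
  · apply G'.core_injective
    change G'.core (f (B.rev b)) = G'.core (B'.rev (f b))
    rw [hf, ← G.rev_core, h2, ← hf, G'.rev_core]
  · apply G'.core_injective
    change G'.core (f B.root) = _
    rw [hf]
    have e1 : N.root = G.core B.root := G.root
    have e2 : N'.root = G'.core B'.root := G'.root
    rw [← e1, h3, e2]

/-- In isomorphic gluings on the same core, the attached pieces correspond. -/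
theorem exists_piece_iso {N' : RootedMap} {W' : Type} {ι' : W' → B.Dart}
    {M' : W' → RootedMap} (G : Gluing N B ι M) (G' : Gluing N' B ι' M')
    (hι : ∀ w, ι w ∈ B.outer) (hs : B.OuterSimple) (hc : B.DartConnected)
    (hι' : ∀ w, ι' w ∈ B.outer) (hM : ∀ w, (M w).DartConnected)
    (hM' : ∀ w, (M' w).DartConnected) (hN : RootedMap.Iso N N') (w : W) :
    ∃ w', ι' w' = ι w ∧ RootedMap.Iso (M w) (M' w') := by
  obtain ⟨ε, h1, h2, h3⟩ := hN
  obtain ⟨β, hβ1, hβ2, hβ3, hβ⟩ := G.exists_core_iso G' hι hs hc hι' hs hc h1 h2 h3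
  have hβid : ∀ b, β b = b := by
    refine hc {b | β b = b} ⟨_, hβ3⟩ (fun b hb => ?_) (fun b hb => ?_)
    · exact (hβ1 b).trans (congrArg _ hb)
    · exact (hβ2 b).trans (congrArg _ hb)
  have hcore : ∀ b, ε (G.core b) = G'.core b := fun b => by rw [hβ, hβid]
  have hnot : ∀ w c b, ε (G.piece w c) ≠ G'.core b := fun w c b h => by
    rw [← hcore] at h
    exact G.core_ne_piece b w c (ε.injective h).symm
  let b := B.rot.symm (ι w)
  have hb : B.rot b = ι w := by simp [b]
  have e1 : N.rot (G.core b) = G.piece w (M w).root := G.rot.inl_attach b w hb.symm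
  have e2 : N'.rot (G'.core b) = ε (G.piece w (M w).root) := by rw [← hcore, ← h1, e1]
  obtain ⟨w', hw'⟩ : ∃ w', ι' w' = B.rot b := by
    by_contra! hcon
    have e3 : N'.rot (G'.core b) = G'.core (B.rot b) := G'.rot.inl b hcon
    exact hnot _ _ _ (e2.symm.trans e3)
  have e4 : N'.rot (G'.core b) = G'.piece w' (M' w').root := G'.rot.inl_attach b w' hw'
  have hroot : ε (G.piece w (M w).root) = G'.piece w' (M' w').root := e2.symm.trans e4
  refine ⟨w', hw'.trans hb, ?_⟩
  have hmem : ∀ c, ∃ c', G'.piece w' c' = ε (G.piece w c) := by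
    refine hM w {c | ∃ c', G'.piece w' c' = ε (G.piece w c)} ⟨_, _, hroot.symm⟩
      (fun c hcc => ?_) (fun c hcc => ?_)
    · by_cases hr : (M w).rot c = (M w).root
      · rw [hr]; exact ⟨_, hroot.symm⟩
      · obtain ⟨c', hc'⟩ := hcc
        have e5 : N.rot (G.piece w c) = G.piece w ((M w).rot c) := G.rot.inr w c hr
        have hr' : (M' w').rot c' ≠ (M' w').root := fun h => by
          have e6 : N'.rot (G'.piece w' c') = G'.core (ι' w') := G'.rot.inr_root w' c' h
          rw [hc', ← h1, e5] at e6
          exact hnot _ _ _ e6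
        have e6 : N'.rot (G'.piece w' c') = G'.piece w' ((M' w').rot c') := G'.rot.inr w' c' hr'
        exact ⟨_, by rw [← e6, hc', ← h1, e5]⟩
    · obtain ⟨c', hc'⟩ := hcc
      exact ⟨(M' w').rev c', by rw [← G'.rev_piece, hc', ← h2, G.rev_piece]⟩
  choose g hg using hmem
  have hgroot : g (M w).root = (M' w').root := G'.piece_injective w' ((hg _).trans hroot)
  have hgrev : ∀ c, g ((M w).rev c) = (M' w').rev (g c) := fun c => G'.piece_injective w' (by
    rw [hg, ← G.rev_piece, h2, ← hg, G'.rev_piece])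
  have hgrot : ∀ c, g ((M w).rot c) = (M' w').rot (g c) := by
    intro c
    by_cases hr : (M w).rot c = (M w).root
    · rw [hr, hgroot]
      by_contra hne
      have e6 : N'.rot (G'.piece w' (g c)) = G'.piece w' ((M' w').rot (g c)) :=
        G'.rot.inr w' (g c) (fun h => hne h.symm)
      have e5 : N.rot (G.piece w c) = G.core (ι w) := G.rot.inr_root w c hr
      rw [hg, ← h1, e5, hcore] at e6
      exact G'.core_ne_piece _ _ _ e6
    · have e5 : N.rot (G.piece w c) = G.piece w ((M w).rot c) := G.rot.inr w c hr
      have hr' : (M' w').rot (g c) ≠ (M' w').root := fun h => by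
        have e6 : N'.rot (G'.piece w' (g c)) = G'.core (ι' w') := G'.rot.inr_root w' _ h
        rw [hg, ← h1, e5] at e6
        exact hnot _ _ _ e6
      have e6 : N'.rot (G'.piece w' (g c)) = G'.piece w' ((M' w').rot (g c)) :=
        G'.rot.inr w' _ hr'
      apply G'.piece_injective w'
      rw [← e6, hg, hg, ← h1, e5]
  have hbij : Function.Bijective g := by
    constructor
    · intro c c' h
      apply G.piece_injective w
      apply ε.injective
      rw [← hg, ← hg, h]
    · refine hM' w' (Set.range g) ⟨_, (M w).root, rfl⟩ ?_ ?_
      · rintro _ ⟨c, rfl⟩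
        exact ⟨_, hgrot c⟩
      · rintro _ ⟨c, rfl⟩
        exact ⟨_, hgrev c⟩
  exact ⟨Equiv.ofBijective g hbij, hgrot, hgrev, hgroot⟩

end Gluing

namespace RootedMap
variable {N : RootedMap}

/-! ### Decomposition of an outerplanar map at the block of its root -/

theorem InCore.eq_of_invariant {α : Type*} {f : N.Dart → α} (h1 : ∀ d, f (N.rev d) = f d)
    (h2 : ∀ d, N.rot d ∉ N.outer → f (N.rot d) = f d) {d : N.Dart} (h : N.InCore d) :
    f d = f N.root := by
  induction h with
  | root => rfl
  | rev _ ih => rw [h1, ih]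
  | rot _ ho ih => rw [h2 _ ho, ih]
  | rot_symm _ ho ih => rw [← h2 _ ho, ih]

/-- The block of the root meets each vertex in at most one corner of the outer face. -/
theorem InCore.outer_unique (h : N.IsOuterplanar) {x y : N.Dart} (hx : N.InCore x)
    (hy : N.InCore y) (hxo : x ∈ N.outer) (hyo : y ∈ N.outer) (hxy : N.src x = N.src y) :
    x = y := by
  classical
  by_contra hne
  obtain ⟨f, h1, h2⟩ := h.cyclesBound.exists_cut (hxo.trans hyo.symm) hxy
  have hval := CombMap.value_after_cut hne (CombMap.src_eq_src_iff.1 hxy) h2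
  have h3 : ∀ d, N.rot d ∉ N.outer → f (N.rot d) = f d := fun d hd => by
    have e1 : N.rot d ≠ x := fun h => hd (h ▸ hxo)
    have e2 : N.rot d ≠ y := fun h => hd (h ▸ hyo)
    have := h2 d
    rw [if_neg e1, if_neg e2] at this
    simpa using this
  have := (hx.eq_of_invariant h1 h3).trans (hy.eq_of_invariant h1 h3).symm
  linarith

theorem exists_decomposition (h : N.IsOuterplanar) :
    ∃ (B : RootedMap) (W : Type) (_ : Finite W) (ι : W → B.Dart) (M : W → RootedMap),
      Function.Injective ι ∧ (∀ w, ι w ∈ B.outer) ∧ B.OuterSimple ∧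
        Nonempty (Gluing N B ι M) := by
  classical
  let O : Set N.Dart := N.outer
  let nxt : O → O := CombMap.firstReturn (M := N.toCombMap) O
  have hnxt : Function.Bijective nxt :=
    Finite.injective_iff_bijective.1 (CombMap.firstReturn_injective (M := N.toCombMap) O)
  have hreach : ∀ x : O, CombMap.ReachAvoiding N.rot O x (nxt x).1 := fun x =>
    CombMap.reachAvoiding_firstReturn (M := N.toCombMap) x
  have hsrc : ∀ x : O, N.src (nxt x).1 = N.src x.1 := fun x =>
    CombMap.src_firstReturn (M := N.toCombMap) x
  let S : Set N.Dart := {d | N.InCore d}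
  have hSrev : ∀ d ∈ S, N.rev d ∈ S := fun d hd => .rev hd
  -- a dart of the core followed by an outer corner belongs to the sector of an outer dart
  have hlast : ∀ d ∈ S, N.rot d ∈ O → ∃ x : O, x.1 ∈ S ∧ (nxt x).1 = N.rot d := by
    intro d hd hdo
    obtain ⟨x, hx⟩ := hnxt.2 ⟨N.rot d, hdo⟩
    refine ⟨x, ?_, congrArg Subtype.val hx⟩
    obtain ⟨k, hk, hk1, hk2⟩ := hreach x
    rw [congrArg Subtype.val hx] at hk1
    have hback : ∀ j, j < k → (N.rot ^ (k - 1 - j)) x.1 ∈ S := by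
      intro j
      induction j with
      | zero =>
        intro _
        have : (N.rot ^ (k - 1)) x.1 = d := by
          apply N.rot.injective
          rw [← Equiv.Perm.mul_apply, ← pow_succ', Nat.sub_add_cancel hk, hk1]
        rw [Nat.sub_zero, this]; exact hd
      | succ j ih =>
        intro hj
        have h1 := ih (by omega)
        have h2 : (N.rot ^ (k - 1 - j)) x.1 = N.rot ((N.rot ^ (k - 1 - (j + 1))) x.1) := by
          rw [← Equiv.Perm.mul_apply, ← pow_succ']; congr 2; omega
        have h3 := hk2 (k - 1 - j) (by omega) (by omega)
        rw [h2] at h1 h3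
        exact .rot_symm h1 h3
    have := hback (k - 1) (by omega)
    rwa [Nat.sub_self] at this
  have hsector : ∀ x : O, x.1 ∈ S → ∀ k : ℕ, (∀ j, 0 < j → j < k → (N.rot ^ j) x.1 ∉ O) →
      ∀ j, j < k → (N.rot ^ j) x.1 ∈ S := by
    intro x hx k hk j
    induction j with
    | zero => intro _; simpa using hx
    | succ j ih =>
      intro hj
      have := hk (j + 1) (by omega) hj
      rw [pow_succ', Equiv.Perm.mul_apply] at this ⊢
      exact .rot (ih (by omega)) this
  let W : Type := {x : O // x.1 ∈ S ∧ (nxt x).1 ≠ x.1}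
  have hcut : ∀ w : W, ∃ f : N.Dart → ℝ, (∀ d, f (N.rev d) = f d) ∧ (∀ d, f (N.rot d) =
      f d + (if N.rot d = w.1.1 then 1 else 0) - (if N.rot d = (nxt w.1).1 then 1 else 0)) ∧
      f (nxt w.1).1 = f w.1.1 - 1 := by
    intro w
    obtain ⟨f, h1, h2⟩ := h.cyclesBound.exists_cut (x := w.1.1) (y := (nxt w.1).1)
      (w.1.2.trans (nxt w.1).2.symm) (hsrc w.1).symm
    exact ⟨f, h1, h2, CombMap.value_after_cut w.2.2.symm
      (CombMap.src_eq_src_iff.1 (hsrc w.1).symm) h2⟩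
  choose f hfrev hfrot hfval using hcut
  let T : W → Set N.Dart := fun w => {d | f w d = f w w.1.1 - 1}
  have hTrev : ∀ w, ∀ d ∈ T w, N.rev d ∈ T w := fun w d hd => (hfrev w d).trans hd
  have hyT : ∀ w, (nxt w.1).1 ∈ T w := hfval
  have hTS : ∀ w, ∀ d ∈ S, d ∉ T w := by
    intro w d hd hdT
    have h3 : ∀ d, N.rot d ∉ N.outer → f w (N.rot d) = f w d := fun d hd => by
      have e1 : N.rot d ≠ w.1.1 := fun h => hd (h ▸ w.1.2)
      have e2 : N.rot d ≠ (nxt w.1).1 := fun h => hd (h ▸ (nxt w.1).2)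
      have := hfrot w d
      rw [if_neg e1, if_neg e2] at this
      simpa using this
    have h4 := (InCore.eq_of_invariant (hfrev w) h3 hd).trans
      (InCore.eq_of_invariant (hfrev w) h3 w.2.1).symm
    have : f w d = f w w.1.1 - 1 := hdT
    linarith
  have hTrot : ∀ w, ∀ d ∈ T w, N.rot d ∈ T w ∨ N.rot d = w.1.1 := by
    intro w d hd
    by_contra! hcon
    have h1 := hfrot w d
    have h2 : f w d = f w w.1.1 - 1 := hd
    have h3 := hfval w
    rw [if_neg hcon.2] at h1
    by_cases h4 : N.rot d = (nxt w.1).1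
    · exact hcon.1 (h4 ▸ hyT w)
    · rw [if_neg h4] at h1
      exact hcon.1 (by change f w (N.rot d) = _; linarith)
  have hTdisj : ∀ w w' d, d ∈ T w → d ∈ T w' → w = w' := by
    intro w w' d hd hd'
    by_contra hne
    refine hTS w w.1.1 w.2.1 (h.dartConnected (T w ∩ T w') ⟨d, hd, hd'⟩ ?_ ?_ w.1.1).1
    · rintro e ⟨he, he'⟩
      have hxne : w.1.1 ≠ w'.1.1 := fun h => hne (Subtype.ext (Subtype.ext h))
      rcases hTrot w e he with h1 | h1
      · rcases hTrot w' e he' with h2 | h2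
        · exact ⟨h1, h2⟩
        · exact (hTS w _ w'.2.1 (h2 ▸ h1)).elim
      · rcases hTrot w' e he' with h2 | h2
        · exact (hTS w' _ w.2.1 (h1 ▸ h2)).elim
        · exact (hxne (h1.symm.trans h2)).elim
    · rintro e ⟨he, he'⟩
      exact ⟨hTrev w e he, hTrev w' e he'⟩
  -- where the rotation leads from the core
  have hSrot : ∀ d ∈ S, N.rot d ∉ S →
      ∃ w : W, N.rot d = (nxt w.1).1 ∧ CombMap.ReachAvoiding N.rot S d w.1.1 := by
    intro d hd hdS
    have ho : N.rot d ∈ O := by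
      by_contra ho
      exact hdS (.rot hd ho)
    obtain ⟨x, hx, hxd⟩ := hlast d hd ho
    let w : W := ⟨x, hx, fun h => hdS (by rw [← hxd, h]; exact hx)⟩
    refine ⟨w, hxd.symm, ?_⟩
    obtain ⟨k, hk, hk1, hk2⟩ :=
      CombMap.reachAvoiding_firstReturn (M := N.toCombMap) (S := S) ⟨d, hd⟩
    have hin : ∀ j, 0 < j → j ≤ k → (N.rot ^ j) d ∈ T w ∨ (N.rot ^ j) d = x.1 := by
      intro j
      induction j with
      | zero => intro h0; omega
      | succ j ih =>
        intro _ hj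
        rcases Nat.eq_zero_or_pos j with rfl | hpos
        · left
          rw [zero_add, pow_one, ← hxd]
          exact hyT w
        · rcases ih hpos (by omega) with h1 | h1
          · rw [pow_succ', Equiv.Perm.mul_apply]
            exact hTrot w _ h1
          · exact (hk2 j hpos (by omega) (h1 ▸ hx)).elim
    refine ⟨k, hk, ?_, hk2⟩
    rcases hin k hk le_rfl with h1 | h1
    · exact (hTS w _ (hk1 ▸ (CombMap.firstReturn (M := N.toCombMap) S ⟨d, hd⟩).2) h1).elim
    · exact h1
  have hcover : ∀ d, d ∈ S ∨ ∃ w, d ∈ T w := by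
    refine h.dartConnected {d | d ∈ S ∨ ∃ w, d ∈ T w} ⟨N.root, .inl .root⟩ ?_ ?_
    · rintro d (hd | ⟨w, hd⟩)
      · by_cases hS : N.rot d ∈ S
        · exact .inl hS
        · obtain ⟨w, hw, -⟩ := hSrot d hd hS
          exact .inr ⟨w, hw ▸ hyT w⟩
      · rcases hTrot w d hd with h1 | h1
        · exact .inr ⟨w, h1⟩
        · exact .inl (h1 ▸ w.2.1)
    · rintro d (hd | ⟨w, hd⟩)
      · exact .inl (hSrev d hd)
      · exact .inr ⟨w, hTrev w d hd⟩
  let B : RootedMap := { N.submap S hSrev with root := ⟨N.root, .root⟩ }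
  let M : W → RootedMap := fun w =>
    { N.submap (T w) (hTrev w) with root := ⟨(nxt w.1).1, hyT w⟩ }
  let ι : W → B.Dart := fun w => ⟨w.1.1, w.2.1⟩
  have hBrot : ∀ b : B.Dart, N.rot b.1 ∈ S → (B.rot b).1 = N.rot b.1 := fun b hb =>
    congrArg Subtype.val (CombMap.firstReturn_eq (M := N.toCombMap) (a := (b : S)) hb (.single rfl))
  have hBrot' : ∀ (b : B.Dart) (w : W), CombMap.ReachAvoiding N.rot S b.1 w.1.1 →
      B.rot b = ι w := fun b w hb =>
    CombMap.firstReturn_eq (M := N.toCombMap) (a := (b : S)) w.2.1 hb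
  have hMrot : ∀ w (c : (M w).Dart), N.rot c.1 ∈ T w → ((M w).rot c).1 = N.rot c.1 :=
    fun w c hc => congrArg Subtype.val
      (CombMap.firstReturn_eq (M := N.toCombMap) (a := (c : T w)) hc (.single rfl))
  have hMrot' : ∀ w (c : (M w).Dart), N.rot c.1 = w.1.1 → (M w).rot c = (M w).root := by
    intro w c hc
    refine CombMap.firstReturn_eq (M := N.toCombMap) (a := (c : T w)) (hyT w) ?_
    refine (CombMap.ReachAvoiding.single hc).trans (hTS w _ w.2.1) ?_
    obtain ⟨k, hk, hk1, hk2⟩ := hreach w.1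
    exact ⟨k, hk, hk1, fun j _ hj => hTS w _ (hsector w.1 w.2.1 k hk2 j hj)⟩
  have hsubsrc : ∀ b b' : B.Dart, B.src b = B.src b' ↔ N.src b.1 = N.src b'.1 := fun b b' =>
    CombMap.submap_src_eq_iff (hS := hSrev)
  have hinj : Function.Injective (Sum.elim (fun b : B.Dart => b.1)
      (fun c : Σ w, (M w).Dart => c.2.1)) := by
    rintro (b | ⟨w, c⟩) (b' | ⟨w', c'⟩) hbb
    · exact congrArg Sum.inl (Subtype.ext hbb)
    · exact (hTS w' _ b.2 ((show b.1 = c'.1 from hbb) ▸ c'.2)).elim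
    · exact (hTS w _ b'.2 ((show c.1 = b'.1 from hbb) ▸ c.2)).elim
    · have hcc : c.1 = c'.1 := hbb
      obtain rfl := hTdisj w w' c.1 c.2 (hcc ▸ c'.2)
      rw [show c = c' from Subtype.ext hcc]
  have hsurj : Function.Surjective (Sum.elim (fun b : B.Dart => b.1)
      (fun c : Σ w, (M w).Dart => c.2.1)) := by
    intro d
    rcases hcover d with hd | ⟨w, hd⟩
    · exact ⟨.inl ⟨d, hd⟩, rfl⟩
    · exact ⟨.inr ⟨w, ⟨d, hd⟩⟩, rfl⟩
  have hWfin : Finite W := inferInstanceAs (Finite {x : O // x.1 ∈ S ∧ (nxt x).1 ≠ x.1})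
  have hιinj : Function.Injective ι := fun w w' hw =>
    Subtype.ext (Subtype.ext (congrArg (fun b : B.Dart => b.1) hw))
  let G : Gluing N B ι M :=
    { e := Equiv.ofBijective _ ⟨hinj, hsurj⟩
      rev_inl := fun b => rfl
      rev_inr := fun w c => rfl
      root := rfl
      rot :=
        { inl := fun b hb => by
            by_cases hS : N.rot b.1 ∈ S
            · exact (hBrot b hS).symm
            · obtain ⟨w, -, hw⟩ := hSrot b.1 b.2 hS
              exact (hb w (hBrot' b w hw).symm).elim
          inl_attach := fun b w hb => by
            by_cases hS : N.rot b.1 ∈ S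
            · -- the next outer corner after the sector of `ι w` would be `ι w` itself
              exfalso
              have h1 : w.1.1 = N.rot b.1 :=
                (congrArg Subtype.val hb).trans (hBrot b hS)
              obtain ⟨x, hx, hxb⟩ := hlast b.1 b.2 (h1 ▸ w.1.2)
              have h2 : x = w.1 := Subtype.ext (InCore.outer_unique h hx w.2.1 x.2 w.1.2 (by
                rw [h1, ← hxb, hsrc]))
              exact w.2.2 (by rw [h1, ← hxb, h2])
            · obtain ⟨w', hw', hw2⟩ := hSrot b.1 b.2 hS
              obtain rfl := hιinj (hb.trans (hBrot' b w' hw2))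
              exact hw'
          inr := fun w c hc => by
            rcases hTrot w c.1 c.2 with h1 | h1
            · exact (hMrot w c h1).symm
            · exact (hc (hMrot' w c h1)).elim
          inr_root := fun w c hc => by
            rcases hTrot w c.1 c.2 with h1 | h1
            · -- entering the sector of the root dart is possible from the core only
              exfalso
              have h2 : N.rot c.1 = (nxt w.1).1 :=
                (hMrot w c h1).symm.trans (congrArg Subtype.val hc)
              have h3 := hfrot w c.1
              have h4 : f w c.1 = f w w.1.1 - 1 := c.2
              have h5 := hfval w
              rw [h2, if_neg w.2.2, if_pos rfl] at h3
              linarith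
            · exact h1 } }
  refine ⟨B, W, hWfin, ι, M, hιinj, fun w => ?_, fun x hx y hy hxy => ?_, ⟨G⟩⟩
  · exact G.rightFace_core_iff.1 (show N.rightFace w.1.1 = N.rightFace N.root from w.1.2)
  · exact Subtype.ext (InCore.outer_unique h x.2 y.2 (G.core_mem_outer.2 hx)
      (G.core_mem_outer.2 hy) ((hsubsrc x y).1 hxy))

end RootedMap

/-! ### The block decomposition of classes of outerplanar maps -/

namespace RootedMap

theorem numVertices_eq_of_iso {M N : RootedMap} (h : Iso M N) :
    M.numVertices = N.numVertices := by
  obtain ⟨e, h1, h2, -⟩ := h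
  obtain ⟨g⟩ := CombMap.Iso.exists_graphIso (M := M.toCombMap) (N := N.toCombMap) ⟨e, h1, h2⟩
  exact Nat.card_congr g.toEquiv

theorem two_le_numVertices {M : RootedMap} (h : M.IsSimple) : 2 ≤ M.numVertices := by
  have h1 := h.1 M.root
  have : Nontrivial M.Vertex := ⟨_, _, h1⟩
  have := Finite.one_lt_card (α := M.Vertex)
  exact this

/-- The vertices of a map whose outer face visits each vertex exactly once. -/
theorem OuterSimple.numVertices {B : RootedMap} (h : B.OuterSimple) (ho : B.IsOuterplanar) :
    B.numVertices = Nat.card B.outer := by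
  refine (Nat.card_congr (Equiv.ofBijective (fun x : B.outer => B.src x.1) ⟨?_, ?_⟩)).symm
  · intro x y hxy
    exact Subtype.ext (h x x.2 y y.2 hxy)
  · intro v
    obtain ⟨x, hx, hxo⟩ := ho.2.2 v
    exact ⟨⟨x, hxo⟩, hx⟩

end RootedMap

namespace OuterplanarClass

/-- The number of vertices of an isomorphism class. -/
def classSize : RootedMapClass → ℕ :=
  Quotient.lift (fun M : RootedMap => M.numVertices) fun _ _ h => RootedMap.numVertices_eq_of_iso h

variable (C : Set RootedMapClass)

/-- The isomorphism classes of maps with at least one edge and blocks in `C`. -/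
def MemClass : Type 1 := {a : RootedMapClass // ∃ M, Mem C M ∧ Quotient.mk _ M = a}

/-- The isomorphism classes of maps with blocks in `C`; `none` is the single vertex. -/
abbrev Tree : Type 1 := Option (MemClass C)

variable {C}

/-- The number of vertices. -/
def Tree.size (t : Tree C) : ℕ := t.elim 1 fun a => classSize a.1

/-- A chosen representative. -/
def MemClass.rep (a : MemClass C) : RootedMap := a.2.choose

theorem MemClass.rep_mem (a : MemClass C) : Mem C a.rep := a.2.choose_spec.1

theorem MemClass.mk_rep (a : MemClass C) : Quotient.mk _ a.rep = a.1 := a.2.choose_spec.2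

theorem Tree.one_le_size (t : Tree C) : 1 ≤ t.size := by
  rcases t with _ | a
  · exact le_rfl
  · have := RootedMap.two_le_numVertices a.rep_mem.1.2.1
    change 1 ≤ classSize a.1
    rw [← a.mk_rep]
    exact one_le_two.trans this

variable (C) in
/-- A block of the class together with a map attached to each of its outer corners. -/
abbrev Decorated : Type 1 := Σ b : C, ((b.1.out : RootedMap).outer → Tree C)

section
variable (hC : ∀ M : RootedMap, (Quotient.mk _ M : RootedMapClass) ∈ C →
      M.IsOuterplanar ∧ M.IsNonseparable)
include hC

theorem out_spec (b : C) : (b.1.out : RootedMap).IsOuterplanar ∧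
    (b.1.out : RootedMap).IsNonseparable ∧ (b.1.out : RootedMap).OuterSimple := by
  have h := hC b.1.out (by rw [Quotient.out_eq]; exact b.2)
  exact ⟨h.1, h.2, .of_isNonseparable h.1 h.2⟩

/-- The corners of the block at which a nontrivial map is attached. -/
abbrev Decorated.Support (p : Decorated C) : Type :=
  {x : (p.1.1.out : RootedMap).outer // (p.2 x).isSome}

omit hC in
/-- The corner at which an attached map sits, as a dart of the block. -/
def Decorated.ι (p : Decorated C) (w : p.Support) : (p.1.1.out : RootedMap).Dart := w.1.1

omit hC in
/-- The nontrivial map attached at a corner of the support. -/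
def Decorated.attached (p : Decorated C) (w : p.Support) : RootedMap :=
  ((p.2 w.1).get w.2).rep

omit hC in
theorem Decorated.ι_injective (p : Decorated C) : Function.Injective p.ι :=
  fun _ _ h => Subtype.ext (Subtype.ext h)

omit hC in
theorem Decorated.exists_gluing (p : Decorated C) :
    ∃ N : RootedMap, Nonempty (Gluing N p.1.1.out p.ι p.attached) :=
  Gluing.exists_gluing _ p.ι_injective _

omit hC in
/-- The map assembled from a decorated block. -/
def Decorated.glue (p : Decorated C) : RootedMap := p.exists_gluing.choose

omit hC in
/-- The assembled map is a gluing of the attached maps into the block. -/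
def Decorated.gluing (p : Decorated C) : Gluing p.glue p.1.1.out p.ι p.attached :=
  p.exists_gluing.choose_spec.some

theorem Decorated.mem_glue (p : Decorated C) : Mem C p.glue := by
  obtain ⟨h1, h2, h3⟩ := out_spec hC p.1
  refine (p.gluing.mem_iff C (fun w => w.1.2) h3 h2).2 ⟨h1, ?_, fun w => MemClass.rep_mem _⟩
  rw [Quotient.out_eq]
  exact p.1.2

theorem Decorated.numVertices_glue (p : Decorated C) :
    p.glue.numVertices = ∑ᶠ x, (p.2 x).size := by
  classical
  obtain ⟨h1, h2, h3⟩ := out_spec hC p.1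
  have : Fintype (p.1.1.out : RootedMap).outer := Fintype.ofFinite _
  have hV := p.gluing.numVertices_add
  rw [h3.numVertices h1, finsum_eq_sum_of_fintype] at hV
  have hsize : ∀ w : p.Support, (p.attached w).numVertices = (p.2 w.1).size := by
    intro w
    obtain ⟨a, ha⟩ := Option.isSome_iff_exists.1 w.2
    have h4 : p.attached w = a.rep := by simp [Decorated.attached, ha]
    rw [h4, ha]
    change _ = classSize a.1
    rw [← a.mk_rep]
    rfl
  rw [finsum_eq_sum_of_fintype]
  have h5 := Fintype.sum_subtype_add_sum_subtype (fun x => (p.2 x).isSome = true)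
    (fun x => (p.2 x).size)
  have h6 : ∀ x : {x // ¬ (p.2 x).isSome = true}, (p.2 x.1).size = 1 := by
    intro x
    have : p.2 x.1 = none := by simpa using x.2
    rw [this]; rfl
  simp only [h6, Finset.sum_const, Finset.card_univ, smul_eq_mul, mul_one] at h5
  have h7 := Fintype.card_subtype_compl (fun x => (p.2 x).isSome = true)
  have h8 := Fintype.card_subtype_le (fun x => (p.2 x).isSome = true)
  have h9 : ∑ w, (p.attached w).numVertices =
      ∑ w : {x // (p.2 x).isSome = true}, (p.2 w.1).size :=
    Fintype.sum_equiv (Equiv.refl _) _ _ fun w => hsize w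
  have h10 : Fintype.card p.Support = Fintype.card {x // (p.2 x).isSome = true} :=
    Fintype.card_congr (Equiv.refl _)
  rw [h9, Nat.card_eq_fintype_card, Nat.card_eq_fintype_card, h10] at hV
  rw [← h5, h7]
  omega

/-- The class of the map assembled from a decorated block. -/
def Decorated.toMemClass (p : Decorated C) : MemClass C := ⟨Quotient.mk _ p.glue, _, p.mem_glue hC, rfl⟩

theorem Decorated.toMemClass_bijective :
    Function.Bijective (Decorated.toMemClass hC : Decorated C → MemClass C) := by
  classical
  constructor
  · rintro ⟨b, f⟩ ⟨b', f'⟩ h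
    have hiso : RootedMap.Iso (Decorated.glue ⟨b, f⟩) (Decorated.glue ⟨b', f'⟩) :=
      Quotient.exact (s := RootedMap.isoSetoid) (congrArg Subtype.val h)
    obtain ⟨h1, h2, h3⟩ := out_spec hC b
    obtain ⟨h1', h2', h3'⟩ := out_spec hC b'
    have hb : b = b' := by
      obtain ⟨ε, e1, e2, e3⟩ := hiso
      obtain ⟨β, hβ1, hβ2, hβ3, -⟩ := (Decorated.gluing ⟨b, f⟩).exists_core_iso
        (Decorated.gluing ⟨b', f'⟩) (fun w => w.1.2) h3 h1.dartConnected (fun w => w.1.2) h3'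
        h1'.dartConnected e1 e2 e3
      apply Subtype.ext
      rw [← Quotient.out_eq b.1, ← Quotient.out_eq b'.1]
      exact Quotient.sound (s := RootedMap.isoSetoid) ⟨β, hβ1, hβ2, hβ3⟩
    subst hb
    have key : ∀ f f' : (b.1.out : RootedMap).outer → Tree C,
        RootedMap.Iso (Decorated.glue ⟨b, f⟩) (Decorated.glue ⟨b, f'⟩) →
        ∀ x a, f x = some a → f' x = some a := by
      intro f f' hiso x a hx
      obtain ⟨w', hw', hM⟩ := (Decorated.gluing ⟨b, f⟩).exists_piece_iso
        (Decorated.gluing ⟨b, f'⟩) (fun w => w.1.2) h3 h1.dartConnected (fun w => w.1.2)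
        (fun w => (MemClass.rep_mem _).1.dartConnected)
        (fun w => (MemClass.rep_mem _).1.dartConnected) hiso
        ⟨x, by change (f x).isSome = true; rw [hx]; rfl⟩
      obtain ⟨x', hx'⟩ := w'
      obtain rfl : x' = x := Subtype.ext hw'
      obtain ⟨a', ha'⟩ := Option.isSome_iff_exists.1 hx'
      change f' x' = some a' at ha'
      rw [ha']
      have e1 : Decorated.attached ⟨b, f⟩ ⟨x', by change (f x').isSome = true; rw [hx]; rfl⟩ =
          a.rep := by simp [Decorated.attached, hx]
      have e2 : Decorated.attached ⟨b, f'⟩ ⟨x', hx'⟩ = a'.rep := by simp [Decorated.attached, ha']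
      rw [e1, e2] at hM
      congr 1
      apply Subtype.ext
      rw [← a.mk_rep, ← a'.mk_rep]
      exact (Quotient.sound (s := RootedMap.isoSetoid) hM).symm
    have hf : f = f' := by
      funext x
      rcases hfx : f x with _ | a
      · rcases hfx' : f' x with _ | a'
        · rfl
        · have := key f' f (RootedMap.isoSetoid.iseqv.symm hiso) x a' hfx'
          rw [hfx] at this
          exact absurd this (by simp)
      · exact (key f f' hiso x a hfx).symm
    rw [hf]
  · intro a
    obtain ⟨B, W, hW, ι, M, hιinj, hι, hs, ⟨G⟩⟩ := RootedMap.exists_decomposition a.rep_mem.1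
    have hB : B.IsOuterplanar := ((G.isOuterplanar_iff hι).1 a.rep_mem.1).1
    have hBn : B.IsNonseparable := hs.isNonseparable hB.connected hB.2.2
    obtain ⟨-, hBC, hM⟩ := (G.mem_iff C hι hs hBn).1 a.rep_mem
    let b : C := ⟨Quotient.mk _ B, hBC⟩
    obtain ⟨β, hβ1, hβ2, hβ3⟩ : RootedMap.Iso B b.1.out :=
      Quotient.exact (s := RootedMap.isoSetoid) (Quotient.out_eq b.1).symm
    let m : W → MemClass C := fun w => ⟨Quotient.mk _ (M w), M w, hM w, rfl⟩
    let f : (b.1.out : RootedMap).outer → Tree C := fun x =>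
      if h : ∃ w, β (ι w) = x.1 then some (m h.choose) else none
    have hf : ∀ w (hw : β (ι w) ∈ (b.1.out : RootedMap).outer), f ⟨β (ι w), hw⟩ = some (m w) := by
      intro w hw
      have hex : ∃ w', β (ι w') = β (ι w) := ⟨w, rfl⟩
      have : hex.choose = w := hιinj (β.injective hex.choose_spec)
      simp only [f, dif_pos hex]
      rw [this]
    have hout : ∀ w, β (ι w) ∈ (b.1.out : RootedMap).outer := fun w =>
      (RootedMap.Iso.mem_outer_iff hβ1 hβ2 hβ3).2 (hι w)
    let p : Decorated C := ⟨b, f⟩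
    let ω : W → p.Support := fun w => ⟨⟨β (ι w), hout w⟩, by
      change (f _).isSome = true
      rw [hf]; rfl⟩
    have hω : Function.Bijective ω := by
      constructor
      · intro w w' h
        exact hιinj (β.injective (congrArg (fun x : p.Support => x.1.1) h))
      · rintro ⟨x, hx⟩
        have hex : ∃ w, β (ι w) = x.1 := by
          by_contra hcon
          have : f x = none := by simp only [f, dif_neg hcon]
          change (f x).isSome = true at hx
          rw [this] at hx
          exact absurd hx (by simp)
        obtain ⟨w, hw⟩ := hex
        exact ⟨w, Subtype.ext (Subtype.ext hw)⟩
    refine ⟨p, Subtype.ext ?_⟩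
    rw [← a.mk_rep]
    refine (Quotient.sound (s := RootedMap.isoSetoid) ?_).symm
    refine G.iso_of_iso p.gluing β hβ1 hβ2 hβ3 (Equiv.ofBijective ω hω) (fun w => rfl) fun w => ?_
    have e1 : p.attached (ω w) = (m w).rep := by
      have := hf w (hout w)
      simp only [Decorated.attached]
      congr 1
      rw [← Option.some_inj, Option.some_get]
      exact this
    change RootedMap.Iso (M w) (p.attached (ω w))
    rw [e1]
    exact Quotient.exact (s := RootedMap.isoSetoid) (m w).mk_rep.symm

end
end OuterplanarClass

/-! ### The functional equation of the generating function -/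

/-- Sequences of weighted objects are counted by the powers of the generating function. -/
theorem card_pi_weight_eq {X : Type*} [Fintype X] {T : Type*} (s : T → ℕ)
    (hs : ∀ n, Finite {t // s t = n}) (n : ℕ) :
    Nat.card {f : X → T // ∑ x, s (f x) = n} =
      PowerSeries.coeff n
        ((PowerSeries.mk fun n => Nat.card {t // s t = n}) ^ Fintype.card X) := by
  classical
  rw [← Finset.card_univ, ← Finset.prod_const, PowerSeries.coeff_prod]
  let L := Finset.finsuppAntidiag (Finset.univ : Finset X) n
  have hL : ∀ l : X →₀ ℕ, l ∈ L ↔ ∑ x, l x = n := fun l => by simp [L, Finset.mem_finsuppAntidiag]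
  let g : {f : X → T // ∑ x, s (f x) = n} → L := fun f =>
    ⟨Finsupp.equivFunOnFinite.symm fun x => s (f.1 x), (hL _).2 f.2⟩
  have hg : ∀ f (l : L), g f = l ↔ ∀ x, s (f.1 x) = l.1 x := by
    intro f l
    rw [Subtype.ext_iff, Finsupp.ext_iff]
    rfl
  let E : ∀ l : L, {f // g f = l} ≃ ∀ x, {t // s t = l.1 x} := fun l =>
    { toFun := fun f x => ⟨f.1.1 x, (hg _ _).1 f.2 x⟩
      invFun := fun h => ⟨⟨fun x => (h x).1, by
        simp only [fun x => (h x).2]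
        exact (hL _).1 l.2⟩, (hg _ _).2 fun x => (h x).2⟩
      left_inv := fun f => rfl
      right_inv := fun h => rfl }
  have hfinite : ∀ l : L, Finite {f // g f = l} := fun l => Finite.of_equiv _ (E l).symm
  rw [← Nat.card_congr (Equiv.sigmaFiberEquiv g), Nat.card_sigma, ← Finset.sum_coe_sort L]
  refine Finset.sum_congr rfl fun l _ => ?_
  rw [Nat.card_congr (E l), Nat.card_pi]
  simp

namespace OuterplanarClass
variable {C : Set RootedMapClass}

/-- The number of blocks with `k` vertices in the class. -/
def blockCount (C : Set RootedMapClass) (k : ℕ) : ℕ := {b ∈ C | classSize b = k}.ncard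

theorem coeff_blockSeries (k : ℕ) :
    PowerSeries.coeff k (blockSeries C) = (blockCount C k : ℝ) := by
  rw [blockSeries, PowerSeries.coeff_mk, blockCount]
  congr 2
  ext b
  constructor
  · rintro ⟨M, ⟨h1, h2⟩, rfl⟩
    exact ⟨h1, h2⟩
  · rintro ⟨h1, h2⟩
    obtain ⟨M, rfl⟩ := Quotient.exists_rep b
    exact ⟨M, ⟨h1, h2⟩, rfl⟩

theorem ncard_mem (n : ℕ) :
    ((Quotient.mk _ : RootedMap → RootedMapClass) '' {M | Mem C M ∧ M.numVertices = n}).ncard =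
      Nat.card {a : MemClass C // classSize a.1 = n} := by
  have hinj : Function.Injective (fun a : MemClass C => a.1) := fun a b h => Subtype.ext h
  have h1 : (Quotient.mk _ : RootedMap → RootedMapClass) '' {M | Mem C M ∧ M.numVertices = n} =
      (fun a : MemClass C => a.1) '' {a : MemClass C | classSize a.1 = n} := by
    ext b
    constructor
    · rintro ⟨M, ⟨h1, h2⟩, rfl⟩
      exact ⟨⟨_, M, h1, rfl⟩, h2, rfl⟩
    · rintro ⟨⟨_, M, h1, rfl⟩, h2, rfl⟩
      exact ⟨M, ⟨h1, h2⟩, rfl⟩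
  rw [h1, Set.ncard_image_of_injective _ hinj]
  rfl

theorem count_eq_card (n : ℕ) (hfin : Finite {t : Tree C // t.size = n}) :
    count C n = Nat.card {t : Tree C // t.size = n} := by
  classical
  have h2 : {t : Tree C | t.size = n} = some '' {a : MemClass C | classSize a.1 = n} ∪
      (if n = 1 then {none} else ∅) := by
    ext t
    rcases t with _ | a
    · by_cases hn : n = 1
      · simp [hn, Tree.size]
      · simp [hn, Tree.size, Ne.symm hn]
    · by_cases hn : n = 1
      · simp [hn, Tree.size]
      · simp [hn, Tree.size]
  have hfin' : {t : Tree C | t.size = n}.Finite := hfin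
  have h3 : Nat.card {t : Tree C // t.size = n} = {t : Tree C | t.size = n}.ncard := rfl
  have h4 : (if n = 1 then {none} else ∅ : Set (Tree C)).ncard = if n = 1 then 1 else 0 := by
    by_cases hn : n = 1 <;> simp [hn]
  have h5 : Disjoint (some '' {a : MemClass C | classSize a.1 = n})
      (if n = 1 then {none} else ∅ : Set (Tree C)) := by
    by_cases hn : n = 1 <;> simp [hn]
  rw [h3, h2, Set.ncard_union_eq h5 (hfin'.subset (h2 ▸ Set.subset_union_left))
    (hfin'.subset (h2 ▸ Set.subset_union_right)), h4,
    Set.ncard_image_of_injective _ (Option.some_injective _), count, ncard_mem]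
  rfl

section
variable (hC : ∀ M : RootedMap, (Quotient.mk _ M : RootedMapClass) ∈ C →
      M.IsOuterplanar ∧ M.IsNonseparable)
include hC

theorem card_outer (b : C) : Nat.card (b.1.out : RootedMap).outer = classSize b.1 := by
  obtain ⟨h1, -, h3⟩ := out_spec hC b
  rw [← h3.numVertices h1]
  conv_rhs => rw [← Quotient.out_eq b.1]
  rfl

theorem two_le_classSize (b : C) : 2 ≤ classSize b.1 := by
  have := RootedMap.two_le_numVertices (out_spec hC b).1.2.1
  rw [← card_outer hC, ← (out_spec hC b).2.2.numVertices (out_spec hC b).1]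
  exact this

theorem finite_trees (hfin : ∀ k, {b ∈ C | classSize b = k}.Finite) (n : ℕ) :
    {t : Tree C | t.size = n}.Finite := by
  classical
  induction n using Nat.strong_induction_on with
  | _ n ih =>
    have hlt : {t : Tree C | t.size < n}.Finite := by
      have : {t : Tree C | t.size < n} = ⋃ m ∈ Finset.range n, {t : Tree C | t.size = m} := by
        ext t; simp
      rw [this]
      exact Set.Finite.biUnion (Finset.finite_toSet _) fun m hm => ih m (Finset.mem_range.1 hm)
    have hB : {b : C | classSize b.1 ≤ n}.Finite := by
      have : {b : C | classSize b.1 ≤ n} = ⋃ m ∈ Finset.range (n + 1),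
          {b : C | classSize b.1 = m} := by
        ext t; simp
      rw [this]
      refine Set.Finite.biUnion (Finset.finite_toSet _) fun m _ => ?_
      refine Set.Finite.of_finite_image (f := Subtype.val) ((hfin m).subset ?_)
        Subtype.val_injective.injOn
      rintro _ ⟨b, hb, rfl⟩
      exact ⟨b.2, hb⟩
    have hP : (⋃ b ∈ {b : C | classSize b.1 ≤ n}, (Sigma.mk b : _ → Decorated C) ''
        {f : (b.1.out : RootedMap).outer → Tree C | ∀ x, (f x) ∈
          {t : Tree C | t.size < n}}).Finite :=
      hB.biUnion fun b _ => (Set.Finite.pi' fun _ => hlt).image _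
    have hM : {a : MemClass C | classSize a.1 = n}.Finite := by
      refine (hP.image (Decorated.toMemClass hC)).subset fun a ha => ?_
      obtain ⟨p, rfl⟩ := (Decorated.toMemClass_bijective hC).2 a
      refine ⟨p, ?_, rfl⟩
      have hsum : ∑ᶠ x, (p.2 x).size = n := (p.numVertices_glue hC).symm.trans ha
      have : Fintype (p.1.1.out : RootedMap).outer := Fintype.ofFinite _
      rw [finsum_eq_sum_of_fintype] at hsum
      have hcard := card_outer hC p.1
      have h2 := two_le_classSize hC p.1
      rw [Nat.card_eq_fintype_card] at hcard
      refine Set.mem_biUnion (x := p.1) ?_ ⟨p.2, ?_, rfl⟩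
      · change classSize p.1.1 ≤ n
        rw [← hsum, ← hcard, ← Finset.card_univ, Finset.card_eq_sum_ones]
        exact Finset.sum_le_sum fun x _ => Tree.one_le_size _
      · intro x
        change (p.2 x).size < n
        rw [← hsum, ← Finset.add_sum_erase _ _ (Finset.mem_univ x)]
        have h3 : (Finset.univ.erase x).card ≤ ∑ x ∈ Finset.univ.erase x, (p.2 x).size := by
          rw [Finset.card_eq_sum_ones]
          exact Finset.sum_le_sum fun x _ => Tree.one_le_size _
        rw [Finset.card_erase_of_mem (Finset.mem_univ x), Finset.card_univ] at h3
        omega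
    refine ((hM.image some).union (Set.finite_singleton none)).subset ?_
    rintro (_ | a) ha
    · exact .inr rfl
    · exact .inl ⟨a, ha, rfl⟩

/-- The functional equation `M = z + ∑ c_k M ^ k` of the generating function. -/
theorem count_eq (hfin : ∀ k, {b ∈ C | classSize b = k}.Finite) (n : ℕ) :
    count C n = (∑ k ∈ Finset.range (n + 1), blockCount C k *
      PowerSeries.coeff n ((PowerSeries.mk (count C)) ^ k)) + if n = 1 then 1 else 0 := by
  classical
  have hT : ∀ n, Finite {t : Tree C // t.size = n} := fun n => finite_trees hC hfin n
  have hcount : ∀ n, count C n = Nat.card {t : Tree C // t.size = n} := fun n =>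
    count_eq_card n (hT n)
  have hmk : PowerSeries.mk (count C) =
      PowerSeries.mk fun n => Nat.card {t : Tree C // t.size = n} := by
    ext n; simp [hcount]
  have hB : Finite {b : C // classSize b.1 ≤ n} := by
    have : {b : C | classSize b.1 ≤ n} = ⋃ m ∈ Finset.range (n + 1),
        {b : C | classSize b.1 = m} := by
      ext t; simp
    change ({b : C | classSize b.1 ≤ n}).Finite
    rw [this]
    refine Set.Finite.biUnion (Finset.finite_toSet _) fun m _ => ?_
    refine Set.Finite.of_finite_image (f := Subtype.val) ((hfin m).subset ?_)
      Subtype.val_injective.injOn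
    rintro _ ⟨b, hb, rfl⟩
    exact ⟨b.2, hb⟩
  have : Fintype {b : C // classSize b.1 ≤ n} := Fintype.ofFinite _
  have hsize : ∀ p : Decorated C, classSize (p.toMemClass hC).1 = ∑ᶠ x, (p.2 x).size :=
    fun p => p.numVertices_glue hC
  let f1 : {p : Decorated C // ∑ᶠ x, (p.2 x).size = n} ≃ {a : MemClass C // classSize a.1 = n} :=
    (Equiv.ofBijective _ (Decorated.toMemClass_bijective hC)).subtypeEquiv fun p => by
      rw [← hsize]; rfl
  have hle : ∀ p : Decorated C, ∑ᶠ x, (p.2 x).size = n → classSize p.1.1 ≤ n := by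
    intro p hsum
    have : Fintype (p.1.1.out : RootedMap).outer := Fintype.ofFinite _
    rw [finsum_eq_sum_of_fintype] at hsum
    have hcard := card_outer hC p.1
    rw [Nat.card_eq_fintype_card] at hcard
    rw [← hsum, ← hcard, ← Finset.card_univ, Finset.card_eq_sum_ones]
    exact Finset.sum_le_sum fun x _ => Tree.one_le_size _
  let f2 : {p : Decorated C // ∑ᶠ x, (p.2 x).size = n} ≃ Σ b : {b : C // classSize b.1 ≤ n},
      {f : (b.1.1.out : RootedMap).outer → Tree C // ∑ᶠ x, (f x).size = n} :=
    { toFun := fun p => ⟨⟨p.1.1, hle p.1 p.2⟩, ⟨p.1.2, p.2⟩⟩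
      invFun := fun q => ⟨⟨q.1.1, q.2.1⟩, q.2.2⟩
      left_inv := fun p => rfl
      right_inv := fun q => rfl }
  have hfib : ∀ b : C, Nat.card
      {f : (b.1.out : RootedMap).outer → Tree C // ∑ᶠ x, (f x).size = n} =
      PowerSeries.coeff n ((PowerSeries.mk (count C)) ^ classSize b.1) := by
    intro b
    have : Fintype (b.1.out : RootedMap).outer := Fintype.ofFinite _
    simp only [finsum_eq_sum_of_fintype]
    rw [card_pi_weight_eq Tree.size hT, ← Nat.card_eq_fintype_card, card_outer hC, hmk]
  have hfinf : ∀ b : {b : C // classSize b.1 ≤ n}, Finite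
      {f : (b.1.1.out : RootedMap).outer → Tree C // ∑ᶠ x, (f x).size = n} := by
    intro b
    have hlt : {t : Tree C | t.size ≤ n}.Finite := by
      have : {t : Tree C | t.size ≤ n} = ⋃ m ∈ Finset.range (n + 1), {t : Tree C | t.size = m} := by
        ext t; simp
      rw [this]
      exact Set.Finite.biUnion (Finset.finite_toSet _) fun m hm => finite_trees hC hfin m
    have h1 : {f : (b.1.1.out : RootedMap).outer → Tree C | ∀ x, f x ∈
        {t : Tree C | t.size ≤ n}}.Finite := Set.Finite.pi' fun _ => hlt
    refine Set.Finite.subset (s := {f : (b.1.1.out : RootedMap).outer → Tree C | ∀ x, f x ∈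
        {t : Tree C | t.size ≤ n}}) h1 (t := {f | ∑ᶠ x, (f x).size = n}) fun f hf x => ?_
    have : Fintype (b.1.1.out : RootedMap).outer := Fintype.ofFinite _
    have hf' : ∑ᶠ x, (f x).size = n := hf
    rw [finsum_eq_sum_of_fintype] at hf'
    change (f x).size ≤ n
    rw [← hf']
    exact Finset.single_le_sum (f := fun x => (f x).size) (fun _ _ => Nat.zero_le _)
      (Finset.mem_univ x)
  have hcard : Nat.card {a : MemClass C // classSize a.1 = n} =
      ∑ k ∈ Finset.range (n + 1), blockCount C k *
        PowerSeries.coeff n ((PowerSeries.mk (count C)) ^ k) := by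
    rw [← Nat.card_congr f1, Nat.card_congr f2, Nat.card_sigma]
    simp only [hfib]
    rw [← Finset.sum_fiberwise_of_maps_to (s := Finset.univ)
      (t := Finset.range (n + 1)) (g := fun b : {b : C // classSize b.1 ≤ n} => classSize b.1.1)
      (fun b _ => Finset.mem_range.2 (Nat.lt_succ_of_le b.2))]
    refine Finset.sum_congr rfl fun k hk => ?_
    have hk' : k ≤ n := Nat.lt_succ_iff.1 (Finset.mem_range.1 hk)
    rw [Finset.sum_congr rfl (g := fun _ => PowerSeries.coeff n ((PowerSeries.mk (count C)) ^ k))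
      (fun b hb => by rw [(Finset.mem_filter.1 hb).2]), Finset.sum_const, smul_eq_mul]
    congr 1
    rw [blockCount, ← Set.ncard_coe_finset]
    have himg : {b ∈ C | classSize b = k} =
        (fun b : {b : C // classSize b.1 ≤ n} => b.1.1) ''
          (Finset.univ.filter fun b : {b : C // classSize b.1 ≤ n} => classSize b.1.1 = k :
            Finset _) := by
      ext b
      constructor
      · rintro ⟨h1, h2⟩
        exact ⟨⟨⟨b, h1⟩, h2.le.trans hk'⟩, by simpa using h2, rfl⟩
      · rintro ⟨b, hb, rfl⟩
        exact ⟨b.1.2, by simpa using hb⟩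
    rw [himg, Set.ncard_image_of_injective _ (fun a b h => Subtype.ext (Subtype.ext h))]
  rw [← hcard, count, ncard_mem]

end
end OuterplanarClass

/-! ### Blocks are determined by their chords -/

namespace RootedMap
variable {B : RootedMap} {k : ℕ}

/-- A labelling of the vertices by their position on the boundary of the outer face, counted from
the root vertex; `k` is meant to be the length of the boundary, so that positions are cyclic. -/
structure IsContour (B : RootedMap) (lab : B.Vertex → ZMod k) : Prop where
  injective : Function.Injective lab
  lab_pow : ∀ n : ℕ, lab (B.src ((B.facePerm ^ n) B.root)) = n

theorem isCycleOn_outer : B.facePerm.IsCycleOn B.outer := by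
  refine ⟨⟨fun x hx => facePerm_mem_outer.2 hx, B.facePerm.injective.injOn, fun y hy =>
    ⟨B.facePerm.symm y, ?_, by simp⟩⟩, fun x hx y hy => CombMap.rightFace_eq_iff.1 (hx.trans hy.symm)⟩
  rw [← facePerm_mem_outer]
  simpa using hy

theorem exists_pow_of_mem_outer {x : B.Dart} (hx : x ∈ B.outer) :
    ∃ n : ℕ, (B.facePerm ^ n) B.root = x :=
  isCycleOn_outer.exists_pow_eq' (Set.toFinite _) root_mem_outer hx

theorem OuterSimple.exists_isContour (h : B.OuterSimple) (ho : B.IsOuterplanar)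
    (hk : Nat.card B.outer = k) : ∃ lab : B.Vertex → ZMod k, B.IsContour lab := by
  classical
  have hfin : B.outer.Finite := Set.toFinite _
  have hcyc : B.facePerm.IsCycleOn (hfin.toFinset : Set B.Dart) := by
    rw [Set.Finite.coe_toFinset]; exact isCycleOn_outer
  have hcard : hfin.toFinset.card = k := by
    rw [← hk, Nat.card_coe_set_eq, Set.ncard_eq_toFinset_card _ hfin]
  have hroot : B.root ∈ hfin.toFinset := by simpa using root_mem_outer
  have hex : ∀ v : B.Vertex, ∃ n : ℕ, B.src ((B.facePerm ^ n) B.root) = v := by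
    intro v
    obtain ⟨x, hx, hxo⟩ := ho.2.2 v
    obtain ⟨n, rfl⟩ := exists_pow_of_mem_outer hxo
    exact ⟨n, hx⟩
  have hmem : ∀ n : ℕ, (B.facePerm ^ n) B.root ∈ B.outer := fun n => by
    have := hcyc.1.mapsTo.perm_pow n hroot
    simpa using this
  choose p hp using hex
  have key : ∀ m n : ℕ, B.src ((B.facePerm ^ m) B.root) = B.src ((B.facePerm ^ n) B.root) ↔
      (m : ZMod k) = n := by
    intro m n
    rw [ZMod.natCast_eq_natCast_iff, ← hcard, ← hcyc.pow_apply_eq_pow_apply hroot]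
    exact ⟨fun h' => h _ (hmem _) _ (hmem _) h', fun h' => congrArg _ h'⟩
  refine ⟨fun v => p v, fun v w hvw => ?_, fun n => (key _ _).1 (hp _)⟩
  rw [← hp v, ← hp w]
  exact (key _ _).2 hvw

namespace IsContour
variable {lab : B.Vertex → ZMod k}

section
variable (hl : B.IsContour lab) (hs : B.OuterSimple) (ho : B.IsOuterplanar)
include hl

theorem lab_pow_apply {x : B.Dart} (hx : x ∈ B.outer) (n : ℕ) :
    lab (B.src ((B.facePerm ^ n) x)) = lab (B.src x) + n := by
  obtain ⟨m, rfl⟩ := exists_pow_of_mem_outer hx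
  rw [← Equiv.Perm.mul_apply, ← pow_add, hl.lab_pow, hl.lab_pow, Nat.cast_add, add_comm]

theorem lab_rev {x : B.Dart} (hx : x ∈ B.outer) : lab (B.src (B.rev x)) = lab (B.src x) + 1 := by
  have := hl.lab_pow_apply hx 1
  rwa [pow_one, CombMap.src_facePerm, Nat.cast_one] at this

include hs ho in
open Classical in
/-- A chord separates the vertices on its two sides: an indicator that is the same on both darts
of an edge, equal to `1` at the vertices strictly between the ends of the dart `d` along the
boundary and to `0` at the other vertices, the ends excepted. -/
theorem exists_indicator [NeZero k] (d : B.Dart) : ∃ f : B.Dart → ℝ, (∀ z, f (B.rev z) = f z) ∧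
    (∀ z, B.src z ≠ B.src d → B.src z ≠ B.src (B.rev d) →
      f z = if (lab (B.src z) - lab (B.src d)).val <
        (lab (B.src (B.rev d)) - lab (B.src d)).val then 1 else 0) ∧
    (B.rot d ∉ B.outer → f (B.rot d) = 0) := by
  obtain ⟨x, hxd, hx⟩ := ho.2.2 (B.src d)
  change x ∈ B.outer at hx
  set n := (lab (B.src (B.rev d)) - lab (B.src d)).val with hn
  have hpow : ∀ m : ℕ, lab (B.src ((B.facePerm ^ m) x)) = lab (B.src d) + m := fun m => by
    rw [hl.lab_pow_apply hx, hxd]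
  have hval : ∀ m < k, (lab (B.src ((B.facePerm ^ m) x)) - lab (B.src d)).val = m := fun m hm => by
    rw [hpow, add_sub_cancel_left, ZMod.val_cast_of_lt hm]
  have hnk : n < k := ZMod.val_lt _
  set y := (B.facePerm ^ n) x with hy
  have hyd : B.src y = B.src (B.rev d) := hl.injective (by
    rw [hpow, hn, ZMod.natCast_val, ZMod.cast_id]; ring)
  have hne : B.src (B.rev d) ≠ B.src d := ho.loopless d d rfl
  obtain ⟨h, h1, h2⟩ := ho.cyclesBound.exists_level (x := x) (y := y) rfl
    (fun z => if z = B.rev d then 1 else 0) (fun f hf => by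
      have e1 : f x = f d := CombMap.eq_of_src_eq hf hxd
      have e2 : f y = f (B.rev d) := CombMap.eq_of_src_eq hf hyd
      have e3 : ∀ z : B.Dart, (if B.rev z = B.rev d then (1 : ℝ) else 0) =
        if z = d then 1 else 0 := fun z => by simp
      simp only [mul_sub, Finset.sum_sub_distrib, e3, mul_ite, mul_one, mul_zero,
        Finset.sum_ite_eq', Finset.mem_univ, if_true, e1, e2]
      ring)
  simp only [EmbeddingLike.apply_eq_iff_eq] at h2
  -- the value at the corner `x` holds up to the dart `d`
  have hd : h d = h x := by
    obtain ⟨p, hp, hmin, hret⟩ := exists_minimal_pow (CombMap.src_eq_src_iff.1 hxd)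
    have hsrc : ∀ q : ℕ, B.src ((B.rot ^ q) x) = B.src d := fun q => by
      rw [← hxd]
      exact (CombMap.src_eq_src_iff.2 ⟨q, by rw [zpow_natCast]⟩).symm
    have : ∀ q ≤ p, h ((B.rot ^ q) x) = h x := by
      intro q
      induction q with
      | zero => simp
      | succ q ih =>
        intro hq
        have e1 := hret (q + 1) (by omega) hq
        have e2 : (B.rot ^ (q + 1)) x ≠ y := fun e => hne (by rw [← hyd, ← e, hsrc])
        have e3 : (B.rot ^ (q + 1)) x ≠ B.rev d := fun e => hne (by rw [← e, hsrc])
        have e4 := hmin q (by omega)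
        have := h2 ((B.rot ^ q) x)
        rw [← Equiv.Perm.mul_apply, ← pow_succ', if_neg e1, if_neg e2, if_neg e3, if_neg e4,
          ih (by omega)] at this
        linarith
    rw [← hp]
    exact this p le_rfl
  have hrot : B.rot d ∉ B.outer → h (B.rot d) = h x - 1 := by
    intro hr
    have e1 : B.rot d ≠ x := fun e => hr (e ▸ hx)
    have e2 : B.rot d ≠ y := fun e => hne (by rw [← hyd, ← e, CombMap.src_rot])
    have e3 : B.rot d ≠ B.rev d := fun e => hne (by rw [← e, CombMap.src_rot])
    have := h2 d
    rw [if_neg e1, if_neg e2, if_neg e3, if_pos rfl, hd] at this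
    linarith
  -- along the outer face the level changes only at the ends of `d`
  have hface : ∀ m, h ((B.facePerm ^ (m + 1)) x) = h ((B.facePerm ^ m) x)
      + (if (B.facePerm ^ (m + 1)) x = x then 1 else 0)
      - (if (B.facePerm ^ (m + 1)) x = y then 1 else 0)
      + (if (B.facePerm ^ (m + 1)) x = B.rev d then 1 else 0)
      - (if (B.facePerm ^ m) x = B.rev d then 1 else 0) := by
    intro m
    have := h2 (B.rev ((B.facePerm ^ m) x))
    rw [h1, ← CombMap.facePerm_apply, ← Equiv.Perm.mul_apply, ← pow_succ'] at this
    rw [this]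
    have e : (B.rev ((B.facePerm ^ m) x) = d) ↔ (B.facePerm ^ m) x = B.rev d :=
      ⟨fun e => by rw [← e, B.rev_rev], fun e => by rw [e, B.rev_rev]⟩
    simp only [e]
  have hnx : ∀ m < k, m ≠ 0 → (B.facePerm ^ m) x ≠ x := fun m hm h0 e => by
    have := hval m hm
    rw [e, hxd, sub_self, ZMod.val_zero] at this
    exact h0 this.symm
  have hny : ∀ m < k, m ≠ n → B.src ((B.facePerm ^ m) x) ≠ B.src (B.rev d) := fun m hm h0 e => by
    have := hval m hm
    rw [e] at this
    exact h0 this.symm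
  have hin : ∀ m < n, h ((B.facePerm ^ m) x) = h x := by
    intro m
    induction m with
    | zero => simp
    | succ m ih =>
      intro hm
      have e1 := hny (m + 1) (by omega) (by omega)
      have e2 := hny m (by omega) (by omega)
      rw [hface, if_neg (hnx _ (by omega) (by omega)), if_neg (fun e => e1 (by rw [e, hyd])),
        if_neg (fun e => e1 (by rw [e])), if_neg (fun e => e2 (by rw [e])), ih (by omega)]
      ring
  have hk : (B.facePerm ^ k) x = x := by
    have e1 : (B.facePerm ^ k) x ∈ B.outer := by
      have := (isCycleOn_outer (B := B)).1.mapsTo.perm_pow k hx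
      exact this
    exact hs _ e1 _ hx (hl.injective (by rw [hpow, hxd]; simp))
  have hout : ∀ t, n < k - 1 - t → h ((B.facePerm ^ (k - 1 - t)) x) = h x - 1 := by
    intro t
    induction t with
    | zero =>
      intro ht
      have e2 := hny (k - 1) (by omega) (by omega)
      have := hface (k - 1)
      rw [Nat.sub_add_cancel (by omega), hk, if_pos rfl,
        if_neg (fun e => hne (by rw [← hyd, ← e, hxd])),
        if_neg (fun e => hne (by rw [← e, hxd])), if_neg (fun e => e2 (by rw [e]))] at this
      simp only [Nat.sub_zero]
      linarith
    | succ t ih =>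
      intro ht
      have e1 := hny (k - 1 - t) (by omega) (by omega)
      have e2 := hny (k - 1 - (t + 1)) (by omega) (by omega)
      have := hface (k - 1 - (t + 1))
      rw [show k - 1 - (t + 1) + 1 = k - 1 - t by omega, if_neg (hnx _ (by omega) (by omega)),
        if_neg (fun e => e1 (by rw [e, hyd])),
        if_neg (fun e => e1 (by rw [e])), if_neg (fun e => e2 (by rw [e])), ih (by omega)] at this
      linarith
  refine ⟨fun z => h z - (h x - 1), fun z => by simp only [h1], fun z hz1 hz2 => ?_,
    fun hr => by simp only [hrot hr]; ring⟩
  set m := (lab (B.src z) - lab (B.src d)).val with hm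
  have hmk : m < k := ZMod.val_lt _
  have hzm : B.src z = B.src ((B.facePerm ^ m) x) := hl.injective (by
    rw [hpow, hm, ZMod.natCast_val, ZMod.cast_id]; ring)
  have hconst : h z = h ((B.facePerm ^ m) x) := by
    have := CombMap.eq_of_src_eq (f := fun z => if B.src z = B.src d ∨ B.src z = B.src (B.rev d)
      then 0 else h z) (fun z => by
        by_cases hz : B.src z = B.src d ∨ B.src z = B.src (B.rev d)
        · simp only [CombMap.src_rot, if_pos hz]
        · simp only [CombMap.src_rot, if_neg hz]
          push Not at hz
          rw [h2, if_neg (fun e => hz.1 (by rw [← hxd, ← e, CombMap.src_rot])),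
            if_neg (fun e => hz.2 (by rw [← hyd, ← e, CombMap.src_rot])),
            if_neg (fun e => hz.2 (by rw [← e, CombMap.src_rot])),
            if_neg (fun e => hz.1 (by rw [← e]))]
          ring) hzm
    rwa [← hzm, if_neg (by tauto), if_neg (by tauto)] at this
  have hmn : m ≠ n := by
    intro e
    exact hz2 (by rw [hzm, e, ← hyd])
  rcases lt_or_gt_of_ne hmn with hlt | hlt
  · simp only [if_pos hlt, hconst, hin m hlt]
    ring
  · have := hout (k - 1 - m) (by omega)
    rw [show k - 1 - (k - 1 - m) = m by omega] at this
    simp only [if_neg hlt.not_gt, hconst, this]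
    ring

include hs ho in
/-- Chords do not cross. -/
theorem not_cross [NeZero k] (d z : B.Dart) (h1 : B.src z ≠ B.src d)
    (h2 : (lab (B.src z) - lab (B.src d)).val < (lab (B.src (B.rev d)) - lab (B.src d)).val)
    (h3 : B.src (B.rev z) ≠ B.src d) :
    (lab (B.src (B.rev z)) - lab (B.src d)).val ≤ (lab (B.src (B.rev d)) - lab (B.src d)).val := by
  classical
  obtain ⟨f, hf, hf1, -⟩ := hl.exists_indicator hs ho d
  by_cases h4 : B.src (B.rev z) = B.src (B.rev d)
  · rw [h4]
  have e1 := hf1 z h1 (fun e => by rw [e] at h2; exact lt_irrefl _ h2)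
  have e2 := hf1 (B.rev z) h3 h4
  rw [if_pos h2] at e1
  rw [hf, e1] at e2
  by_contra hcon
  rw [if_neg (by omega)] at e2
  exact one_ne_zero e2

/-- How far the end of a dart lies beyond its origin along the boundary. -/
def gap (lab : B.Vertex → ZMod k) (d : B.Dart) : ℕ := (lab (B.src (B.rev d)) - lab (B.src d)).val

include hs ho in
/-- Around a vertex the ends of the darts appear in the order in which the boundary visits them. -/
theorem gap_lt_gap_rot [NeZero k] {d : B.Dart} (hd : B.rot d ∉ B.outer) :
    gap lab d < gap lab (B.rot d) := by
  obtain ⟨f, hf, hf1, hf2⟩ := hl.exists_indicator hs ho d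
  have hne : B.rot d ≠ d := by
    intro e
    obtain ⟨x, hx, hxo⟩ := ho.2.2 (B.src d)
    have h := CombMap.src_eq_src_iff.1 hx.symm
    have : x = d := sameCycle_induction (P := fun z => z = d) (fun z hz => by rw [hz, e]) h rfl
    rw [e] at hd
    exact hd (this ▸ hxo)
  have h3 : B.src (B.rev (B.rot d)) ≠ B.src (B.rev d) := fun e =>
    hne (ho.2.1.2 _ _ (CombMap.src_rot d) e)
  have h4 : B.src (B.rev (B.rot d)) ≠ B.src d := by
    have := ho.loopless (B.rot d) (B.rot d) rfl
    rwa [CombMap.src_rot] at this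
  have e1 := hf1 _ h4 h3
  rw [hf, hf2 hd] at e1
  have h5 : ¬ (lab (B.src (B.rev (B.rot d))) - lab (B.src d)).val <
      (lab (B.src (B.rev d)) - lab (B.src d)).val := by
    intro h
    rw [if_pos h] at e1
    exact zero_ne_one e1
  have h6 : (lab (B.src (B.rev (B.rot d))) - lab (B.src d)).val ≠
      (lab (B.src (B.rev d)) - lab (B.src d)).val := by
    intro h
    exact h3 (hl.injective (sub_left_injective (ZMod.val_injective _ h)))
  simp only [gap, CombMap.src_rot]
  omega

include hs ho in
theorem gap_rot_le [NeZero k] {d x : B.Dart} (hdx : B.src d = B.src x)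
    (hlt : gap lab d < gap lab x) : B.rot d ∉ B.outer ∧ gap lab (B.rot d) ≤ gap lab x := by
  obtain ⟨o, ho1, hoo⟩ := ho.2.2 (B.src d)
  change o ∈ B.outer at hoo
  obtain ⟨a, ha, -, hamin⟩ := exists_minimal_pow (CombMap.src_eq_src_iff.1 ho1)
  obtain ⟨b, hb, -, hbmin⟩ := exists_minimal_pow (CombMap.src_eq_src_iff.1 (ho1.trans hdx))
  have hsrc : ∀ q : ℕ, B.src ((B.rot ^ q) o) = B.src o := fun q =>
    (CombMap.src_eq_src_iff.2 ⟨q, by rw [zpow_natCast]⟩).symm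
  have hnout : ∀ q : ℕ, (B.rot ^ q) o ≠ o → (B.rot ^ q) o ∉ B.outer := fun q hq h =>
    hq (hs _ h _ hoo (hsrc q))
  have hmono : ∀ c : ℕ, (∀ q, 0 < q → q ≤ c → (B.rot ^ q) o ≠ o) → ∀ t, ∀ q, q + t ≤ c →
      gap lab ((B.rot ^ q) o) ≤ gap lab ((B.rot ^ (q + t)) o) := by
    intro c hc t
    induction t with
    | zero => intro q _; rfl
    | succ t ih =>
      intro q hq
      refine (ih q (by omega)).trans ?_
      have h1 := hnout _ (hc (q + t + 1) (by omega) (by omega))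
      rw [pow_succ', Equiv.Perm.mul_apply] at h1
      have := hl.gap_lt_gap_rot hs ho h1
      rw [← Equiv.Perm.mul_apply, ← pow_succ'] at this
      exact this.le
  have hab : a < b := by
    by_contra hcon
    have := hmono a hamin (a - b) b (by omega)
    rw [show b + (a - b) = a by omega, ha, hb] at this
    omega
  have e1 : B.rot d = (B.rot ^ (a + 1)) o := by
    rw [pow_succ', Equiv.Perm.mul_apply, ha]
  refine ⟨?_, ?_⟩
  · rw [e1]
    exact hnout _ (hbmin _ (by omega) (by omega))
  · have := hmono b hbmin (b - (a + 1)) (a + 1) (by omega)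
    rwa [show a + 1 + (b - (a + 1)) = b by omega, ← e1, hb] at this

theorem mem_outer_iff {d : B.Dart} [NeZero k] (hk : 2 ≤ k) (ho : B.IsOuterplanar) :
    d ∈ B.outer ↔ gap lab d = 1 := by
  have : Fact (1 < k) := ⟨hk⟩
  have h1 : ∀ x ∈ B.outer, gap lab x = 1 := fun x hx => by
    rw [gap, hl.lab_rev hx, add_sub_cancel_left, ZMod.val_one]
  refine ⟨h1 d, fun hd => ?_⟩
  obtain ⟨o, ho1, hoo⟩ := ho.2.2 (B.src d)
  have h2 := h1 o hoo
  have : o = d := ho.2.1.2 _ _ ho1 (hl.injective (by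
    have h3 := ZMod.val_injective _ (h2.trans hd.symm)
    rw [ho1] at h3
    exact sub_left_injective h3))
  rw [← this]
  exact hoo

end

/-- A map whose outer face visits each vertex exactly once is determined by its adjacencies. -/
theorem iso {B B' : RootedMap} [NeZero k] (hk : 2 ≤ k)
    {lab : B.Vertex → ZMod k} {lab' : B'.Vertex → ZMod k}
    (hl : B.IsContour lab) (hs : B.OuterSimple) (ho : B.IsOuterplanar)
    (hl' : B'.IsContour lab') (hs' : B'.OuterSimple) (ho' : B'.IsOuterplanar)
    (hadj : ∀ c c', (∃ d, lab (B.src d) = c ∧ lab (B.src (B.rev d)) = c') ↔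
      ∃ d, lab' (B'.src d) = c ∧ lab' (B'.src (B'.rev d)) = c') : Iso B B' := by
  have hex : ∀ d, ∃ d', lab' (B'.src d') = lab (B.src d) ∧
      lab' (B'.src (B'.rev d')) = lab (B.src (B.rev d)) := fun d =>
    (hadj _ _).1 ⟨d, rfl, rfl⟩
  choose e he1 he2 using hex
  have huniq : ∀ d z', lab' (B'.src z') = lab (B.src d) →
      lab' (B'.src (B'.rev z')) = lab (B.src (B.rev d)) → e d = z' := fun d z' h1 h2 =>
    ho'.2.1.2 _ _ (hl'.injective ((he1 d).trans h1.symm)) (hl'.injective ((he2 d).trans h2.symm))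
  have hbij : Function.Bijective e := by
    constructor
    · intro d z hdz
      exact ho.2.1.2 _ _ (hl.injective (by rw [← he1, ← he1, hdz]))
        (hl.injective (by rw [← he2, ← he2, hdz]))
    · intro z'
      obtain ⟨d, h1, h2⟩ := (hadj _ _).2 ⟨z', rfl, rfl⟩
      exact ⟨d, huniq _ _ h1.symm h2.symm⟩
  have hgap : ∀ d, gap lab' (e d) = gap lab d := fun d => by rw [gap, gap, he1, he2]
  have hout : ∀ d, e d ∈ B'.outer ↔ d ∈ B.outer := fun d => by
    rw [hl.mem_outer_iff hk ho, hl'.mem_outer_iff hk ho', hgap]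
  have hsrc : ∀ d z, B'.src (e d) = B'.src (e z) ↔ B.src d = B.src z := fun d z => by
    rw [← hl.injective.eq_iff, ← hl'.injective.eq_iff, he1, he1]
  refine ⟨Equiv.ofBijective e hbij, fun d => ?_, fun d => ?_, ?_⟩
  · change e (B.rot d) = B'.rot (e d)
    obtain ⟨z, hz⟩ := hbij.2 (B'.rot (e d))
    have hdz : B.src d = B.src z := by rw [← hsrc, hz, CombMap.src_rot]
    rw [← hz]
    congr 1
    by_cases hr : B.rot d ∈ B.outer
    · by_cases hr' : z ∈ B.outer
      · exact hs _ hr _ hr' (by rw [CombMap.src_rot, hdz])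
      · rw [← hout, hz] at hr'
        have h1 := hl'.gap_lt_gap_rot hs' ho' hr'
        rw [← hz, hgap, hgap] at h1
        exact absurd hr (hl.gap_rot_le hs ho hdz h1).1
    · have h1 := hl.gap_lt_gap_rot hs ho hr
      have h2 : gap lab' (e d) < gap lab' (e (B.rot d)) := by rwa [hgap, hgap]
      obtain ⟨h3, h4⟩ := hl'.gap_rot_le hs' ho' ((hsrc _ _).2 (CombMap.src_rot d).symm) h2
      have h5 := hl'.gap_lt_gap_rot hs' ho' h3
      rw [← hz, hgap, hgap] at h5
      rw [← hz, hgap, hgap] at h4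
      have h6 := (hl.gap_rot_le hs ho hdz h5).2
      have h7 : gap lab (B.rot d) = gap lab z := le_antisymm h6 h4
      refine ho.2.1.2 _ _ (by rw [CombMap.src_rot, hdz]) (hl.injective ?_)
      rw [gap, gap, CombMap.src_rot, hdz] at h7
      exact sub_left_injective (ZMod.val_injective _ h7)
  · change e (B.rev d) = B'.rev (e d)
    exact huniq _ _ (he2 d) (by rw [B'.rev_rev, B.rev_rev, he1])
  · change e B.root = B'.root
    have h1 := hl.lab_pow 0
    have h1' := hl'.lab_pow 0
    simp only [pow_zero, Equiv.Perm.one_apply] at h1 h1'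
    exact huniq _ _ (h1'.trans h1.symm)
      (by rw [hl.lab_rev root_mem_outer, hl'.lab_rev root_mem_outer, h1, h1'])

end IsContour
end RootedMap

/-! ### Exponential growth of the number of blocks -/

/-- A set of non-crossing arcs between points of a line. -/
def IsNoncrossing (k : ℕ) (A : Finset (ℕ × ℕ)) : Prop :=
  (∀ p ∈ A, p.1 < p.2 ∧ p.2 < k) ∧ ∀ p ∈ A, ∀ q ∈ A, p.1 < q.1 → q.1 < p.2 → q.2 ≤ p.2

namespace IsNoncrossing
variable {k : ℕ} {A A' : Finset (ℕ × ℕ)}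

/-- At the ends of a shortest arc in the difference of two sets with the same degrees there would be
two longer arcs of the other set, and these cross each other. -/
theorem false_of_degrees_eq (h : IsNoncrossing k A) (h' : IsNoncrossing k A')
    (hup : ∀ i, (A.filter fun p => p.1 = i).card = (A'.filter fun p => p.1 = i).card)
    (hdown : ∀ j, (A.filter fun p => p.2 = j).card = (A'.filter fun p => p.2 = j).card)
    (i j : ℕ) (hij : (i, j) ∈ A) (hij' : (i, j) ∉ A')
    (hmin : ∀ p ∈ A', p ∉ A → j - i ≤ p.2 - p.1) : False := by
  have h1 : ∃ p ∈ A', p ∉ A ∧ p.1 = i := by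
    by_contra hcon
    push Not at hcon
    have hsub : (A'.filter fun p => p.1 = i) ⊂ A.filter fun p => p.1 = i := by
      refine (Finset.ssubset_iff_of_subset fun p hp => ?_).2 ⟨(i, j), ?_, ?_⟩
      · rw [Finset.mem_filter] at hp ⊢
        refine ⟨?_, hp.2⟩
        by_contra hpA
        exact hcon p hp.1 hpA hp.2
      · simpa using hij
      · simpa using hij'
    exact (Finset.card_lt_card hsub).ne (hup i).symm
  have h2 : ∃ p ∈ A', p ∉ A ∧ p.2 = j := by
    by_contra hcon
    push Not at hcon
    have hsub : (A'.filter fun p => p.2 = j) ⊂ A.filter fun p => p.2 = j := by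
      refine (Finset.ssubset_iff_of_subset fun p hp => ?_).2 ⟨(i, j), ?_, ?_⟩
      · rw [Finset.mem_filter] at hp ⊢
        refine ⟨?_, hp.2⟩
        by_contra hpA
        exact hcon p hp.1 hpA hp.2
      · simpa using hij
      · simpa using hij'
    exact (Finset.card_lt_card hsub).ne (hdown j).symm
  obtain ⟨⟨a, b⟩, hp, hpA, rfl⟩ := h1
  obtain ⟨⟨c, d⟩, hq, hqA, rfl⟩ := h2
  have e1 := hmin _ hp hpA
  have e2 := hmin _ hq hqA
  have e3 := (h.1 _ hij)
  have e4 := (h'.1 _ hp).1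
  have e5 := (h'.1 _ hq).1
  simp only at e1 e2 e3 e4 e5
  have e6 : b ≠ d := by rintro rfl; exact hpA hij
  have e7 : c ≠ a := by rintro rfl; exact hqA hij
  have := h'.2 _ hq _ hp (by simp only; omega) (by simp only; omega)
  simp only at this
  omega

theorem eq_of_degrees_eq (h : IsNoncrossing k A) (h' : IsNoncrossing k A')
    (hup : ∀ i, (A.filter fun p => p.1 = i).card = (A'.filter fun p => p.1 = i).card)
    (hdown : ∀ j, (A.filter fun p => p.2 = j).card = (A'.filter fun p => p.2 = j).card) :
    A = A' := by
  classical
  by_contra hne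
  have hD : (symmDiff A A').Nonempty := by
    rw [Finset.nonempty_iff_ne_empty]
    intro he
    exact hne (symmDiff_eq_bot.1 he)
  obtain ⟨⟨i, j⟩, hp, hmin⟩ := Finset.exists_min_image _ (fun p : ℕ × ℕ => p.2 - p.1) hD
  rcases Finset.mem_symmDiff.1 hp with ⟨h1, h2⟩ | ⟨h1, h2⟩
  · exact h.false_of_degrees_eq h' hup hdown i j h1 h2 fun p hp hpA =>
      hmin p (Finset.mem_symmDiff.2 (.inr ⟨hp, hpA⟩))
  · exact h'.false_of_degrees_eq h (fun i => (hup i).symm) (fun i => (hdown i).symm) i j h1 h2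
      fun p hp hpA => hmin p (Finset.mem_symmDiff.2 (.inl ⟨hp, hpA⟩))

/-- Every arc is the longest one starting at its left end or the longest one ending at its right
end. -/
theorem card_le (h : IsNoncrossing k A) : A.card ≤ 2 * k := by
  classical
  let S := A.filter fun p => ∀ q ∈ A, q.1 = p.1 → q.2 ≤ p.2
  let T := A.filter fun p => ∀ q ∈ A, q.2 = p.2 → p.1 ≤ q.1
  have hST : A ⊆ S ∪ T := by
    rintro ⟨i, j⟩ hp
    rw [Finset.mem_union, Finset.mem_filter, Finset.mem_filter]
    by_contra hcon
    push Not at hcon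
    obtain ⟨⟨a, b⟩, hq, rfl, hb⟩ := hcon.1 hp
    obtain ⟨⟨c, d⟩, hr, rfl, hc⟩ := hcon.2 hp
    have e1 := (h.1 _ hp).1
    have := h.2 _ hr _ hq hc e1
    simp only at this hb
    omega
  have hS : S.card ≤ k := by
    rw [← Finset.card_range k]
    refine Finset.card_le_card_of_injOn Prod.fst (fun p hp => ?_) fun p hp q hq hpq => ?_
    · have := h.1 p (Finset.mem_filter.1 hp).1
      simp only [Finset.coe_range, Set.mem_Iio]
      omega
    · have hp := Finset.mem_filter.1 hp
      have hq := Finset.mem_filter.1 hq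
      exact Prod.ext hpq (le_antisymm (hq.2 p hp.1 hpq) (hp.2 q hq.1 hpq.symm))
  have hT : T.card ≤ k := by
    rw [← Finset.card_range k]
    refine Finset.card_le_card_of_injOn Prod.snd (fun p hp => ?_) fun p hp q hq hpq => ?_
    · have := h.1 p (Finset.mem_filter.1 hp).1
      simp only [Finset.coe_range, Set.mem_Iio]
      omega
    · have hp := Finset.mem_filter.1 hp
      have hq := Finset.mem_filter.1 hq
      exact Prod.ext (le_antisymm (hp.2 q hq.1 hpq.symm) (hq.2 p hp.1 hpq)) hpq
  have := (Finset.card_le_card hST).trans (Finset.card_union_le _ _)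
  omega

end IsNoncrossing

/-- The number of sequences of given length and bounded sum, by weighting each with
`(1 / 2) ^ sum`. -/
theorem card_sum_le {ι : Type*} [Fintype ι] [DecidableEq ι] (m : ℕ)
    (F : Finset (ι → ℕ)) (hF : ∀ p ∈ F, ∑ i, p i ≤ m) : F.card ≤ 2 ^ (m + Fintype.card ι) := by
  have h1 : F ⊆ Fintype.piFinset fun _ : ι => Finset.range (m + 1) := by
    intro p hp
    rw [Fintype.mem_piFinset]
    intro i
    have := hF p hp
    have h2 := Finset.single_le_sum (f := p) (fun _ _ => Nat.zero_le _) (Finset.mem_univ i)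
    rw [Finset.mem_range]
    omega
  have h2 : (F.card : ℝ) * (1 / 2) ^ m ≤ 2 ^ Fintype.card ι := by
    calc (F.card : ℝ) * (1 / 2) ^ m = ∑ p ∈ F, (1 / 2 : ℝ) ^ m := by simp
      _ ≤ ∑ p ∈ F, ∏ i, (1 / 2 : ℝ) ^ (p i) := by
        refine Finset.sum_le_sum fun p hp => ?_
        rw [Finset.prod_pow_eq_pow_sum]
        exact pow_le_pow_of_le_one (by norm_num) (by norm_num) (hF p hp)
      _ ≤ ∑ p ∈ Fintype.piFinset fun _ : ι => Finset.range (m + 1), ∏ i, (1 / 2 : ℝ) ^ (p i) :=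
        Finset.sum_le_sum_of_subset_of_nonneg h1 fun p _ _ => by positivity
      _ = ∏ _i : ι, ∑ j ∈ Finset.range (m + 1), (1 / 2 : ℝ) ^ j :=
        (Finset.prod_univ_sum _ _).symm
      _ ≤ ∏ _i : ι, 2 := by
        refine Finset.prod_le_prod (fun _ _ => by positivity) fun _ _ => ?_
        have := (summable_geometric_two).sum_le_tsum (Finset.range (m + 1))
          (fun _ _ => by positivity)
        rwa [tsum_geometric_two] at this
      _ = 2 ^ Fintype.card ι := by simp
  have h3 : (F.card : ℝ) ≤ 2 ^ (m + Fintype.card ι) := by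
    rw [one_div, inv_pow, ← div_eq_mul_inv, div_le_iff₀ (by positivity)] at h2
    rw [pow_add, mul_comm]
    exact h2
  exact_mod_cast h3

/-- Non-crossing sets of arcs are counted by their degree sequences. -/
theorem card_noncrossing_le (k : ℕ) (𝒜 : Finset (Finset (ℕ × ℕ)))
    (h : ∀ A ∈ 𝒜, IsNoncrossing k A) : 𝒜.card ≤ 64 ^ k := by
  classical
  let deg : Finset (ℕ × ℕ) → (Fin k ⊕ Fin k → ℕ) := fun A =>
    Sum.elim (fun i => (A.filter fun p => p.1 = i.val).card)
      fun j => (A.filter fun p => p.2 = j.val).card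
  have hinj : Set.InjOn deg 𝒜 := by
    intro A hA A' hA' heq
    have h1 := h A hA
    have h2 := h A' hA'
    refine h1.eq_of_degrees_eq h2 (fun i => ?_) fun j => ?_
    · by_cases hi : i < k
      · exact congrFun heq (.inl ⟨i, hi⟩)
      · rw [Finset.filter_false_of_mem (s := A) (p := fun p => p.1 = i) fun p hp e =>
            hi (e ▸ (h1.1 p hp).1.trans (h1.1 p hp).2),
          Finset.filter_false_of_mem (s := A') (p := fun p => p.1 = i) fun p hp e =>
            hi (e ▸ (h2.1 p hp).1.trans (h2.1 p hp).2)]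
    · by_cases hi : j < k
      · exact congrFun heq (.inr ⟨j, hi⟩)
      · rw [Finset.filter_false_of_mem (s := A) (p := fun p => p.2 = j) fun p hp e =>
            hi (e ▸ (h1.1 p hp).2),
          Finset.filter_false_of_mem (s := A') (p := fun p => p.2 = j) fun p hp e =>
            hi (e ▸ (h2.1 p hp).2)]
  rw [← Finset.card_image_of_injOn hinj]
  refine (card_sum_le (4 * k) _ fun p hp => ?_).trans ?_
  · obtain ⟨A, hA, rfl⟩ := Finset.mem_image.1 hp
    have h1 := h A hA
    have e1 : ∑ i : Fin k, (A.filter fun p => p.1 = i.val).card = A.card := by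
      rw [Fin.sum_univ_eq_sum_range (fun i => (A.filter fun p => p.1 = i).card)]
      exact (Finset.card_eq_sum_card_fiberwise fun p hp => by
        simpa using (h1.1 p hp).1.trans (h1.1 p hp).2).symm
    have e2 : ∑ i : Fin k, (A.filter fun p => p.2 = i.val).card = A.card := by
      rw [Fin.sum_univ_eq_sum_range (fun i => (A.filter fun p => p.2 = i).card)]
      exact (Finset.card_eq_sum_card_fiberwise fun p hp => by simpa using (h1.1 p hp).2).symm
    have e3 := h1.card_le
    rw [Fintype.sum_sum_type]
    simp only [deg, Sum.elim_inl, Sum.elim_inr]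
    omega
  · rw [Fintype.card_sum, Fintype.card_fin, show 4 * k + (k + k) = 6 * k by ring, pow_mul]
    norm_num

namespace RootedMap
variable {B : RootedMap} {k : ℕ} {lab : B.Vertex → ZMod k}

open Classical in
/-- The adjacencies of a map, as arcs between the boundary positions of the vertices. -/
def arcs (B : RootedMap) (lab : B.Vertex → ZMod k) : Finset (ℕ × ℕ) :=
  (Finset.univ.image fun d : B.Dart =>
    ((lab (B.src d)).val, (lab (B.src (B.rev d))).val)).filter fun p => p.1 < p.2

theorem mem_arcs {p : ℕ × ℕ} : p ∈ B.arcs lab ↔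
    (∃ d, (lab (B.src d)).val = p.1 ∧ (lab (B.src (B.rev d))).val = p.2) ∧ p.1 < p.2 := by
  simp [arcs, Prod.ext_iff]

theorem IsContour.isNoncrossing_arcs [NeZero k] (hl : B.IsContour lab) (hs : B.OuterSimple)
    (ho : B.IsOuterplanar) : IsNoncrossing k (B.arcs lab) := by
  have hsub : ∀ a b : ZMod k, a.val ≤ b.val → (b - a).val = b.val - a.val := fun a b h =>
    ZMod.val_sub h
  have hsub' : ∀ a b : ZMod k, b.val < a.val → (b - a).val + a.val = b.val + k := by
    intro a b h
    have h1 := ZMod.val_add (b - a) a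
    have h2 := ZMod.val_lt (b - a)
    have h3 := ZMod.val_lt a
    rw [sub_add_cancel] at h1
    rcases lt_or_ge ((b - a).val + a.val) k with h4 | h4
    · rw [Nat.mod_eq_of_lt h4] at h1
      omega
    · rw [Nat.mod_eq_sub_mod h4, Nat.mod_eq_of_lt (by omega)] at h1
      omega
  refine ⟨fun p hp => ?_, fun p hp q hq h1 h2 => ?_⟩
  · obtain ⟨⟨d, hd1, hd2⟩, h⟩ := mem_arcs.1 hp
    exact ⟨h, hd2 ▸ ZMod.val_lt _⟩
  · obtain ⟨⟨d, hd1, hd2⟩, hd⟩ := mem_arcs.1 hp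
    obtain ⟨⟨z, hz1, hz2⟩, hz⟩ := mem_arcs.1 hq
    have := hl.not_cross hs ho d z (fun e => by rw [e, hd1] at hz1; omega)
      (by rw [hsub _ _ (by omega), hsub _ _ (by omega)]; omega)
      (fun e => by rw [e, hd1] at hz2; omega)
    rw [hsub _ _ (by omega), hsub _ _ (by omega)] at this
    omega

theorem IsContour.iso_of_arcs_eq [NeZero k] (hk : 2 ≤ k) {B' : RootedMap}
    {lab' : B'.Vertex → ZMod k}
    (hl : B.IsContour lab) (hs : B.OuterSimple) (ho : B.IsOuterplanar)
    (hl' : B'.IsContour lab') (hs' : B'.OuterSimple) (ho' : B'.IsOuterplanar)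
    (harcs : B.arcs lab = B'.arcs lab') : Iso B B' := by
  have key : ∀ {B : RootedMap} {lab : B.Vertex → ZMod k}, B.IsContour lab → B.IsOuterplanar →
      ∀ c c' : ZMod k, (∃ d, lab (B.src d) = c ∧ lab (B.src (B.rev d)) = c') ↔
      (c.val, c'.val) ∈ B.arcs lab ∨ (c'.val, c.val) ∈ B.arcs lab := by
    intro B lab hl ho c c'
    have hval := ZMod.val_injective k
    simp only [mem_arcs, hval.eq_iff]
    constructor
    · rintro ⟨d, rfl, rfl⟩
      have hne : (lab (B.src d)).val ≠ (lab (B.src (B.rev d))).val := fun e =>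
        ho.2.1.1 d (hl.injective (hval e))
      rcases hne.lt_or_gt with h | h
      · exact .inl ⟨⟨d, rfl, rfl⟩, h⟩
      · exact .inr ⟨⟨B.rev d, rfl, by rw [B.rev_rev]⟩, h⟩
    · rintro (⟨h, -⟩ | ⟨⟨d, h1, h2⟩, -⟩)
      · exact h
      · exact ⟨B.rev d, h2, by rw [B.rev_rev, h1]⟩
  refine hl.iso hk hs ho hl' hs' ho' fun c c' => ?_
  rw [key hl ho, key hl' ho', harcs]

end RootedMap

namespace OuterplanarClass
variable {C : Set RootedMapClass} (hC : ∀ M : RootedMap, (Quotient.mk _ M : RootedMapClass) ∈ C →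
      M.IsOuterplanar ∧ M.IsNonseparable)
include hC

/-- There are at most exponentially many blocks of given size. -/
theorem finite_blocks_and_le (k : ℕ) :
    {b ∈ C | classSize b = k}.Finite ∧ blockCount C k ≤ 64 ^ k := by
  classical
  rcases lt_or_ge k 2 with hk | hk
  · have : {b ∈ C | classSize b = k} = ∅ := by
      ext b
      simp only [Set.mem_ofPred_eq, Set.mem_empty_iff_false, iff_false, not_and]
      intro hb
      have := two_le_classSize hC ⟨b, hb⟩
      simp only at this
      omega
    rw [blockCount, this]
    simp
  have : NeZero k := ⟨by omega⟩
  have hex : ∀ b : {b : C // classSize b.1 = k}, ∃ lab : (b.1.1.out : RootedMap).Vertex → ZMod k,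
      (b.1.1.out : RootedMap).IsContour lab := fun b =>
    (out_spec hC b.1).2.2.exists_isContour (out_spec hC b.1).1 ((card_outer hC b.1).trans b.2)
  choose lab hlab using hex
  let α : {b : C // classSize b.1 = k} → Finset (ℕ × ℕ) := fun b =>
    (b.1.1.out : RootedMap).arcs (lab b)
  have hinj : Function.Injective α := by
    intro b b' h
    have h1 := out_spec hC b.1
    have h2 := out_spec hC b'.1
    have := (hlab b).iso_of_arcs_eq hk h1.2.2 h1.1 (hlab b') h2.2.2 h2.1 h
    apply Subtype.ext
    apply Subtype.ext
    rw [← Quotient.out_eq b.1.1, ← Quotient.out_eq b'.1.1]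
    exact Quotient.sound (s := RootedMap.isoSetoid) this
  have hnc : ∀ b, IsNoncrossing k (α b) := fun b =>
    (hlab b).isNoncrossing_arcs (out_spec hC b.1).2.2 (out_spec hC b.1).1
  have hfin : Finite {b : C // classSize b.1 = k} := by
    refine Set.finite_coe_iff.1 (Finite.of_injective (β := ((Finset.range k ×ˢ Finset.range k).powerset))
      (fun b : {b : C // classSize b.1 = k} => ⟨α b, ?_⟩) fun b b' h => hinj (congrArg Subtype.val h))
    rw [Finset.mem_powerset]
    intro p hp
    have := (hnc b).1 p hp
    rw [Finset.mem_product, Finset.mem_range, Finset.mem_range]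
    omega
  have himg : {b ∈ C | classSize b = k} = Set.range fun b : {b : C // classSize b.1 = k} => b.1.1 := by
    ext b
    constructor
    · rintro ⟨h1, h2⟩
      exact ⟨⟨⟨b, h1⟩, h2⟩, rfl⟩
    · rintro ⟨b, rfl⟩
      exact ⟨b.1.2, b.2⟩
  refine ⟨himg ▸ Set.finite_range _, ?_⟩
  have : Fintype {b : C // classSize b.1 = k} := Fintype.ofFinite _
  rw [blockCount, himg, ← Set.image_univ,
    Set.ncard_image_of_injective _ (fun a b h => Subtype.ext (Subtype.ext h)), Set.ncard_univ,
    Nat.card_eq_fintype_card, ← Finset.card_univ, ← Finset.card_image_of_injective _ hinj]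
  refine card_noncrossing_le k _ fun A hA => ?_
  obtain ⟨b, -, rfl⟩ := Finset.mem_image.1 hA
  exact hnc b

end OuterplanarClass

/-! ### Lagrange inversion -/

namespace PowerSeries
variable {R : Type*} [Field R]

theorem coeff_X_mul_derivative (f : R⟦X⟧) (n : ℕ) :
    coeff n (X * derivative R f) = n * coeff n f := by
  rcases n with _ | n
  · simp
  · rw [coeff_succ_X_mul, coeff_derivative, mul_comm]
    push_cast
    ring

theorem coeff_pow_of_lt {g : R⟦X⟧} (hg : constantCoeff g = 0) {m d : ℕ} (h : m < d) :
    coeff m (g ^ d) = 0 :=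
  X_pow_dvd_iff.1 (pow_dvd_pow_of_dvd (X_dvd_iff.2 hg) d) m h

theorem coeff_subst_eq_sum {g : R⟦X⟧} (hg : constantCoeff g = 0) (f : R⟦X⟧) {m N : ℕ}
    (hN : m < N) : coeff m (f.subst g) = ∑ j ∈ Finset.range N, coeff j f * coeff m (g ^ j) := by
  rw [coeff_subst' (HasSubst.of_constantCoeff_zero' hg)]
  refine finsum_eq_sum_of_support_subset _ fun j hj => ?_
  simp only [Finset.coe_range, Set.mem_Iio]
  by_contra hcon
  exact hj (by simp only [coeff_pow_of_lt hg (show m < j by omega), smul_zero])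

/-- Lagrange inversion for the powers of the solution of `g = X * f(g)`. -/
theorem natCast_mul_coeff_pow [CharZero R] {f g : R⟦X⟧} (hg : constantCoeff g = 0)
    (h : g = X * f.subst g) (n : ℕ) : ∀ k ≤ n, (n : R) * coeff n (g ^ k) =
      k * coeff (n - k) (f ^ n) := by
  have hs := HasSubst.of_constantCoeff_zero' hg
  induction n using Nat.strong_induction_on with
  | _ n ih =>
    intro k hk
    rcases Nat.eq_zero_or_pos k with rfl | hk0
    · rcases Nat.eq_zero_or_pos n with rfl | hn
      · simp
      · simp [coeff_one, hn.ne']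
    obtain ⟨m, rfl⟩ := Nat.exists_eq_add_of_le' hk
    rw [Nat.add_sub_cancel]
    have h1 : coeff (m + k) (g ^ k) = coeff m ((f ^ k).subst g) := by
      conv_lhs => rw [h, mul_pow, ← subst_pow hs, mul_comm, coeff_mul_X_pow]
    rw [h1, coeff_subst_eq_sum hg _ (Nat.lt_succ_self m)]
    rcases Nat.eq_zero_or_pos m with rfl | hm
    · simp
    have hm' : (m : R) ≠ 0 := by exact_mod_cast hm.ne'
    have h2 : (m : R) * ∑ j ∈ Finset.range m.succ, coeff j (f ^ k) * coeff m (g ^ j) =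
        coeff m (X * derivative R (f ^ k) * f ^ m) := by
      rw [coeff_mul, Finset.Nat.sum_antidiagonal_eq_sum_range_succ
        (fun i j => coeff i (X * derivative R (f ^ k)) * coeff j (f ^ m)), Finset.mul_sum]
      refine Finset.sum_congr rfl fun j hj => ?_
      have := ih m (by omega) j (Nat.lt_succ_iff.1 (Finset.mem_range.1 hj))
      rw [coeff_X_mul_derivative, mul_left_comm, this]
      ring
    have h3 : ((m + k : ℕ) : R⟦X⟧) * (X * derivative R (f ^ k) * f ^ m) =
        (k : R⟦X⟧) * (X * derivative R (f ^ (m + k))) := by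
      obtain ⟨k, rfl⟩ := Nat.exists_eq_add_of_le' hk0
      rw [derivative_pow, derivative_pow, show m + (k + 1) - 1 = m + k by omega,
        Nat.add_sub_cancel, pow_add f m k]
      ring
    have h4 := congrArg (coeff m) h3
    rw [← map_natCast (C (R := R)), ← map_natCast (C (R := R)), coeff_C_mul, coeff_C_mul,
      coeff_X_mul_derivative, ← h2] at h4
    apply mul_left_cancel₀ hm'
    rw [mul_left_comm, h4]
    ring

end PowerSeries

namespace OuterplanarClass
variable {C : Set RootedMapClass} (hC : ∀ M : RootedMap, (Quotient.mk _ M : RootedMapClass) ∈ C →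
      M.IsOuterplanar ∧ M.IsNonseparable)

/-- The series `φ_C(z) / z`. -/
def quotSeries (C : Set RootedMapClass) : ℝ⟦X⟧ :=
  PowerSeries.mk fun k => PowerSeries.coeff (k + 1) (blockSeries C)

include hC

theorem blockCount_of_lt_two {k : ℕ} (hk : k < 2) : blockCount C k = 0 := by
  have : {b ∈ C | classSize b = k} = ∅ := by
    ext b
    simp only [Set.mem_ofPred_eq, Set.mem_empty_iff_false, iff_false, not_and]
    intro hb
    have := two_le_classSize hC ⟨b, hb⟩
    simp only at this
    omega
  rw [blockCount, this]
  simp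

theorem blockSeries_eq : blockSeries C = PowerSeries.X * quotSeries C := by
  ext k
  rcases k with _ | k
  · rw [coeff_blockSeries, blockCount_of_lt_two hC (by omega)]
    simp
  · rw [PowerSeries.coeff_succ_X_mul, quotSeries, PowerSeries.coeff_mk]

theorem constantCoeff_quotSeries : PowerSeries.constantCoeff (quotSeries C) = 0 := by
  rw [← PowerSeries.coeff_zero_eq_constantCoeff_apply, quotSeries, PowerSeries.coeff_mk,
    coeff_blockSeries, blockCount_of_lt_two hC (by omega)]
  simp

theorem phiSeries_mul : phiSeries C * (1 - quotSeries C) = 1 :=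
  PowerSeries.inv_mul_cancel _ (by
    change PowerSeries.constantCoeff (1 - quotSeries C) ≠ 0
    rw [map_sub, constantCoeff_quotSeries hC]; simp)

/-- Lagrange inversion for maps: `n |M_n| = [t ^ (n - 1)] φ(t) ^ n`. -/
theorem natCast_mul_count {n : ℕ} (hn : 1 ≤ n) : (n : ℝ) * count C n =
    PowerSeries.coeff (n - 1) (phiSeries C ^ n) := by
  let M : ℝ⟦X⟧ := PowerSeries.mk fun n => (count C n : ℝ)
  have hMmap : M = (PowerSeries.mk (count C)).map (Nat.castRingHom ℝ) := by
    ext n; simp [M]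
  have hcount := count_eq hC (fun k => (finite_blocks_and_le hC k).1)
  have hM0 : PowerSeries.constantCoeff M = 0 := by
    rw [← PowerSeries.coeff_zero_eq_constantCoeff_apply, PowerSeries.coeff_mk, hcount 0]
    simp [blockCount_of_lt_two hC]
  have hs := PowerSeries.HasSubst.of_constantCoeff_zero' hM0
  have h1 : M = (blockSeries C).subst M + PowerSeries.X := by
    ext n
    rw [map_add, PowerSeries.coeff_subst_eq_sum hM0 _ (Nat.lt_succ_self n), PowerSeries.coeff_X,
      PowerSeries.coeff_mk, hcount n]
    push_cast
    congr 1
    refine Finset.sum_congr rfl fun k _ => ?_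
    rw [coeff_blockSeries, hMmap, ← map_pow, PowerSeries.coeff_map]
    rfl
  have h2 : M * (1 - (quotSeries C).subst M) = PowerSeries.X := by
    rw [blockSeries_eq hC, PowerSeries.subst_mul hs, PowerSeries.subst_X hs] at h1
    linear_combination h1
  have h3 : (phiSeries C).subst M * (1 - (quotSeries C).subst M) = 1 := by
    have := congrArg (PowerSeries.subst M) (phiSeries_mul hC)
    have hone : (1 : ℝ⟦X⟧).subst M = (1 : ℝ⟦X⟧) := by
      rw [← PowerSeries.coe_substAlgHom hs, map_one]
    rwa [PowerSeries.subst_mul hs, PowerSeries.subst_sub hs, hone] at this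
  have h4 : M = PowerSeries.X * (phiSeries C).subst M := by
    linear_combination (phiSeries C).subst M * h2 - M * h3
  have := PowerSeries.natCast_mul_coeff_pow hM0 h4 n 1 hn
  rw [pow_one, Nat.cast_one, one_mul] at this
  rw [← this]
  simp [M]

end OuterplanarClass

/-! ### The mean of a tilted sequence -/

section Tilted
variable {a : ℕ → ℝ}

theorem summable_of_le_of_nonneg (ha : ∀ k, 0 ≤ a k) {s t : ℝ} (hs : 0 ≤ s) (hst : s ≤ t)
    (h : Summable fun k => a k * t ^ k) : Summable fun k => a k * s ^ k :=
  h.of_nonneg_of_le (fun k => mul_nonneg (ha k) (pow_nonneg hs k)) fun k =>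
    mul_le_mul_of_nonneg_left (pow_le_pow_left₀ hs hst k) (ha k)

theorem tsum_mul_pow_pos (ha : ∀ k, 0 ≤ a k) (h0 : 0 < a 0) {t : ℝ} (ht : 0 ≤ t)
    (hA : Summable fun k => a k * t ^ k) : 0 < ∑' k, a k * t ^ k :=
  hA.tsum_pos (fun k => mul_nonneg (ha k) (pow_nonneg ht k)) 0 (by simpa using h0)

/-- The mean of the weights `a k * t ^ k` increases with `t`: with `m` the mean at `s`, the terms
`(k - m) * ((t / s) ^ k - (t / s) ^ m)` are nonnegative. -/
theorem tilted_mean_lt (ha : ∀ k, 0 ≤ a k) (h0 : 0 < a 0) (h1 : ∃ k, k ≠ 0 ∧ 0 < a k) {s t : ℝ}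
    (hs : 0 < s) (hst : s < t) (hA : Summable fun k => a k * t ^ k)
    (hB : Summable fun k : ℕ => (k * a k : ℝ) * t ^ k) :
    (∑' k : ℕ, (k * a k : ℝ) * s ^ k) / (∑' k, a k * s ^ k) <
      (∑' k : ℕ, (k * a k : ℝ) * t ^ k) / (∑' k, a k * t ^ k) := by
  have ha' : ∀ k : ℕ, 0 ≤ (k * a k : ℝ) := fun k => mul_nonneg (Nat.cast_nonneg k) (ha k)
  have hAs := summable_of_le_of_nonneg ha hs.le hst.le hA
  have hBs := summable_of_le_of_nonneg ha' hs.le hst.le hB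
  have hApos := tsum_mul_pow_pos ha h0 (hs.trans hst).le hA
  have hAspos := tsum_mul_pow_pos ha h0 hs.le hAs
  obtain ⟨k0, hk0, hak0⟩ := h1
  have hBspos : 0 < ∑' k : ℕ, (k * a k : ℝ) * s ^ k :=
    hBs.tsum_pos (fun k => mul_nonneg (ha' k) (pow_nonneg hs.le k)) k0 (by positivity)
  set m := (∑' k : ℕ, (k * a k : ℝ) * s ^ k) / (∑' k, a k * s ^ k) with hm
  have hmpos : 0 < m := div_pos hBspos hAspos
  have hq : 1 < t / s := (one_lt_div hs).2 hst
  set q := (t / s) ^ m with hqdef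
  have hterm : ∀ k : ℕ, (k - m) * a k * s ^ k * q ≤ (k - m) * a k * t ^ k := by
    intro k
    have htk : t ^ k = s ^ k * (t / s) ^ (k : ℝ) := by
      rw [Real.rpow_natCast, div_pow, mul_div_cancel₀ _ (pow_pos hs k).ne']
    have h2 : 0 ≤ ((k : ℝ) - m) * ((t / s) ^ (k : ℝ) - q) := by
      rcases le_total (k : ℝ) m with h | h
      · exact mul_nonneg_of_nonpos_of_nonpos (sub_nonpos.2 h)
          (sub_nonpos.2 (Real.rpow_le_rpow_of_exponent_le hq.le h))
      · exact mul_nonneg (sub_nonneg.2 h)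
          (sub_nonneg.2 (Real.rpow_le_rpow_of_exponent_le hq.le h))
    rw [htk]
    have := mul_nonneg (mul_nonneg (ha k) (pow_nonneg hs.le k)) h2
    linarith
  have hlt : ((0 : ℕ) - m) * a 0 * s ^ 0 * q < ((0 : ℕ) - m) * a 0 * t ^ 0 := by
    have : 1 < q := Real.one_lt_rpow hq hmpos
    have := mul_pos hmpos h0
    simp only [Nat.cast_zero, pow_zero]
    nlinarith
  have hdiff : ∀ u : ℝ, (Summable fun k => a k * u ^ k) →
      (Summable fun k : ℕ => (k * a k : ℝ) * u ^ k) →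
      HasSum (fun k : ℕ => (k - m) * a k * u ^ k)
        ((∑' k : ℕ, (k * a k : ℝ) * u ^ k) - m * ∑' k, a k * u ^ k) := by
    intro u h1 h2
    refine (h2.hasSum.sub (h1.hasSum.mul_left m)).congr_fun ?_
    intro k
    ring
  have e1 := (hdiff s hAs hBs).mul_right q
  have e2 := hdiff t hA hB
  have e3 := hasSum_lt hterm hlt e1 e2
  have e4 : (∑' k : ℕ, (k * a k : ℝ) * s ^ k) - m * ∑' k, a k * s ^ k = 0 := by
    rw [hm, div_mul_cancel₀ _ hAspos.ne', sub_self]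
  rw [e4, zero_mul, sub_pos] at e3
  rwa [lt_div_iff₀ hApos]

theorem continuousOn_tsum_mul_pow (ha : ∀ k, 0 ≤ a k) {t : ℝ}
    (hA : Summable fun k => a k * t ^ k) :
    ContinuousOn (fun s => ∑' k, a k * s ^ k) (Set.Icc 0 t) := by
  refine continuousOn_tsum (fun k => by fun_prop) hA fun k s hs => ?_
  rw [Real.norm_of_nonneg (mul_nonneg (ha k) (pow_nonneg hs.1 k))]
  exact mul_le_mul_of_nonneg_left (pow_le_pow_left₀ hs.1 hs.2 k) (ha k)

theorem continuousOn_tilted_mean (ha : ∀ k, 0 ≤ a k) (h0 : 0 < a 0) {t : ℝ}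
    (hA : Summable fun k => a k * t ^ k) (hB : Summable fun k : ℕ => (k * a k : ℝ) * t ^ k) :
    ContinuousOn (fun s => (∑' k : ℕ, (k * a k : ℝ) * s ^ k) / (∑' k, a k * s ^ k))
      (Set.Icc 0 t) :=
  (continuousOn_tsum_mul_pow (fun k => mul_nonneg (Nat.cast_nonneg k) (ha k)) hB).div
    (continuousOn_tsum_mul_pow ha hA) fun _ hs =>
      (tsum_mul_pow_pos ha h0 hs.1 (summable_of_le_of_nonneg ha hs.1 hs.2 hA)).ne'

/-- A mean that stays below `1` forces convergence at the right end. -/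
theorem summable_of_tilted_mean_le_one (ha : ∀ k, 0 ≤ a k) {ρ : ℝ} (hρ : 0 < ρ)
    (hA : ∀ t, 0 < t → t < ρ → Summable fun k => a k * t ^ k)
    (hB : ∀ t, 0 < t → t < ρ → Summable fun k : ℕ => (k * a k : ℝ) * t ^ k)
    (hle : ∀ t, 0 < t → t < ρ → ∑' k : ℕ, (k * a k : ℝ) * t ^ k ≤ ∑' k, a k * t ^ k) :
    Summable fun k : ℕ => (k * a k : ℝ) * ρ ^ k := by
  have hpart : ∀ n : ℕ, ∀ t, 0 < t → t < ρ →
      ∑ k ∈ Finset.range n, (((k + 2 : ℕ) - 1) * a (k + 2) : ℝ) * t ^ (k + 2) ≤ a 0 := by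
    intro n t ht htρ
    have h1 : HasSum (fun k : ℕ => ((k - 1) * a k : ℝ) * t ^ k)
        ((∑' k : ℕ, (k * a k : ℝ) * t ^ k) - ∑' k, a k * t ^ k) := by
      refine ((hB t ht htρ).hasSum.sub (hA t ht htρ).hasSum).congr_fun fun k => ?_
      ring
    have h2 := (h1.summable.sum_add_tsum_nat_add 2)
    rw [h1.tsum_eq] at h2
    have h3 := (h1.summable.comp_injective (add_left_injective 2))
    have h4 := h3.sum_le_tsum (Finset.range n) fun k _ => by
      have : (0 : ℝ) ≤ ((k + 2 : ℕ) : ℝ) - 1 := by push_cast; linarith [k.cast_nonneg (α := ℝ)]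
      exact mul_nonneg (mul_nonneg this (ha _)) (pow_nonneg ht.le _)
    have h5 := hle t ht htρ
    simp only [Function.comp_apply] at h4
    simp only [Finset.sum_range_succ, Finset.sum_range_zero, Nat.cast_zero, Nat.cast_one, pow_zero,
      sub_self, zero_mul, zero_sub, mul_one, zero_add, neg_mul, one_mul, add_zero] at h2
    linarith
  have hlim : ∀ n : ℕ,
      ∑ k ∈ Finset.range n, (((k + 2 : ℕ) - 1) * a (k + 2) : ℝ) * ρ ^ (k + 2) ≤ a 0 := by
    intro n
    have hc : Continuous fun t : ℝ =>
        ∑ k ∈ Finset.range n, (((k + 2 : ℕ) - 1) * a (k + 2) : ℝ) * t ^ (k + 2) := by fun_prop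
    refine le_of_tendsto (hc.continuousWithinAt (s := Set.Iio ρ) (x := ρ)) ?_
    filter_upwards [Ioo_mem_nhdsLT hρ] with t ht
    exact hpart n t ht.1 ht.2
  have hs : Summable fun k : ℕ => (((k + 2 : ℕ) - 1) * a (k + 2) : ℝ) * ρ ^ (k + 2) := by
    refine summable_of_sum_range_le (c := a 0) (fun k => ?_) hlim
    have : (0 : ℝ) ≤ ((k + 2 : ℕ) : ℝ) - 1 := by push_cast; linarith [k.cast_nonneg (α := ℝ)]
    exact mul_nonneg (mul_nonneg this (ha _)) (pow_nonneg hρ.le _)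
  rw [← summable_nat_add_iff 2]
  refine (hs.mul_left 2).of_nonneg_of_le (fun k => ?_) fun k => ?_
  · exact mul_nonneg (mul_nonneg (Nat.cast_nonneg _) (ha _)) (pow_nonneg hρ.le _)
  · have := mul_nonneg (mul_nonneg (Nat.cast_nonneg (α := ℝ) k) (ha (k + 2)))
      (pow_nonneg hρ.le (k + 2))
    push_cast
    nlinarith

theorem summable_pow_mul_of_lt (ha : ∀ k, 0 ≤ a k) {s t : ℝ} (hs : 0 ≤ s) (hst : s < t)
    (hA : Summable fun k => a k * t ^ k) (j : ℕ) :
    Summable fun k : ℕ => (k ^ j * a k : ℝ) * s ^ k := by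
  have ht : 0 < t := hs.trans_lt hst
  have h1 : Summable fun k : ℕ => ((k : ℝ) ^ j * (s / t) ^ k) := by
    refine summable_pow_mul_geometric_of_norm_lt_one j ?_
    rw [Real.norm_of_nonneg (by positivity)]
    exact (div_lt_one ht).2 hst
  obtain ⟨M, hM⟩ := h1.tendsto_atTop_zero.bddAbove_range
  refine (hA.mul_left M).of_nonneg_of_le (fun k => ?_) fun k => ?_
  · exact mul_nonneg (mul_nonneg (by positivity) (ha k)) (pow_nonneg hs k)
  · have h2 : (k : ℝ) ^ j * (s / t) ^ k ≤ M := hM ⟨k, rfl⟩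
    have h3 : (k ^ j * a k : ℝ) * s ^ k = ((k : ℝ) ^ j * (s / t) ^ k) * (a k * t ^ k) := by
      rw [div_pow]
      field_simp
    rw [h3]
    exact mul_le_mul_of_nonneg_right h2 (mul_nonneg (ha k) (pow_nonneg ht.le k))

end Tilted

/-! ### The coefficients of `φ` -/

namespace OuterplanarClass
variable {C : Set RootedMapClass}

section
variable (hC : ∀ M : RootedMap, (Quotient.mk _ M : RootedMapClass) ∈ C →
      M.IsOuterplanar ∧ M.IsNonseparable)
include hC

omit hC in
theorem coeff_quotSeries_nonneg (k : ℕ) : 0 ≤ PowerSeries.coeff k (quotSeries C) := by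
  rw [quotSeries, PowerSeries.coeff_mk, coeff_blockSeries]
  exact Nat.cast_nonneg _

/-- The recursion `φ = 1 + (φ_C(z) / z) φ`. -/
theorem coeff_phiSeries (n : ℕ) : PowerSeries.coeff n (phiSeries C) = (if n = 0 then 1 else 0) +
    ∑ p ∈ Finset.HasAntidiagonal.antidiagonal n,
      PowerSeries.coeff p.1 (quotSeries C) * PowerSeries.coeff p.2 (phiSeries C) := by
  rw [← PowerSeries.coeff_mul, ← PowerSeries.coeff_one, ← map_add]
  congr 1
  linear_combination phiSeries_mul hC

theorem coeff_zero_quotSeries : PowerSeries.coeff 0 (quotSeries C) = 0 := by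
  rw [PowerSeries.coeff_zero_eq_constantCoeff_apply, constantCoeff_quotSeries hC]

theorem coeff_zero_phiSeries : PowerSeries.coeff 0 (phiSeries C) = 1 := by
  rw [coeff_phiSeries hC]
  simp [constantCoeff_quotSeries hC]

theorem coeff_phiSeries_nonneg (n : ℕ) : 0 ≤ PowerSeries.coeff n (phiSeries C) := by
  induction n using Nat.strong_induction_on with
  | _ n ih =>
    rw [coeff_phiSeries hC]
    refine add_nonneg (by positivity) (Finset.sum_nonneg fun p hp => ?_)
    rcases Nat.eq_zero_or_pos p.1 with h | h
    · rw [h, coeff_zero_quotSeries hC, zero_mul]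
    · exact mul_nonneg (coeff_quotSeries_nonneg _)
        (ih _ (by have := Finset.HasAntidiagonal.mem_antidiagonal.1 hp; omega))

/-- There are at most `64 ^ (k + 1) ≤ 4096 ^ k` blocks with `k + 1` vertices for
`k ≥ 1`, and composing them to sequences at most doubles the rate. -/
theorem coeff_phiSeries_le (n : ℕ) : PowerSeries.coeff n (phiSeries C) ≤ 8192 ^ n := by
  induction n using Nat.strong_induction_on with
  | _ n ih =>
    rcases Nat.eq_zero_or_pos n with rfl | hn
    · rw [coeff_zero_phiSeries hC]; simp
    rw [coeff_phiSeries hC, if_neg hn.ne', zero_add,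
      Finset.Nat.sum_antidiagonal_eq_sum_range_succ (fun i j =>
        PowerSeries.coeff i (quotSeries C) * PowerSeries.coeff j (phiSeries C)),
      Finset.sum_range_succ', coeff_zero_quotSeries hC, zero_mul, add_zero]
    have h1 : ∀ i ∈ Finset.range n, PowerSeries.coeff (i + 1) (quotSeries C) *
        PowerSeries.coeff (n - (i + 1)) (phiSeries C) ≤ 8192 ^ n * ((1 / 2) ^ i * (1 / 2)) := by
      intro i hi
      have hi' := Finset.mem_range.1 hi
      have h2 : PowerSeries.coeff (i + 1) (quotSeries C) ≤ 4096 ^ (i + 1) := by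
        rw [quotSeries, PowerSeries.coeff_mk, coeff_blockSeries]
        have h3 := (finite_blocks_and_le hC (i + 1 + 1)).2
        have h4 : 64 ^ (i + 1 + 1) ≤ 4096 ^ (i + 1) := by
          rw [show 4096 = 64 ^ 2 by norm_num, ← pow_mul]
          exact Nat.pow_le_pow_right (by norm_num) (by omega)
        exact_mod_cast h3.trans h4
      have h5 := ih (n - (i + 1)) (by omega)
      calc _ ≤ (4096 : ℝ) ^ (i + 1) * 8192 ^ (n - (i + 1)) :=
            mul_le_mul h2 h5 (coeff_phiSeries_nonneg hC _) (by positivity)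
        _ = 8192 ^ (n - (i + 1)) * (8192 * (1 / 2)) ^ (i + 1) := by norm_num [mul_comm]
        _ = 8192 ^ (n - (i + 1) + (i + 1)) * (1 / 2) ^ (i + 1) := by rw [mul_pow, pow_add]; ring
        _ = 8192 ^ n * ((1 / 2) ^ i * (1 / 2)) := by rw [Nat.sub_add_cancel hi', pow_succ]
    refine (Finset.sum_le_sum h1).trans ?_
    rw [← Finset.mul_sum, ← Finset.sum_mul]
    have := (summable_geometric_two).sum_le_tsum (Finset.range n) (fun _ _ => by positivity)
    rw [tsum_geometric_two] at this
    nlinarith [pow_pos (show (0 : ℝ) < 8192 by norm_num) n]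

/-- A block with `d + 1` vertices can be repeated in a sequence. -/
theorem exists_one_le_coeff_phiSeries (hne : C.Nonempty) :
    ∃ d, 0 < d ∧ ∀ m, 1 ≤ PowerSeries.coeff (d * m) (phiSeries C) := by
  obtain ⟨b, hb⟩ := hne
  have hsize := two_le_classSize hC ⟨b, hb⟩
  simp only at hsize
  obtain ⟨d, hd⟩ := Nat.exists_eq_add_of_le' (show 1 ≤ classSize b by omega)
  have h1 : 1 ≤ PowerSeries.coeff d (quotSeries C) := by
    rw [quotSeries, PowerSeries.coeff_mk, coeff_blockSeries, blockCount]
    have := (finite_blocks_and_le hC (d + 1)).1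
    have h2 : 0 < {b ∈ C | classSize b = d + 1}.ncard :=
      (Set.ncard_pos this).2 ⟨b, hb, hd⟩
    exact_mod_cast h2
  refine ⟨d, by omega, fun m => ?_⟩
  induction m with
  | zero => rw [mul_zero, coeff_zero_phiSeries hC]
  | succ m ih =>
    rw [coeff_phiSeries hC]
    have h3 := Finset.single_le_sum (f := fun p : ℕ × ℕ => PowerSeries.coeff p.1 (quotSeries C) *
      PowerSeries.coeff p.2 (phiSeries C)) (s := Finset.HasAntidiagonal.antidiagonal (d * (m + 1)))
      (fun p _ => mul_nonneg (coeff_quotSeries_nonneg _) (coeff_phiSeries_nonneg hC _))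
      (a := (d, d * m)) (by rw [Finset.HasAntidiagonal.mem_antidiagonal]; simp only; ring)
    simp only at h3
    have h4 := one_le_mul_of_one_le_of_one_le h1 ih
    have h5 : (0 : ℝ) ≤ if d * (m + 1) = 0 then 1 else 0 := by positivity
    linarith

theorem radius_pos_and_le_one (hne : C.Nonempty) :
    0 < (FormalMultilinearSeries.ofScalars ℝ fun k => PowerSeries.coeff k (phiSeries C)).radius ∧
    (FormalMultilinearSeries.ofScalars ℝ fun k =>
      PowerSeries.coeff k (phiSeries C)).radius ≤ 1 := by
  set p := FormalMultilinearSeries.ofScalars ℝ fun k => PowerSeries.coeff k (phiSeries C) with hp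
  have hnorm : ∀ n, ‖p n‖ = PowerSeries.coeff n (phiSeries C) := fun n => by
    rw [hp, FormalMultilinearSeries.ofScalars_norm, Real.norm_of_nonneg
      (coeff_phiSeries_nonneg hC n)]
  constructor
  · have := p.le_radius_of_bound (r := (1 / 8192 : NNReal)) 1 fun n => by
      rw [hnorm]
      have h1 := coeff_phiSeries_le hC n
      push_cast
      rw [one_div, inv_pow, ← div_eq_mul_inv]
      exact div_le_one_of_le₀ h1 (by positivity)
    refine lt_of_lt_of_le ?_ this
    rw [ENNReal.coe_pos]
    positivity
  · by_contra hcon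
    have h1 := p.summable_norm_mul_pow (r := 1) (by simpa using hcon)
    simp only [hnorm, NNReal.coe_one, one_pow, mul_one] at h1
    obtain ⟨d, hd, hm⟩ := exists_one_le_coeff_phiSeries hC hne
    have h2 := h1.tendsto_atTop_zero.comp
      (tendsto_id.const_mul_atTop' hd : Tendsto (fun m => d * m) atTop atTop)
    exact absurd (ge_of_tendsto' h2 hm) (by norm_num)

theorem rho_pos (hne : C.Nonempty) : 0 < rho C := by
  obtain ⟨h1, h2⟩ := radius_pos_and_le_one hC hne
  exact ENNReal.toReal_pos h1.ne' (ne_top_of_le_ne_top ENNReal.one_ne_top h2)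

theorem summable_coeff_phiSeries {t : ℝ} (h0 : 0 < t) (ht : t < rho C) :
    Summable fun k => PowerSeries.coeff k (phiSeries C) * t ^ k := by
  have h1 : (t.toNNReal : ENNReal) <
      (FormalMultilinearSeries.ofScalars ℝ fun k => PowerSeries.coeff k (phiSeries C)).radius :=
    (ENNReal.ofReal_lt_iff_lt_toReal h0.le (fun h => by
      rw [rho, h] at ht; exact absurd ht (by simpa using h0.le))).2 ht
  have := (FormalMultilinearSeries.ofScalars ℝ fun k =>
    PowerSeries.coeff k (phiSeries C)).summable_norm_mul_pow h1
  simpa only [FormalMultilinearSeries.ofScalars_norm, Real.coe_toNNReal t h0.le,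
    Real.norm_of_nonneg (coeff_phiSeries_nonneg hC _)] using this

end
end OuterplanarClass

/-! ### The function `ψ` -/

theorem summable_shift_iff {f : ℕ → ℝ} {t : ℝ} (ht : t ≠ 0) (j : ℕ) :
    (Summable fun k => f (k + j) * t ^ k) ↔ Summable fun k => f k * t ^ k := by
  rw [← summable_nat_add_iff (f := fun k => f k * t ^ k) j,
    ← summable_mul_left_iff (pow_ne_zero j ht)]
  refine summable_congr fun k => ?_
  rw [pow_add]
  ring

theorem pow_mul_tsum_shift {f : ℕ → ℝ} {t : ℝ} (ht : t ≠ 0) (j : ℕ) (hf : ∀ i < j, f i = 0) :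
    t ^ j * ∑' k, f (k + j) * t ^ k = ∑' k, f k * t ^ k := by
  by_cases h : Summable fun k => f k * t ^ k
  · rw [← h.sum_add_tsum_nat_add j, Finset.sum_eq_zero fun i hi => by
      rw [hf i (Finset.mem_range.1 hi), zero_mul], zero_add, ← tsum_mul_left]
    refine tsum_congr fun k => ?_
    rw [pow_add]
    ring
  · rw [tsum_eq_zero_of_not_summable h,
      tsum_eq_zero_of_not_summable (fun h' => h ((summable_shift_iff ht j).1 h')), mul_zero]

namespace OuterplanarClass
variable {C : Set RootedMapClass}

theorem coeff_derivative_one (k : ℕ) :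
    PowerSeries.coeff k ((PowerSeries.derivative ℝ)^[1] (phiSeries C)) =
      ((k + 1 : ℕ) : ℝ) * PowerSeries.coeff (k + 1) (phiSeries C) := by
  rw [Function.iterate_one, PowerSeries.coeff_derivative, mul_comm]
  push_cast
  ring

theorem coeff_derivative_two (k : ℕ) :
    PowerSeries.coeff k ((PowerSeries.derivative ℝ)^[2] (phiSeries C)) =
      ((k + 2 : ℕ) : ℝ) * (((k + 2 : ℕ) : ℝ) - 1) * PowerSeries.coeff (k + 2) (phiSeries C) := by
  rw [Function.iterate_succ_apply', PowerSeries.coeff_derivative, coeff_derivative_one]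
  push_cast
  ring

theorem phiDerivSummable_one_iff {t : ℝ} (ht : t ≠ 0) : PhiDerivSummable C 1 t ↔
    Summable fun k : ℕ => (k * PowerSeries.coeff k (phiSeries C) : ℝ) * t ^ k := by
  rw [← summable_shift_iff ht 1]
  simp only [PhiDerivSummable, coeff_derivative_one]

theorem phiDerivSummable_two_iff {t : ℝ} (ht : t ≠ 0) : PhiDerivSummable C 2 t ↔
    Summable fun k : ℕ => (k * (k - 1) * PowerSeries.coeff k (phiSeries C) : ℝ) * t ^ k := by
  rw [← summable_shift_iff ht 2]
  simp only [PhiDerivSummable, coeff_derivative_two]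

theorem mul_phiDeriv_one {t : ℝ} (ht : t ≠ 0) : t * phiDeriv C 1 t =
    ∑' k : ℕ, (k * PowerSeries.coeff k (phiSeries C) : ℝ) * t ^ k := by
  rw [← pow_mul_tsum_shift ht 1 (by simp), pow_one]
  simp only [phiDeriv, coeff_derivative_one]

theorem sq_mul_phiDeriv_two {t : ℝ} (ht : t ≠ 0) : t ^ 2 * phiDeriv C 2 t =
    ∑' k : ℕ, (k * (k - 1) * PowerSeries.coeff k (phiSeries C) : ℝ) * t ^ k := by
  rw [← pow_mul_tsum_shift ht 2 (fun i hi => by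
    rcases (show i = 0 ∨ i = 1 by omega) with rfl | rfl <;> simp)]
  simp only [phiDeriv, coeff_derivative_two]

theorem psi_eq {t : ℝ} (ht : t ≠ 0) : psi C t =
    (∑' k : ℕ, (k * PowerSeries.coeff k (phiSeries C) : ℝ) * t ^ k) /
      ∑' k, PowerSeries.coeff k (phiSeries C) * t ^ k := by
  rw [psi, mul_phiDeriv_one ht]
  rfl

/-- The value `1` of `ψ` is not a junk value. -/
theorem summable_of_psi_eq_one {t : ℝ} (h : psi C t = 1) :
    PhiDerivSummable C 0 t ∧ PhiDerivSummable C 1 t := by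
  constructor
  · by_contra hs
    have : phiDeriv C 0 t = 0 := tsum_eq_zero_of_not_summable hs
    rw [psi, this, div_zero] at h
    exact zero_ne_one h
  · by_contra hs
    have : phiDeriv C 1 t = 0 := tsum_eq_zero_of_not_summable hs
    rw [psi, this, mul_zero, zero_div] at h
    exact zero_ne_one h

section
variable (hC : ∀ M : RootedMap, (Quotient.mk _ M : RootedMapClass) ∈ C →
      M.IsOuterplanar ∧ M.IsNonseparable)
include hC

theorem summable_mul_coeff_phiSeries {t : ℝ} (h0 : 0 < t) (ht : t < rho C) :
    Summable fun k : ℕ => (k * PowerSeries.coeff k (phiSeries C) : ℝ) * t ^ k := by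
  obtain ⟨u, hu, hu'⟩ := exists_between ht
  simpa using summable_pow_mul_of_lt (coeff_phiSeries_nonneg hC) h0.le hu
    (summable_coeff_phiSeries hC (h0.trans hu) hu') 1

theorem phi_zero_pos : 0 < PowerSeries.coeff 0 (phiSeries C) := by
  rw [coeff_zero_phiSeries hC]; exact one_pos

variable (hne : C.Nonempty)
include hne

theorem exists_coeff_phiSeries_pos : ∃ k, k ≠ 0 ∧ 0 < PowerSeries.coeff k (phiSeries C) := by
  obtain ⟨d, hd, hm⟩ := exists_one_le_coeff_phiSeries hC hne
  exact ⟨d * 1, by omega, one_pos.trans_le (hm 1)⟩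

theorem psi_lt_psi {s t : ℝ} (hs : 0 < s) (hst : s < t) (h0 : PhiDerivSummable C 0 t)
    (h1 : PhiDerivSummable C 1 t) : psi C s < psi C t := by
  rw [psi_eq hs.ne', psi_eq (hs.trans hst).ne']
  exact tilted_mean_lt (coeff_phiSeries_nonneg hC) (phi_zero_pos hC)
    (exists_coeff_phiSeries_pos hC hne) hs hst h0
    ((phiDerivSummable_one_iff (hs.trans hst).ne').1 h1)

theorem psi_strictMonoOn : StrictMonoOn (psi C) (Set.Ioo 0 (rho C)) := fun _ hs _ ht hst =>
  psi_lt_psi hC hne hs.1 hst (summable_coeff_phiSeries hC ht.1 ht.2)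
    ((phiDerivSummable_one_iff ht.1.ne').2 (summable_mul_coeff_phiSeries hC ht.1 ht.2))

theorem tendsto_psi_sSup : Tendsto (fun t => (psi C t : EReal)) (𝓝[<] rho C)
    (𝓝 (sSup ((fun t => (psi C t : EReal)) '' Set.Ioo 0 (rho C)))) := by
  refine MonotoneOn.tendsto_nhdsWithin_Ioo_left (Set.nonempty_Ioo.2 (rho_pos hC hne))
    (fun s hs t ht hst => ?_) (OrderTop.bddAbove _)
  exact EReal.coe_le_coe_iff.2 ((psi_strictMonoOn hC hne).monotoneOn hs ht hst)

theorem nu_eq : nu C = sSup ((fun t => (psi C t : EReal)) '' Set.Ioo 0 (rho C)) :=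
  (tendsto_psi_sSup hC hne).limUnder_eq

theorem tendsto_psi : Tendsto (fun t => (psi C t : EReal)) (𝓝[<] rho C) (𝓝 (nu C)) := by
  rw [nu_eq hC hne]
  exact tendsto_psi_sSup hC hne

/-- If `ψ` reaches `1` before `ρ`, the value is attained by continuity; otherwise `ν = 1`, both
series converge at `ρ`, and `ψ(ρ) = ν`. -/
theorem exists_psi_eq_one (hν : 1 ≤ nu C) : ∃ τ ∈ Set.Ioc 0 (rho C), psi C τ = 1 := by
  have hρ := rho_pos hC hne
  have hnn := coeff_phiSeries_nonneg hC
  let g : ℝ → ℝ := fun t => (∑' k : ℕ, (k * PowerSeries.coeff k (phiSeries C) : ℝ) * t ^ k) /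
      ∑' k, PowerSeries.coeff k (phiSeries C) * t ^ k
  by_cases hex : ∃ t ∈ Set.Ioo 0 (rho C), 1 ≤ psi C t
  · obtain ⟨t, ht, h1⟩ := hex
    have hc : ContinuousOn g (Set.Icc 0 t) := continuousOn_tilted_mean hnn (phi_zero_pos hC)
      (summable_coeff_phiSeries hC ht.1 ht.2) (summable_mul_coeff_phiSeries hC ht.1 ht.2)
    have hg0 : g 0 = 0 := by
      have : ∀ k : ℕ, (k * PowerSeries.coeff k (phiSeries C) : ℝ) * 0 ^ k = 0 := fun k => by
        rcases k with _ | k <;> simp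
      simp only [g, this, tsum_zero, zero_div]
    rw [psi_eq ht.1.ne'] at h1
    obtain ⟨τ, hτ, hτ1⟩ := intermediate_value_Icc ht.1.le hc
      (show (1 : ℝ) ∈ Set.Icc (g 0) (g t) from ⟨hg0.le.trans zero_le_one, h1⟩)
    have hτ0 : 0 < τ := lt_of_le_of_ne hτ.1 fun h => by
      rw [← h, hg0] at hτ1
      exact zero_ne_one hτ1
    exact ⟨τ, ⟨hτ0, hτ.2.trans ht.2.le⟩, by rw [psi_eq hτ0.ne']; exact hτ1⟩
  · push Not at hex
    have hν1 : nu C = 1 := by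
      refine le_antisymm ?_ hν
      rw [nu_eq hC hne]
      refine sSup_le ?_
      rintro _ ⟨t, ht, rfl⟩
      exact EReal.coe_le_coe_iff.2 (hex t ht).le
    have hB : Summable fun k : ℕ =>
        (k * PowerSeries.coeff k (phiSeries C) : ℝ) * (rho C) ^ k := by
      refine summable_of_tilted_mean_le_one hnn hρ (fun t => summable_coeff_phiSeries hC)
        (fun t => summable_mul_coeff_phiSeries hC) fun t h0 ht => ?_
      have h1 := hex t ⟨h0, ht⟩
      rw [psi_eq h0.ne', div_lt_one (tsum_mul_pow_pos hnn (phi_zero_pos hC) h0.le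
        (summable_coeff_phiSeries hC h0 ht))] at h1
      exact h1.le
    have hA : Summable fun k : ℕ => PowerSeries.coeff k (phiSeries C) * (rho C) ^ k := by
      rw [← summable_nat_add_iff 1] at hB ⊢
      refine hB.of_nonneg_of_le (fun k => mul_nonneg (hnn _) (pow_nonneg hρ.le _)) fun k => ?_
      refine mul_le_mul_of_nonneg_right ?_ (pow_nonneg hρ.le _)
      refine le_mul_of_one_le_left (hnn _) ?_
      push_cast
      linarith [k.cast_nonneg (α := ℝ)]
    have hc : ContinuousOn g (Set.Icc 0 (rho C)) :=
      continuousOn_tilted_mean hnn (phi_zero_pos hC) hA hB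
    refine ⟨rho C, ⟨hρ, le_rfl⟩, ?_⟩
    have h1 : Tendsto (fun t => (psi C t : EReal)) (𝓝[<] rho C) (𝓝 (psi C (rho C) : EReal)) := by
      have h2 : Tendsto g (𝓝[<] rho C) (𝓝 (g (rho C))) :=
        ((hc _ ⟨hρ.le, le_rfl⟩).mono_of_mem_nhdsWithin (mem_of_superset (Ioo_mem_nhdsLT hρ)
          Set.Ioo_subset_Icc_self))
      rw [psi_eq hρ.ne']
      refine (continuous_coe_real_ereal.continuousAt.tendsto.comp h2).congr' ?_
      filter_upwards [Ioo_mem_nhdsLT hρ] with t ht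
      rw [psi_eq ht.1.ne']
      rfl
    have h3 := tendsto_nhds_unique h1 (tendsto_psi hC hne)
    rw [hν1] at h3
    exact_mod_cast h3

theorem eq_of_psi_eq_one {s t : ℝ} (hs : 0 < s) (ht : 0 < t) (h1 : psi C s = 1)
    (h2 : psi C t = 1) : s = t := by
  rcases lt_trichotomy s t with h | h | h
  · obtain ⟨e1, e2⟩ := summable_of_psi_eq_one h2
    have := psi_lt_psi hC hne hs h e1 e2
    linarith
  · exact h
  · obtain ⟨e1, e2⟩ := summable_of_psi_eq_one h1
    have := psi_lt_psi hC hne ht h e1 e2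
    linarith

end
end OuterplanarClass

/-! ### Characteristic functions of lattice distributions -/

/-- The characteristic function of the distribution with weights `p`. -/
def charSum (p : ℕ → ℝ) (α : ℝ) : ℂ := ∑' k : ℕ, (p k : ℂ) * Complex.exp (Complex.I * (k * α : ℝ))

section
variable {p : ℕ → ℝ} (hp : ∀ k, 0 ≤ p k) (hsum : HasSum p 1)
include hp

theorem norm_charSum_term (k : ℕ) (α : ℝ) :
    ‖(p k : ℂ) * Complex.exp (Complex.I * (k * α : ℝ))‖ = p k := by
  rw [norm_mul, Complex.norm_exp_I_mul_ofReal, mul_one, Complex.norm_of_nonneg (hp k)]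

include hsum

theorem hasSum_charSum (α : ℝ) :
    HasSum (fun k : ℕ => (p k : ℂ) * Complex.exp (Complex.I * (k * α : ℝ))) (charSum p α) :=
  (Summable.of_norm (by simpa only [norm_charSum_term hp] using hsum.summable)).hasSum

theorem continuous_charSum : Continuous (charSum p) := by
  refine continuous_tsum (fun k => by fun_prop) hsum.summable fun k α => ?_
  exact (norm_charSum_term hp k α).le

theorem hasSum_one_sub_re (α : ℝ) :
    HasSum (fun k : ℕ => p k * (1 - Real.cos (k * α))) (1 - (charSum p α).re) := by
  have h1 := Complex.hasSum_re (hasSum_charSum hp hsum α)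
  refine (hsum.sub h1).congr_fun fun k => ?_
  rw [Complex.re_ofReal_mul, mul_comm Complex.I, Complex.exp_ofReal_mul_I_re]
  ring

theorem sum_le_one_sub_re (α : ℝ) (s : Finset ℕ) :
    ∑ k ∈ s, p k * (1 - Real.cos (k * α)) ≤ 1 - (charSum p α).re := by
  rw [← (hasSum_one_sub_re hp hsum α).tsum_eq]
  exact (hasSum_one_sub_re hp hsum α).summable.sum_le_tsum s fun k _ =>
    mul_nonneg (hp k) (sub_nonneg.2 (Real.cos_le_one _))

/-- An atom at `0` makes the characteristic function decay wherever its real part does. -/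
theorem norm_charSum_le (α : ℝ) :
    ‖charSum p α‖ ≤ Real.exp (-(p 0 * (1 - (charSum p α).re))) := by
  have h1 : ‖charSum p α - p 0‖ ≤ 1 - p 0 := by
    have h2 := (hasSum_charSum hp hsum α)
    have h3 := (hasSum_nat_add_iff' 1).2 h2
    have h4 := (hasSum_nat_add_iff' 1).2 hsum
    simp only [Finset.range_one, Finset.sum_singleton, Nat.cast_zero, zero_mul, Complex.ofReal_zero,
      mul_zero, Complex.exp_zero, mul_one] at h3 h4
    rw [← h3.tsum_eq]
    refine tsum_of_norm_bounded h4 fun k => ?_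
    exact (norm_charSum_term hp (k + 1) α).le
  have h2 : ‖charSum p α‖ ^ 2 ≤ 1 - 2 * (p 0 * (1 - (charSum p α).re)) := by
    have h3 : ‖charSum p α - p 0‖ ^ 2 ≤ (1 - p 0) ^ 2 :=
      pow_le_pow_left₀ (norm_nonneg _) h1 2
    rw [← Complex.normSq_eq_norm_sq, Complex.normSq_apply] at h3 ⊢
    simp only [Complex.sub_re, Complex.sub_im, Complex.ofReal_re, Complex.ofReal_im] at h3
    nlinarith
  have h3 : 1 - 2 * (p 0 * (1 - (charSum p α).re)) ≤
      Real.exp (-(p 0 * (1 - (charSum p α).re))) ^ 2 := by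
    rw [← Real.exp_nat_mul]
    have := Real.add_one_le_exp (((2 : ℕ) : ℝ) * -(p 0 * (1 - (charSum p α).re)))
    push_cast at this ⊢
    linarith
  exact le_of_sq_le_sq (h2.trans h3) (Real.exp_pos _).le

theorem quadratic_le_one_sub_re {N : ℕ} {α : ℝ} (hα : N * |α| ≤ Real.pi) :
    2 / Real.pi ^ 2 * (∑ k ∈ Finset.range (N + 1), k ^ 2 * p k) * α ^ 2 ≤
      1 - (charSum p α).re := by
  refine le_trans ?_ (sum_le_one_sub_re hp hsum α (Finset.range (N + 1)))
  rw [Finset.mul_sum, Finset.sum_mul]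
  refine Finset.sum_le_sum fun k hk => ?_
  have hk' : (k : ℝ) ≤ N := by exact_mod_cast Nat.lt_succ_iff.1 (Finset.mem_range.1 hk)
  have h1 : |(k : ℝ) * α| ≤ Real.pi := by
    rw [abs_mul, Nat.abs_cast]
    exact (mul_le_mul_of_nonneg_right hk' (abs_nonneg _)).trans hα
  have h2 := Real.cos_le_one_sub_mul_cos_sq h1
  have h3 : 2 / Real.pi ^ 2 * ((k : ℝ) * α) ^ 2 ≤ 1 - Real.cos (k * α) := by linarith
  have := mul_le_mul_of_nonneg_left h3 (hp k)
  linarith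

/-- On a full period, centered at `0`, the real part equals one only at `0`. -/
theorem one_sub_re_charSum_pos {α : ℝ} (hα0 : α ≠ 0)
    (hα : Nat.setGcd {k | p k ≠ 0} * |α| ≤ Real.pi) (hs : Nat.setGcd {k | p k ≠ 0} ≠ 0) :
    0 < 1 - (charSum p α).re := by
  have hnn : ∀ k : ℕ, 0 ≤ p k * (1 - Real.cos (k * α)) := fun k =>
    mul_nonneg (hp k) (sub_nonneg.2 (Real.cos_le_one _))
  have hge : 0 ≤ 1 - (charSum p α).re := by
    rw [← (hasSum_one_sub_re hp hsum α).tsum_eq]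
    exact tsum_nonneg hnn
  refine lt_of_le_of_ne hge fun h0 => ?_
  have h1 := hasSum_one_sub_re hp hsum α
  rw [← h0, hasSum_zero_iff_of_nonneg hnn] at h1
  -- the integers `k` with `k * α` a multiple of `2 π` are closed under addition
  let A : Set ℕ := {k | ∃ m : ℤ, (k : ℝ) * α = m * (2 * Real.pi)}
  have hA : ∀ k ∈ AddSubmonoid.closure {k | p k ≠ 0}, k ∈ A := by
    intro k hk
    induction hk using AddSubmonoid.closure_induction with
    | mem k hk =>
      have h2 := congrFun h1 k
      simp only [Pi.zero_apply, mul_eq_zero] at h2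
      have h3 : Real.cos (k * α) = 1 := by
        rcases h2 with h2 | h2
        · exact absurd h2 hk
        · linarith
      obtain ⟨m, hm⟩ := (Real.cos_eq_one_iff _).1 h3
      exact ⟨m, hm.symm⟩
    | zero => exact ⟨0, by simp⟩
    | add k l _ _ hk hl =>
      obtain ⟨m, hm⟩ := hk
      obtain ⟨m', hm'⟩ := hl
      refine ⟨m + m', ?_⟩
      push_cast
      rw [add_mul, hm, hm']
      ring
  set s := Nat.setGcd {k | p k ≠ 0} with hsdef
  obtain ⟨n, hn⟩ := Nat.exists_mem_closure_of_ge {k | p k ≠ 0}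
  have hle : n ≤ s * n := Nat.le_mul_of_pos_left _ (Nat.pos_of_ne_zero hs)
  obtain ⟨m, hm⟩ := hA _ (hn (s * n) hle (Dvd.intro _ rfl))
  obtain ⟨m', hm'⟩ := hA _ (hn (s * (n + 1)) (hle.trans (Nat.mul_le_mul_left _ (Nat.le_succ n)))
    (Dvd.intro _ rfl))
  have h2 : (s : ℝ) * α = ((m' - m : ℤ) : ℝ) * (2 * Real.pi) := by
    push_cast at hm hm' ⊢
    linear_combination hm' - hm
  have h3 : |((m' - m : ℤ) : ℝ)| * (2 * Real.pi) ≤ Real.pi := by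
    have : |((m' - m : ℤ) : ℝ)| * (2 * Real.pi) = s * |α| := by
      rw [← Nat.abs_cast s, ← abs_mul, h2, abs_mul, abs_of_pos Real.two_pi_pos]
    rw [this]
    exact hα
  have h4 : |((m' - m : ℤ) : ℝ)| < 1 := by
    have := Real.pi_pos
    nlinarith
  have h5 : m' - m = 0 := by
    rw [← Int.abs_lt_one_iff]
    exact_mod_cast h4
  rw [h5, Int.cast_zero, zero_mul] at h2
  rcases mul_eq_zero.1 h2 with h6 | h6
  · exact hs (by exact_mod_cast h6)
  · exact hα0 h6

/-- A Gaussian bound on a full period. -/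
theorem exists_gaussian_bound (hp0 : 0 < p 0) (hs : Nat.setGcd {k | p k ≠ 0} ≠ 0) :
    ∃ c > 0, ∀ α : ℝ, Nat.setGcd {k | p k ≠ 0} * |α| ≤ Real.pi →
      ‖charSum p α‖ ≤ Real.exp (-(c * α ^ 2)) := by
  obtain ⟨k, hk, hk0⟩ := Nat.exists_ne_zero_of_setGcd_ne_zero hs
  set s := Nat.setGcd {k | p k ≠ 0} with hsdef
  have hspos : (0 : ℝ) < s := by exact_mod_cast Nat.pos_of_ne_zero hs
  have hkpos : (0 : ℝ) < k := by exact_mod_cast Nat.pos_of_ne_zero hk0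
  have hpk : 0 < p k := lt_of_le_of_ne (hp k) (Ne.symm hk)
  have hpi := Real.pi_pos
  suffices h : ∃ c > 0, ∀ α : ℝ, s * |α| ≤ Real.pi → c * α ^ 2 ≤ 1 - (charSum p α).re by
    obtain ⟨c, hc, h⟩ := h
    refine ⟨p 0 * c, mul_pos hp0 hc, fun α hα => (norm_charSum_le hp hsum α).trans ?_⟩
    rw [Real.exp_le_exp, mul_assoc]
    exact neg_le_neg (mul_le_mul_of_nonneg_left (h α hα) hp0.le)
  set c1 := 2 / Real.pi ^ 2 * (∑ j ∈ Finset.range (k + 1), j ^ 2 * p j) with hc1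
  have hc1pos : 0 < c1 := by
    refine mul_pos (by positivity) ?_
    refine lt_of_lt_of_le (show (0 : ℝ) < k ^ 2 * p k by positivity)
      (Finset.single_le_sum (f := fun j : ℕ => (j : ℝ) ^ 2 * p j)
        (fun j _ => mul_nonneg (by positivity) (hp j)) (Finset.self_mem_range_succ k))
  let K : Set ℝ := Set.Icc (-(Real.pi / s)) (Real.pi / s) ∩ {α | Real.pi / k ≤ |α|}
  have hK : IsCompact K := isCompact_Icc.inter_right
    (isClosed_le continuous_const continuous_abs)
  have hmemK : ∀ α : ℝ, s * |α| ≤ Real.pi → Real.pi / k ≤ |α| → α ∈ K := by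
    intro α h1 h2
    refine ⟨abs_le.1 ?_, h2⟩
    rw [le_div_iff₀ hspos, mul_comm]
    exact h1
  have hKpos : ∀ α ∈ K, 0 < (1 - (charSum p α).re) / α ^ 2 := by
    intro α hα
    have h0 : α ≠ 0 := by
      rintro rfl
      have h1 : Real.pi / k ≤ |(0 : ℝ)| := hα.2
      rw [abs_zero] at h1
      exact absurd h1 (not_le.2 (by positivity))
    refine div_pos (one_sub_re_charSum_pos hp hsum h0 ?_ hs) (by positivity)
    have := abs_le.2 hα.1
    rwa [le_div_iff₀ hspos, mul_comm] at this
  have hcont : ContinuousOn (fun α => (1 - (charSum p α).re) / α ^ 2) K := by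
    refine ContinuousOn.div (continuous_const.sub
      (Complex.continuous_re.comp (continuous_charSum hp hsum))).continuousOn (by fun_prop)
      fun α hα h0 => ?_
    have := hKpos α hα
    rw [h0, div_zero] at this
    exact lt_irrefl _ this
  obtain ⟨c2, hc2, hc2'⟩ : ∃ c2 > 0, ∀ α ∈ K, c2 ≤ (1 - (charSum p α).re) / α ^ 2 := by
    rcases K.eq_empty_or_nonempty with hE | hE
    · exact ⟨1, one_pos, fun α hα => by rw [hE] at hα; exact absurd hα (by simp)⟩
    · obtain ⟨α0, h0, hmin⟩ := hK.exists_isMinOn hE hcont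
      exact ⟨_, hKpos α0 h0, fun α hα => hmin hα⟩
  refine ⟨min c1 c2, lt_min hc1pos hc2, fun α hα => ?_⟩
  rcases le_total (Real.pi / k) |α| with h | h
  · have h1 := hKpos α (hmemK α hα h)
    have h2 := hc2' α (hmemK α hα h)
    have h3 : 0 < α ^ 2 := by
      refine lt_of_le_of_ne (sq_nonneg _) fun h0 => ?_
      rw [← h0, div_zero] at h1
      exact lt_irrefl _ h1
    rw [le_div_iff₀ h3] at h2
    exact (mul_le_mul_of_nonneg_right (min_le_right _ _) h3.le).trans h2
  · refine le_trans (mul_le_mul_of_nonneg_right (min_le_left _ _) (sq_nonneg α))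
      (quadratic_le_one_sub_re hp hsum ?_)
    rwa [le_div_iff₀ hkpos, mul_comm] at h

/-- Without a second moment, the powers of the characteristic function tend to `0` at the scale
`1 / √n`. -/
theorem tendsto_charSum_pow_zero (hp0 : 0 < p 0) (hv : ¬ Summable fun k : ℕ => (k ^ 2 * p k : ℝ))
    {u : ℝ} (hu : u ≠ 0) :
    Tendsto (fun n : ℕ => ‖charSum p (u / √n)‖ ^ n) atTop (𝓝 0) := by
  have hpi := Real.pi_pos
  have hlarge : Tendsto (fun N => ∑ k ∈ Finset.range N, (k ^ 2 * p k : ℝ)) atTop atTop :=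
    (not_summable_iff_tendsto_nat_atTop_of_nonneg
      (fun k => mul_nonneg (by positivity) (hp k))).1 hv
  have hexp : Tendsto (fun N => Real.exp (-(p 0 * (2 / Real.pi ^ 2 *
      (∑ k ∈ Finset.range N, (k ^ 2 * p k : ℝ)) * u ^ 2)))) atTop (𝓝 0) := by
    refine Real.tendsto_exp_neg_atTop_nhds_zero.comp ?_
    exact ((hlarge.const_mul_atTop (by positivity)).atTop_mul_const (by positivity)).const_mul_atTop
      hp0
  refine tendsto_order.2 ⟨fun a ha => Eventually.of_forall fun n => ha.trans_le (by positivity),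
    fun ε hε => ?_⟩
  obtain ⟨N, hN⟩ := ((hexp.comp (tendsto_add_atTop_nat 1)).eventually (gt_mem_nhds hε)).exists
  have hlim : Tendsto (fun n : ℕ => N * |u / √n|) atTop (𝓝 0) := by
    have h1 : Tendsto (fun n : ℕ => u / √(n : ℝ)) atTop (𝓝 0) :=
      Tendsto.const_div_atTop (Real.tendsto_sqrt_atTop.comp tendsto_natCast_atTop_atTop) u
    simpa using (h1.abs).const_mul (N : ℝ)
  filter_upwards [hlim.eventually (gt_mem_nhds hpi), eventually_gt_atTop 0] with n hn hn0
  have hn' : (0 : ℝ) < n := by exact_mod_cast hn0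
  have h1 := (norm_charSum_le hp hsum (u / √n)).trans (Real.exp_le_exp.2 (neg_le_neg
    (mul_le_mul_of_nonneg_left (quadratic_le_one_sub_re hp hsum hn.le) hp0.le)))
  refine lt_of_le_of_lt (pow_le_pow_left₀ (norm_nonneg _) h1 n) ?_
  rw [← Real.exp_nat_mul, div_pow, Real.sq_sqrt hn'.le]
  refine lt_of_eq_of_lt ?_ hN
  simp only [Function.comp_apply]
  congr 1
  field_simp

end

/-! ### A local limit theorem -/

theorem norm_exp_I_mul_sub_one_sub_le (y : ℝ) :
    ‖Complex.exp (Complex.I * y) - 1 - Complex.I * y‖ ≤ 3 * y ^ 2 := by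
  have hI : ‖Complex.I * (y : ℂ)‖ = |y| := by simp
  rcases le_total |y| 1 with h | h
  · have := Complex.norm_exp_sub_one_sub_id_le (x := Complex.I * y) (hI.le.trans h)
    rw [hI, sq_abs] at this
    nlinarith [sq_nonneg y]
  · have h1 : ‖Complex.exp (Complex.I * y) - 1 - Complex.I * y‖ ≤ 1 + 1 + |y| := by
      refine (norm_sub_le _ _).trans ?_
      rw [hI]
      refine add_le_add_left ((norm_sub_le _ _).trans ?_) _
      rw [Complex.norm_exp_I_mul_ofReal, norm_one]
    rw [← sq_abs y]
    nlinarith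

theorem tendsto_mul_exp_sub (y : ℝ) :
    Tendsto (fun n : ℕ => (n : ℂ) * (Complex.exp (Complex.I * (y / √n : ℝ)) - 1 -
      Complex.I * (y / √n : ℝ))) atTop (𝓝 (-(y ^ 2 / 2 : ℝ))) := by
  have hlim : Tendsto (fun n : ℕ => 1 / √(n : ℝ)) atTop (𝓝 0) :=
    Tendsto.const_div_atTop (Real.tendsto_sqrt_atTop.comp tendsto_natCast_atTop_atTop) 1
  have h0 : Tendsto (fun n : ℕ => |y| ^ 3 * (1 / √(n : ℝ))) atTop (𝓝 0) := by
    simpa using hlim.const_mul (|y| ^ 3)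
  have h1 : Tendsto (fun n : ℕ => |y| * (1 / √(n : ℝ))) atTop (𝓝 0) := by
    simpa using hlim.const_mul |y|
  rw [tendsto_iff_norm_sub_tendsto_zero]
  refine squeeze_zero' (Eventually.of_forall fun _ => norm_nonneg _) ?_ h0
  filter_upwards [h1.eventually (gt_mem_nhds one_pos), eventually_gt_atTop 0] with n hn hn0
  have hn' : (0 : ℝ) < n := by exact_mod_cast hn0
  have hsq : (√(n : ℝ)) ^ 2 = n := Real.sq_sqrt hn'.le
  have hs : 0 < √(n : ℝ) := Real.sqrt_pos.2 hn'
  set x : ℂ := Complex.I * (y / √n : ℝ) with hx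
  have hxn : ‖x‖ = |y| * (1 / √(n : ℝ)) := by
    rw [hx, norm_mul, Complex.norm_I, one_mul, Complex.norm_real, Real.norm_eq_abs, abs_div,
      abs_of_pos hs]
    ring
  have hnc : (n : ℂ) ≠ 0 := by exact_mod_cast hn0.ne'
  clear_value x
  have h2 := Complex.exp_bound (x := x) (hxn.le.trans hn.le) (n := 3) (by norm_num)
  simp only [Finset.sum_range_succ, Finset.sum_range_zero, pow_zero, Nat.factorial_zero,
    Nat.cast_one, pow_one, Nat.factorial_one, div_one, zero_add, hxn] at h2
  have h3 : (n : ℂ) * (Complex.exp x - 1 - x) - -((y ^ 2 / 2 : ℝ) : ℂ) =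
      n * (Complex.exp x - (1 + x + x ^ 2 / (Nat.factorial 2 : ℕ))) := by
    have : (n : ℂ) * x ^ 2 = -(y : ℂ) ^ 2 := by
      rw [hx, mul_pow, Complex.I_sq, ← Complex.ofReal_pow, div_pow, hsq]
      push_cast
      field_simp
    push_cast [Nat.factorial_two]
    linear_combination this / 2
  rw [h3, norm_mul, Complex.norm_natCast]
  refine (mul_le_mul_of_nonneg_left h2 hn'.le).trans ?_
  have h4 : (n : ℝ) * ((|y| * (1 / √(n : ℝ))) ^ 3) = |y| ^ 3 * (1 / √(n : ℝ)) := by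
    rw [show (n : ℝ) * ((|y| * (1 / √(n : ℝ))) ^ 3) =
      √(n : ℝ) ^ 2 * ((|y| * (1 / √(n : ℝ))) ^ 3) by rw [hsq]]
    field_simp
  have h5 : (0 : ℝ) ≤ |y| ^ 3 * (√(n : ℝ))⁻¹ := by positivity
  rw [← mul_assoc, h4]
  norm_num [Nat.factorial]
  linarith

section
variable {p : ℕ → ℝ} (hp : ∀ k, 0 ≤ p k) (hsum : HasSum p 1)
include hp hsum

theorem hasSum_centered (α : ℝ) :
    HasSum (fun k : ℕ => (p k : ℂ) * Complex.exp (Complex.I * ((k - 1) * α : ℝ)))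
      (Complex.exp (-(Complex.I * α)) * charSum p α) := by
  refine ((hasSum_charSum hp hsum α).mul_left _).congr_fun fun k => ?_
  rw [mul_left_comm, ← Complex.exp_add]
  congr 2
  push_cast
  ring

variable (hmean : HasSum (fun k : ℕ => (k * p k : ℝ)) 1)
include hmean

/-- With a second moment, the powers of the centered characteristic function converge to a
Gaussian. -/
theorem tendsto_centered_pow {v : ℝ} (hv : HasSum (fun k : ℕ => ((k - 1) ^ 2 * p k : ℝ)) v)
    (u : ℝ) :
    Tendsto (fun n : ℕ => (Complex.exp (-(Complex.I * (u / √n : ℝ))) * charSum p (u / √n)) ^ n)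
      atTop (𝓝 (Real.exp (-(v / 2) * u ^ 2) : ℂ)) := by
  let g : ℕ → ℂ := fun n => ∑' k : ℕ, (p k : ℂ) * (Complex.exp (Complex.I *
    (((k - 1) * u) / √n : ℝ)) - 1 - Complex.I * (((k - 1) * u) / √n : ℝ))
  have hg : ∀ n : ℕ, Complex.exp (-(Complex.I * (u / √n : ℝ))) * charSum p (u / √n) = 1 + g n := by
    intro n
    have h1 := hasSum_centered hp hsum (u / √n)
    have h2 : HasSum (fun k : ℕ => (p k : ℂ)) (1 : ℝ) := by exact_mod_cast hsum
    have h3 : HasSum (fun k : ℕ => ((k * p k - p k : ℝ) : ℂ)) (0 : ℝ) := by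
      have := hmean.sub hsum
      rw [sub_self] at this
      exact_mod_cast this
    rw [Complex.ofReal_one] at h2
    rw [Complex.ofReal_zero] at h3
    have h4 := (h1.sub h2).sub (h3.mul_left (Complex.I * (u / √n : ℝ)))
    rw [mul_zero, sub_zero] at h4
    have h5 : g n = Complex.exp (-(Complex.I * (u / √n : ℝ))) * charSum p (u / √n) - 1 := by
      rw [← h4.tsum_eq]
      refine tsum_congr fun k => ?_
      rw [← mul_div_assoc]
      push_cast
      ring
    rw [h5]
    ring
  simp only [hg]
  have hexp : (Real.exp (-(v / 2) * u ^ 2) : ℂ) = Complex.exp (-(v / 2 * u ^ 2 : ℝ)) := by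
    push_cast
    congr 1
    ring
  rw [hexp]
  refine Complex.tendsto_one_add_pow_exp_of_tendsto ?_
  have hsumv : HasSum (fun k : ℕ => (p k : ℂ) * (-(((k - 1) * u) ^ 2 / 2 : ℝ) : ℂ))
      (-(v / 2 * u ^ 2 : ℝ)) := by
    have := (hv.mul_right (-(u ^ 2 / 2)))
    have h2 : HasSum (fun k : ℕ => (((k - 1) ^ 2 * p k * (-(u ^ 2 / 2)) : ℝ) : ℂ))
      ((v * -(u ^ 2 / 2) : ℝ) : ℂ) := by exact_mod_cast this
    convert h2 using 1
    · ext k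
      push_cast
      ring
    · push_cast
      ring
  rw [← hsumv.tsum_eq]
  have hmul : ∀ n : ℕ, (n : ℂ) * g n = ∑' k : ℕ, (p k : ℂ) * ((n : ℂ) * (Complex.exp (Complex.I *
      (((k - 1) * u) / √n : ℝ)) - 1 - Complex.I * (((k - 1) * u) / √n : ℝ))) := by
    intro n
    rw [← tsum_mul_left]
    refine tsum_congr fun k => ?_
    ring
  simp only [hmul]
  refine tendsto_tsum_of_dominated_convergence (bound := fun k : ℕ =>
    3 * u ^ 2 * ((k - 1) ^ 2 * p k)) (hv.summable.mul_left _)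
    (fun k => (tendsto_mul_exp_sub ((k - 1) * u)).const_mul _) ?_
  filter_upwards [eventually_gt_atTop 0] with n hn0 k
  have hn' : (0 : ℝ) < n := by exact_mod_cast hn0
  rw [norm_mul, norm_mul, Complex.norm_of_nonneg (hp k), Complex.norm_natCast]
  have h1 := norm_exp_I_mul_sub_one_sub_le (((k - 1) * u) / √n)
  rw [div_pow, Real.sq_sqrt hn'.le] at h1
  have h2 := mul_le_mul_of_nonneg_left (mul_le_mul_of_nonneg_left h1 hn'.le) (hp k)
  refine h2.trans (le_of_eq ?_)
  field_simp

omit hmean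

/-- Dominated convergence for the Fourier integral at the scale `1 / √n`. -/
theorem tendsto_sqrt_mul_integral (hp0 : 0 < p 0) (hs : Nat.setGcd {k | p k ≠ 0} ≠ 0) {L : ℝ → ℂ}
    (hL : ∀ u ≠ 0, Tendsto (fun n : ℕ =>
      (Complex.exp (-(Complex.I * (u / √n : ℝ))) * charSum p (u / √n)) ^ n) atTop (𝓝 (L u))) :
    Tendsto (fun n : ℕ => (√n : ℂ) * ∫ α in (-(Real.pi / Nat.setGcd {k | p k ≠ 0}))..
      (Real.pi / Nat.setGcd {k | p k ≠ 0}), Complex.exp (Complex.I * α) *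
        (Complex.exp (-(Complex.I * α)) * charSum p α) ^ n) atTop (𝓝 (∫ u, L u)) := by
  obtain ⟨c, hc, hbound⟩ := exists_gaussian_bound hp hsum hp0 hs
  set s := Nat.setGcd {k | p k ≠ 0} with hsdef
  have hspos : (0 : ℝ) < s := by exact_mod_cast Nat.pos_of_ne_zero hs
  have hpi := Real.pi_pos
  set a := Real.pi / s with ha
  have hapos : 0 < a := div_pos hpi hspos
  let f : ℕ → ℝ → ℂ := fun n α => Complex.exp (Complex.I * α) *
        (Complex.exp (-(Complex.I * α)) * charSum p α) ^ n
  have hf : ∀ n, Continuous (f n) := fun n => by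
    have := continuous_charSum hp hsum
    fun_prop
  let F : ℕ → ℝ → ℂ := fun n => (Set.Ioc (-(a * √n)) (a * √n)).indicator fun u => f n (u / √n)
  have hnorm : ∀ n α, ‖f n α‖ = ‖charSum p α‖ ^ n := by
    intro n α
    simp only [f]
    rw [norm_mul, norm_pow, norm_mul, Complex.norm_exp_I_mul_ofReal, one_mul]
    have : ‖Complex.exp (-(Complex.I * α))‖ = 1 := by
      have h1 := Complex.norm_exp_I_mul_ofReal (-α)
      push_cast at h1
      rwa [mul_neg] at h1
    rw [this, one_mul]
  have hint : ∀ᶠ n : ℕ in atTop, ∫ u, F n u = (√n : ℂ) * ∫ α in (-a)..a, f n α := by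
    filter_upwards [eventually_gt_atTop 0] with n hn
    have hn' : (0 : ℝ) < √n := Real.sqrt_pos.2 (by exact_mod_cast hn)
    have h1 := intervalIntegral.integral_comp_div (a := -(a * √n)) (b := a * √n) (f n) hn'.ne'
    rw [neg_div, mul_div_cancel_right₀ _ hn'.ne', intervalIntegral.integral_of_le
      (by nlinarith [mul_pos hapos hn'])] at h1
    simp only [F]
    rw [MeasureTheory.integral_indicator measurableSet_Ioc, h1, Complex.real_smul]
  refine Tendsto.congr' hint ?_
  refine MeasureTheory.tendsto_integral_of_dominated_convergence
    (fun u => Real.exp (-c * u ^ 2)) (fun n => ?_) (integrable_exp_neg_mul_sq hc) (fun n => ?_) ?_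
  · exact ((hf n).comp (continuous_id.div_const _)).aestronglyMeasurable.indicator measurableSet_Ioc
  · refine Eventually.of_forall fun u => ?_
    simp only [F]
    by_cases hu : u ∈ Set.Ioc (-(a * √n)) (a * √n)
    · rw [Set.indicator_of_mem hu, hnorm]
      have hn' : (0 : ℝ) < √n := by
        by_contra hcon
        have h0 : √(n : ℝ) = 0 := le_antisymm (not_lt.1 hcon) (Real.sqrt_nonneg _)
        rw [h0] at hu
        simp at hu
      have h1 : |u / √n| ≤ a := by
        rw [abs_div, abs_of_pos hn', div_le_iff₀ hn']
        exact abs_le.2 ⟨hu.1.le, hu.2⟩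
      have h2 := hbound (u / √n) (by rwa [ha, le_div_iff₀ hspos, mul_comm] at h1)
      refine (pow_le_pow_left₀ (norm_nonneg _) h2 n).trans (le_of_eq ?_)
      have hn0 : (0 : ℝ) < n := Real.sqrt_pos.1 hn'
      rw [← Real.exp_nat_mul, div_pow, Real.sq_sqrt hn0.le]
      congr 1
      field_simp
    · rw [Set.indicator_of_notMem hu, norm_zero]
      positivity
  · have hae : ∀ᵐ u : ℝ, u ≠ 0 := by
      rw [MeasureTheory.ae_iff]
      simp
    filter_upwards [hae] with u hu
    have hlim : Tendsto (fun n : ℕ => u / √(n : ℝ)) atTop (𝓝 0) :=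
      Tendsto.const_div_atTop (Real.tendsto_sqrt_atTop.comp tendsto_natCast_atTop_atTop) u
    have h1 : Tendsto (fun n : ℕ => Complex.exp (Complex.I * (u / √(n : ℝ) : ℝ))) atTop (𝓝 1) := by
      have hc : Continuous fun x : ℝ => Complex.exp (Complex.I * x) := by fun_prop
      have := (hc.tendsto 0).comp hlim
      simp only [Complex.ofReal_zero, mul_zero, Complex.exp_zero] at this
      exact this
    have h2 := h1.mul (hL u hu)
    rw [one_mul] at h2
    refine h2.congr' ?_
    have h3 : Tendsto (fun n : ℕ => a * √(n : ℝ)) atTop atTop :=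
      (Real.tendsto_sqrt_atTop.comp tendsto_natCast_atTop_atTop).const_mul_atTop hapos
    filter_upwards [h3.eventually_gt_atTop |u|] with n hn
    have hmem : u ∈ Set.Ioc (-(a * √n)) (a * √n) :=
      ⟨(abs_lt.1 hn).1, (abs_lt.1 hn).2.le⟩
    simp only [F]
    rw [Set.indicator_of_mem hmem]

/-- The powers of the characteristic function are the Fourier series of the coefficients of the
powers of the generating function. -/
theorem hasSum_coeff_pow (n : ℕ) (α : ℝ) :
    (Summable fun m : ℕ => ‖PowerSeries.coeff m ((PowerSeries.mk p) ^ n)‖) ∧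
    HasSum (fun m : ℕ => ((PowerSeries.coeff m ((PowerSeries.mk p) ^ n) : ℝ) : ℂ) *
      Complex.exp (Complex.I * (m * α : ℝ))) (charSum p α ^ n) := by
  induction n with
  | zero =>
    constructor
    · refine summable_of_ne_finset_zero (s := {0}) fun m hm => ?_
      rw [pow_zero, PowerSeries.coeff_one, if_neg (by simpa using hm), norm_zero]
    · convert hasSum_single 0 ?_ using 1
      · simp
      · intro m hm
        rw [pow_zero, PowerSeries.coeff_one, if_neg hm, Complex.ofReal_zero, zero_mul]
  | succ n ih =>
    obtain ⟨ih1, ih2⟩ := ih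
    have hp1 : Summable fun m : ℕ => ‖p m‖ := by
      simpa only [Real.norm_of_nonneg (hp _)] using hsum.summable
    have hnorm : ∀ (c : ℝ) (m : ℕ), ‖(c : ℂ) * Complex.exp (Complex.I * (m * α : ℝ))‖ = ‖c‖ := by
      intro c m
      rw [norm_mul, Complex.norm_exp_I_mul_ofReal, mul_one, Complex.norm_real]
    constructor
    · refine (summable_norm_sum_mul_antidiagonal_of_summable_norm ih1 hp1).congr fun m => ?_
      rw [pow_succ, PowerSeries.coeff_mul]
      simp only [PowerSeries.coeff_mk]
    · have h1 : Summable fun m : ℕ => ‖((PowerSeries.coeff m ((PowerSeries.mk p) ^ n) : ℝ) : ℂ) *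
          Complex.exp (Complex.I * (m * α : ℝ))‖ := by simpa only [hnorm] using ih1
      have h2 : Summable fun m : ℕ => ‖(p m : ℂ) * Complex.exp (Complex.I * (m * α : ℝ))‖ := by
        simpa only [hnorm] using hp1
      have h3 := tsum_mul_tsum_eq_tsum_sum_antidiagonal_of_summable_norm h1 h2
      have h4 := (summable_norm_sum_mul_antidiagonal_of_summable_norm h1 h2).of_norm.hasSum
      rw [← h3, ih2.tsum_eq, (hasSum_charSum hp hsum α).tsum_eq, ← pow_succ] at h4
      refine h4.congr_fun fun m => ?_
      rw [pow_succ, PowerSeries.coeff_mul]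
      simp only [PowerSeries.coeff_mk]
      push_cast
      rw [Finset.sum_mul]
      refine Finset.sum_congr rfl fun q hq => ?_
      rw [← Finset.HasAntidiagonal.mem_antidiagonal.1 hq, mul_mul_mul_comm, ← Complex.exp_add]
      congr 2
      push_cast
      ring

omit hp hsum in
theorem dvd_of_coeff_pow_ne_zero (n : ℕ) : ∀ m : ℕ,
    PowerSeries.coeff m ((PowerSeries.mk p) ^ n) ≠ 0 → Nat.setGcd {k | p k ≠ 0} ∣ m := by
  induction n with
  | zero =>
    intro m hm
    rw [pow_zero, PowerSeries.coeff_one] at hm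
    have : m = 0 := by by_contra h; exact hm (if_neg h)
    rw [this]
    exact dvd_zero _
  | succ n ih =>
    intro m hm
    rw [pow_succ, PowerSeries.coeff_mul] at hm
    obtain ⟨q, hq, hne⟩ := Finset.exists_ne_zero_of_sum_ne_zero hm
    rw [← Finset.HasAntidiagonal.mem_antidiagonal.1 hq]
    refine dvd_add (ih _ (left_ne_zero_of_mul hne)) (Nat.setGcd_dvd_of_mem ?_)
    simpa using right_ne_zero_of_mul hne

/-- Fourier inversion for the coefficients of a power. The exponents occurring in `charSum p α` are
multiples of the span, so the integral is over a period of length `2 π / s`; for the exponent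
`n + 1` the centering leaves the factor `exp (-i n α)` that selects the coefficient of index
`n`. -/
theorem integral_charSum_pow (hs : Nat.setGcd {k | p k ≠ 0} ≠ 0) (n : ℕ)
    (hn : Nat.setGcd {k | p k ≠ 0} ∣ n) :
    ∫ α in (-(Real.pi / Nat.setGcd {k | p k ≠ 0}))..(Real.pi / Nat.setGcd {k | p k ≠ 0}),
      Complex.exp (Complex.I * α) * (Complex.exp (-(Complex.I * α)) * charSum p α) ^ (n + 1) =
    (2 * Real.pi / Nat.setGcd {k | p k ≠ 0} : ℝ) *
      PowerSeries.coeff n ((PowerSeries.mk p) ^ (n + 1)) := by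
  set s := Nat.setGcd {k | p k ≠ 0} with hsdef
  have hspos : (0 : ℝ) < s := by exact_mod_cast Nat.pos_of_ne_zero hs
  let c : ℕ → ℝ := fun m => PowerSeries.coeff m ((PowerSeries.mk p) ^ (n + 1))
  let f : ℕ → C(ℝ, ℂ) := fun m =>
    ⟨fun α => (c m : ℂ) * Complex.exp (Complex.I * (((m : ℝ) - n) * α : ℝ)), by fun_prop⟩
  have hsummable : Summable fun m => ‖(f m).restrict
      (⟨Set.uIcc (-(Real.pi / s)) (Real.pi / s), isCompact_uIcc⟩ :
        TopologicalSpace.Compacts ℝ)‖ := by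
    refine (hasSum_coeff_pow hp hsum (n + 1) 0).1.of_nonneg_of_le (fun m => norm_nonneg _)
      fun m => ?_
    refine (ContinuousMap.norm_le _ (norm_nonneg _)).2 fun α => ?_
    change ‖(c m : ℂ) * Complex.exp (Complex.I * (((m : ℝ) - n) * (α : ℝ) : ℝ))‖ ≤ _
    rw [norm_mul, Complex.norm_exp_I_mul_ofReal, mul_one, Complex.norm_real]
  have h1 := intervalIntegral.hasSum_intervalIntegral_of_summable_norm hsummable
  have h2 : ∀ α : ℝ, ∑' m, f m α = Complex.exp (Complex.I * α) *
      (Complex.exp (-(Complex.I * α)) * charSum p α) ^ (n + 1) := by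
    intro α
    have h3 := ((hasSum_coeff_pow hp hsum (n + 1) α).2.mul_left
      (Complex.exp (-(Complex.I * (n * α : ℝ)))))
    have h4 : Complex.exp (Complex.I * α) *
        (Complex.exp (-(Complex.I * α)) * charSum p α) ^ (n + 1) =
        Complex.exp (-(Complex.I * (n * α : ℝ))) * charSum p α ^ (n + 1) := by
      rw [mul_pow, ← mul_assoc, ← Complex.exp_nat_mul, ← Complex.exp_add]
      congr 2
      push_cast
      ring
    rw [h4, ← h3.tsum_eq]
    refine tsum_congr fun m => ?_
    change (c m : ℂ) * Complex.exp (Complex.I * (((m : ℝ) - n) * α : ℝ)) = _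
    rw [mul_left_comm, ← Complex.exp_add]
    congr 2
    push_cast
    ring
  simp only [h2] at h1
  rw [← h1.tsum_eq, tsum_eq_single n]
  · change ∫ α in (-(Real.pi / s))..(Real.pi / s),
      (c n : ℂ) * Complex.exp (Complex.I * (((n : ℝ) - n) * α : ℝ)) = _
    simp only [sub_self, zero_mul, Complex.ofReal_zero, mul_zero, Complex.exp_zero, mul_one,
      intervalIntegral.integral_const, Complex.real_smul]
    congr 2
    ring
  · intro m hm
    change ∫ α in (-(Real.pi / s))..(Real.pi / s),
      (c m : ℂ) * Complex.exp (Complex.I * (((m : ℝ) - n) * α : ℝ)) = 0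
    by_cases hcm : c m = 0
    · simp [hcm]
    obtain ⟨j, hj⟩ := dvd_of_coeff_pow_ne_zero (n + 1) m hcm
    obtain ⟨i, hi⟩ := hn
    change m = s * j at hj
    have hsc : (s : ℂ) ≠ 0 := by exact_mod_cast hs
    have hji : ((j : ℂ) - i) ≠ 0 := by
      rw [sub_ne_zero]
      intro h
      apply hm
      rw [hj, hi, show j = i by exact_mod_cast h]
    have hne : Complex.I * ((m : ℂ) - n) ≠ 0 := by
      refine mul_ne_zero Complex.I_ne_zero ?_
      rw [hj, hi]
      push_cast
      rw [← mul_sub]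
      exact mul_ne_zero hsc hji
    have h5 : ∀ α : ℝ, (c m : ℂ) * Complex.exp (Complex.I * (((m : ℝ) - n) * α : ℝ)) =
        (c m : ℂ) * Complex.exp (Complex.I * ((m : ℂ) - n) * α) := by
      intro α
      push_cast
      rw [mul_assoc]
    simp only [h5]
    rw [intervalIntegral.integral_const_mul, integral_exp_mul_complex hne]
    have h6 : Complex.exp (Complex.I * ((m : ℂ) - n) * (Real.pi / s : ℝ)) =
        Complex.exp (Complex.I * ((m : ℂ) - n) * (-(Real.pi / s) : ℝ)) := by
      rw [Complex.exp_eq_exp_iff_exists_int]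
      refine ⟨(j : ℤ) - i, ?_⟩
      rw [hj, hi]
      push_cast
      field_simp
      ring
    rw [h6, sub_self, zero_div, mul_zero]

end

section
variable {p : ℕ → ℝ} (hp : ∀ k, 0 ≤ p k) (hsum : HasSum p 1) (hp0 : 0 < p 0)
  (hs : Nat.setGcd {k | p k ≠ 0} ≠ 0)
include hp hsum hp0 hs

theorem tendsto_sqrt_mul_coeff_pow {L : ℝ → ℂ} {l : ℝ}
    (hL : ∀ u ≠ 0, Tendsto (fun n : ℕ =>
      (Complex.exp (-(Complex.I * (u / √n : ℝ))) * charSum p (u / √n)) ^ n) atTop (𝓝 (L u)))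
    (hl : ∫ u, L u = l) :
    Tendsto (fun n : ℕ => √n * PowerSeries.coeff (n - 1) ((PowerSeries.mk p) ^ n))
      (atTop ⊓ 𝓟 {n : ℕ | n ≡ 1 [MOD Nat.setGcd {k | p k ≠ 0}]})
      (𝓝 (Nat.setGcd {k | p k ≠ 0} / (2 * Real.pi) * l)) := by
  have h1 := tendsto_sqrt_mul_integral hp hsum hp0 hs hL
  have hinv := integral_charSum_pow hp hsum hs
  set s := Nat.setGcd {k | p k ≠ 0} with hsdef
  have hspos : (0 : ℝ) < s := by exact_mod_cast Nat.pos_of_ne_zero hs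
  rw [hl] at h1
  have h2 := ((Complex.continuous_re.tendsto _).comp h1).const_mul (s / (2 * Real.pi) : ℝ)
  rw [Complex.ofReal_re] at h2
  refine (h2.mono_left inf_le_left).congr' ?_
  filter_upwards [(eventually_ge_atTop 1).filter_mono inf_le_left,
    (eventually_principal.2 fun x hx => hx : ∀ᶠ n in 𝓟 {n : ℕ | n ≡ 1 [MOD s]},
      n ∈ {n : ℕ | n ≡ 1 [MOD s]}).filter_mono inf_le_right] with n hn hmod
  obtain ⟨n, rfl⟩ := Nat.exists_eq_add_of_le' hn
  have hdvd : s ∣ n := by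
    have := (Nat.modEq_iff_dvd' hn).1 hmod.symm
    simpa using this
  rw [Function.comp_apply, hinv n hdvd, ← Complex.ofReal_mul, ← Complex.ofReal_mul,
    Complex.ofReal_re, Nat.add_sub_cancel]
  have := Real.pi_pos
  field_simp

/-- The local limit theorem: `√n P(S_n = n - 1)` for a lattice distribution of mean `1`. -/
theorem tendsto_sqrt_mul_coeff_pow_of_variance (hmean : HasSum (fun k : ℕ => (k * p k : ℝ)) 1)
    {v : ℝ} (hvpos : 0 < v) (hv : HasSum (fun k : ℕ => ((k - 1) ^ 2 * p k : ℝ)) v) :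
    Tendsto (fun n : ℕ => √n * PowerSeries.coeff (n - 1) ((PowerSeries.mk p) ^ n))
      (atTop ⊓ 𝓟 {n : ℕ | n ≡ 1 [MOD Nat.setGcd {k | p k ≠ 0}]})
      (𝓝 (Nat.setGcd {k | p k ≠ 0} * (1 / (2 * Real.pi * v)) ^ (1 / 2 : ℝ))) := by
  have h := tendsto_sqrt_mul_coeff_pow hp hsum hp0 hs
    (L := fun u => (Real.exp (-(v / 2) * u ^ 2) : ℂ)) (l := √(Real.pi / (v / 2)))
    (fun u _ => tendsto_centered_pow hp hsum hmean hv u)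
    (by rw [← integral_gaussian]; exact integral_ofReal)
  convert h using 2
  have hpi := Real.pi_pos
  rw [← Real.sqrt_eq_rpow, div_mul_eq_mul_div, mul_div_assoc]
  congr 1
  rw [eq_div_iff (by positivity), ← Real.sqrt_sq (show 0 ≤ 2 * Real.pi by positivity),
    ← Real.sqrt_mul (by positivity)]
  congr 1
  rw [Real.sqrt_sq (by positivity)]
  field_simp

theorem tendsto_sqrt_mul_coeff_pow_of_not_summable
    (hv : ¬ Summable fun k : ℕ => (k ^ 2 * p k : ℝ)) :
    Tendsto (fun n : ℕ => √n * PowerSeries.coeff (n - 1) ((PowerSeries.mk p) ^ n))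
      (atTop ⊓ 𝓟 {n : ℕ | n ≡ 1 [MOD Nat.setGcd {k | p k ≠ 0}]}) (𝓝 0) := by
  have h := tendsto_sqrt_mul_coeff_pow hp hsum hp0 hs (L := fun _ => 0) (l := 0) (fun u hu => by
    rw [tendsto_zero_iff_norm_tendsto_zero]
    refine (tendsto_charSum_pow_zero hp hsum hp0 hv hu).congr fun n => ?_
    have h1 := Complex.norm_exp_I_mul_ofReal (-(u / √n))
    rw [Complex.ofReal_neg, mul_neg] at h1
    rw [norm_pow, norm_mul, h1, one_mul]) (by simp)
  rwa [mul_zero] at h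

end

namespace OuterplanarClass
variable {C : Set RootedMapClass} (hC : ∀ M : RootedMap, (Quotient.mk _ M : RootedMapClass) ∈ C →
      M.IsOuterplanar ∧ M.IsNonseparable)

/-! ### The number of maps -/

/-- The offspring distribution: the weights of `φ` tilted by `τ`. -/
def offspring (C : Set RootedMapClass) (τ : ℝ) (k : ℕ) : ℝ :=
  PowerSeries.coeff k (phiSeries C) * τ ^ k / phiDeriv C 0 τ

theorem coeff_offspring_pow (τ : ℝ) (n m : ℕ) :
    PowerSeries.coeff m ((PowerSeries.mk (offspring C τ)) ^ n) =
      τ ^ m / phiDeriv C 0 τ ^ n * PowerSeries.coeff m (phiSeries C ^ n) := by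
  have h : PowerSeries.mk (offspring C τ) =
      PowerSeries.C (phiDeriv C 0 τ)⁻¹ * PowerSeries.rescale τ (phiSeries C) := by
    ext k
    rw [PowerSeries.coeff_C_mul, PowerSeries.coeff_rescale, PowerSeries.coeff_mk, offspring]
    ring
  rw [h, mul_pow, ← map_pow, ← map_pow, PowerSeries.coeff_C_mul, PowerSeries.coeff_rescale]
  ring

section
include hC
variable {τ : ℝ} (hτ : 0 < τ) (h0 : PhiDerivSummable C 0 τ)
include hτ h0

theorem phiDeriv_zero_pos : 0 < phiDeriv C 0 τ :=
  tsum_mul_pow_pos (coeff_phiSeries_nonneg hC) (phi_zero_pos hC) hτ.le h0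

theorem offspring_nonneg (k : ℕ) : 0 ≤ offspring C τ k :=
  div_nonneg (mul_nonneg (coeff_phiSeries_nonneg hC k) (pow_nonneg hτ.le k))
    (phiDeriv_zero_pos hC hτ h0).le

theorem offspring_zero_pos : 0 < offspring C τ 0 := by
  rw [offspring, pow_zero, mul_one]
  exact div_pos (phi_zero_pos hC) (phiDeriv_zero_pos hC hτ h0)

theorem hasSum_offspring : HasSum (offspring C τ) 1 := by
  have h := (h0.hasSum).div_const (phiDeriv C 0 τ)
  have h1 : (∑' k, PowerSeries.coeff k ((PowerSeries.derivative ℝ)^[0] (phiSeries C)) * τ ^ k) =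
    phiDeriv C 0 τ := rfl
  rw [h1, div_self (phiDeriv_zero_pos hC hτ h0).ne'] at h
  exact h

theorem setGcd_offspring : Nat.setGcd {k | offspring C τ k ≠ 0} = span C := by
  rw [span]
  congr 1
  ext k
  have h1 := (phiDeriv_zero_pos hC hτ h0).ne'
  simp [offspring, h1, hτ.ne']

omit hC h0 in
theorem hasSum_mul_offspring (h1 : PhiDerivSummable C 1 τ) (hψ : psi C τ = 1) :
    HasSum (fun k : ℕ => (k * offspring C τ k : ℝ)) 1 := by
  have h := ((phiDerivSummable_one_iff hτ.ne').1 h1).hasSum.div_const (phiDeriv C 0 τ)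
  rw [← mul_phiDeriv_one hτ.ne', ← psi, hψ] at h
  refine h.congr_fun fun k => ?_
  rw [offspring]
  ring

theorem summable_sq_offspring_iff (h1 : PhiDerivSummable C 1 τ) (hψ : psi C τ = 1) :
    (Summable fun k : ℕ => (k ^ 2 * offspring C τ k : ℝ)) ↔ PhiDerivSummable C 2 τ := by
  have hA := (phiDeriv_zero_pos hC hτ h0).ne'
  have hm := (hasSum_mul_offspring hτ h1 hψ).summable
  rw [phiDerivSummable_two_iff hτ.ne']
  constructor
  · intro h
    refine ((h.sub hm).mul_left (phiDeriv C 0 τ)).congr fun k => ?_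
    rw [offspring]
    field_simp
  · intro h
    refine ((h.div_const (phiDeriv C 0 τ)).add hm).congr fun k => ?_
    rw [offspring]
    field_simp
    ring

theorem hasSum_variance (h1 : PhiDerivSummable C 1 τ) (hψ : psi C τ = 1)
    (h2 : PhiDerivSummable C 2 τ) :
    HasSum (fun k : ℕ => ((k - 1) ^ 2 * offspring C τ k : ℝ))
      (τ ^ 2 * phiDeriv C 2 τ / phiDeriv C 0 τ) := by
  have e0 := hasSum_offspring hC hτ h0
  have e1 := hasSum_mul_offspring hτ h1 hψ
  have e2 := ((phiDerivSummable_two_iff hτ.ne').1 h2).hasSum.div_const (phiDeriv C 0 τ)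
  rw [← sq_mul_phiDeriv_two hτ.ne'] at e2
  have e3 := (e2.sub e1).add e0
  rw [sub_add_cancel] at e3
  refine e3.congr_fun fun k => ?_
  rw [offspring]
  ring

theorem count_eq_coeff_offspring {n : ℕ} (hn : 1 ≤ n) : (count C n : ℝ) =
    τ * (√n * PowerSeries.coeff (n - 1) ((PowerSeries.mk (offspring C τ)) ^ n)) *
      ((τ / phiDeriv C 0 τ) ^ (-(n : ℤ)) * (n : ℝ) ^ (-(3 / 2) : ℝ)) := by
  have hA := (phiDeriv_zero_pos hC hτ h0).ne'
  have hn' : (0 : ℝ) < n := by exact_mod_cast hn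
  have h1 := natCast_mul_count hC hn
  have h2 : √(n : ℝ) * (n : ℝ) ^ (-(3 / 2) : ℝ) = (n : ℝ)⁻¹ := by
    rw [Real.sqrt_eq_rpow, ← Real.rpow_add hn', ← Real.rpow_neg_one]
    norm_num
  have h3 : τ * (τ ^ (n - 1) / phiDeriv C 0 τ ^ n) * (τ / phiDeriv C 0 τ) ^ (-(n : ℤ)) = 1 := by
    rw [zpow_neg, zpow_natCast, div_pow, mul_div_assoc', ← pow_succ', Nat.sub_add_cancel hn]
    have := (pow_pos hτ n).ne'
    field_simp
  rw [coeff_offspring_pow, ← h1]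
  calc (count C n : ℝ) = (n : ℝ)⁻¹ * n * 1 * count C n := by
        rw [inv_mul_cancel₀ hn'.ne', one_mul, one_mul]
    _ = _ := by
        rw [← h2, ← h3]
        ring

end
end OuterplanarClass

end

theorem theorem4 (C : Set RootedMapClass) (hne : C.Nonempty)
    (hC : ∀ M : RootedMap, (Quotient.mk _ M : RootedMapClass) ∈ C →
      M.IsOuterplanar ∧ M.IsNonseparable) :
    0 < OuterplanarClass.rho C ∧
    Tendsto (fun t => (OuterplanarClass.psi C t : EReal)) (𝓝[<] OuterplanarClass.rho C)
      (𝓝 (OuterplanarClass.nu C)) ∧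
    (1 ≤ OuterplanarClass.nu C →
      ∃ τ ∈ Set.Ioc 0 (OuterplanarClass.rho C),
        (OuterplanarClass.PhiDerivSummable C 0 τ ∧ OuterplanarClass.PhiDerivSummable C 1 τ ∧
          OuterplanarClass.psi C τ = 1) ∧
        (∀ t ∈ Set.Ioc 0 (OuterplanarClass.rho C), OuterplanarClass.psi C t = 1 → t = τ) ∧
        (OuterplanarClass.PhiDerivSummable C 2 τ →
          (fun n : ℕ => (OuterplanarClass.count C n : ℝ))
            ~[atTop ⊓ 𝓟 {n : ℕ | n ≡ 1 [MOD OuterplanarClass.span C]}]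
          fun n : ℕ => (OuterplanarClass.span C : ℝ) *
            (OuterplanarClass.phiDeriv C 0 τ /
              (2 * Real.pi * OuterplanarClass.phiDeriv C 2 τ)) ^ (1 / 2 : ℝ) *
            (τ / OuterplanarClass.phiDeriv C 0 τ) ^ (-(n : ℤ)) * (n : ℝ) ^ (-(3 / 2) : ℝ)) ∧
        (¬ OuterplanarClass.PhiDerivSummable C 2 τ →
          (fun n : ℕ => (OuterplanarClass.count C n : ℝ))
            =o[atTop ⊓ 𝓟 {n : ℕ | n ≡ 1 [MOD OuterplanarClass.span C]}]
          fun n : ℕ => (τ / OuterplanarClass.phiDeriv C 0 τ) ^ (-(n : ℤ)) *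
            (n : ℝ) ^ (-(3 / 2) : ℝ))) := by
  open OuterplanarClass in
  refine ⟨rho_pos hC hne, tendsto_psi hC hne, fun hν => ?_⟩
  obtain ⟨τ, hτ, hψ⟩ := exists_psi_eq_one hC hne hν
  obtain ⟨h0, h1⟩ := summable_of_psi_eq_one hψ
  have hA := phiDeriv_zero_pos hC hτ.1 h0
  have hp := offspring_nonneg hC hτ.1 h0
  have hp0 := offspring_zero_pos hC hτ.1 h0
  have hsum := hasSum_offspring hC hτ.1 h0
  have hspan := setGcd_offspring hC hτ.1 h0
  have hs : span C ≠ 0 := by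
    obtain ⟨k, hk0, hk⟩ := exists_coeff_phiSeries_pos hC hne
    intro h
    exact hk0 (by simpa using Nat.setGcd_eq_zero_iff.1 h hk.ne')
  have hs' : Nat.setGcd {k | offspring C τ k ≠ 0} ≠ 0 := by rwa [hspan]
  have hspos : (0 : ℝ) < span C := by exact_mod_cast Nat.pos_of_ne_zero hs
  have hpi := Real.pi_pos
  have hcount : (fun n : ℕ => τ *
      (√n * PowerSeries.coeff (n - 1) ((PowerSeries.mk (offspring C τ)) ^ n)) *
      ((τ / phiDeriv C 0 τ) ^ (-(n : ℤ)) * (n : ℝ) ^ (-(3 / 2) : ℝ)))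
      =ᶠ[atTop ⊓ 𝓟 {n : ℕ | n ≡ 1 [MOD span C]}] fun n : ℕ => (count C n : ℝ) := by
    filter_upwards [(eventually_ge_atTop 1).filter_mono inf_le_left] with n hn
    exact (count_eq_coeff_offspring hC hτ.1 h0 hn).symm
  refine ⟨τ, hτ, ⟨h0, h1, hψ⟩, fun t ht h => eq_of_psi_eq_one hC hne ht.1 hτ.1 h hψ,
    fun h2 => ?_, fun h2 => ?_⟩
  · have hv := hasSum_variance hC hτ.1 h0 h1 hψ h2
    -- the term at `0` alone is positive
    have hvpos : 0 < τ ^ 2 * phiDeriv C 2 τ / phiDeriv C 0 τ := by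
      refine lt_of_lt_of_le hp0 ?_
      have := le_hasSum hv 0 fun k _ => mul_nonneg (sq_nonneg _) (hp k)
      simpa using this
    have hlim := tendsto_sqrt_mul_coeff_pow_of_variance hp hsum hp0 hs'
      (hasSum_mul_offspring hτ.1 h1 hψ) hvpos hv
    rw [hspan] at hlim
    have hφ2 : 0 < phiDeriv C 2 τ := by
      have h3 := (div_pos_iff_of_pos_right hA).1 hvpos
      exact pos_of_mul_pos_right h3 (by positivity)
    have hconst : τ * (span C * (1 / (2 * Real.pi *
        (τ ^ 2 * phiDeriv C 2 τ / phiDeriv C 0 τ))) ^ (1 / 2 : ℝ)) =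
        span C * (phiDeriv C 0 τ / (2 * Real.pi * phiDeriv C 2 τ)) ^ (1 / 2 : ℝ) := by
      rw [mul_left_comm]
      congr 1
      rw [← Real.sqrt_eq_rpow, ← Real.sqrt_eq_rpow]
      have hτ0 := hτ.1
      conv_lhs => rw [← Real.sqrt_sq hτ0.le, ← Real.sqrt_mul (by positivity)]
      congr 1
      rw [Real.sqrt_sq hτ0.le]
      field_simp
    have hlim2 := hlim.const_mul τ
    rw [hconst] at hlim2
    have hne0 : span C * (phiDeriv C 0 τ / (2 * Real.pi * phiDeriv C 2 τ)) ^ (1 / 2 : ℝ) ≠ 0 := by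
      positivity
    have h5 := ((isEquivalent_const_iff_tendsto hne0).2 hlim2).mul
      (IsEquivalent.refl (u := fun n : ℕ => (τ / phiDeriv C 0 τ) ^ (-(n : ℤ)) *
        (n : ℝ) ^ (-(3 / 2) : ℝ)))
    refine (h5.congr_left hcount).trans (EventuallyEq.isEquivalent (Eventually.of_forall fun n => ?_))
    simp only [Pi.mul_apply, Function.const_apply, mul_assoc]
  · have hv : ¬ Summable fun k : ℕ => (k ^ 2 * offspring C τ k : ℝ) := fun h =>
      h2 ((summable_sq_offspring_iff hC hτ.1 h0 h1 hψ).1 h)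
    have hlim := (tendsto_sqrt_mul_coeff_pow_of_not_summable hp hsum hp0 hs' hv).const_mul τ
    rw [hspan, mul_zero] at hlim
    have h5 := ((isLittleO_one_iff ℝ).2 hlim).mul_isBigO
      (isBigO_refl (fun n : ℕ => (τ / phiDeriv C 0 τ) ^ (-(n : ℤ)) * (n : ℝ) ^ (-(3 / 2) : ℝ)) _)
    simp only [one_mul] at h5
    exact h5.congr' hcount EventuallyEq.rfl
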